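/- Conventions. A cylindric algebra of dimension $\alpha$ ($\mathsf{CA}_\alpha$) is a Boolean algebra with cylindrifications $\mathsf c_i$ and diagonal elements $\mathsf d_{ij}$ $(i,j<\alpha)$ satisfying the usual axioms: $\mathsf c_i0=0$; $x\le \mathsf c_ix$; $\mathsf c_i(x\cdot \mathsf c_iy)=\mathsf c_ix\cdot \mathsf c_iy$; $\mathsf c_i\mathsf c_jx=\mathsf c_j\mathsf c_ix$; $\mathsf d_{ii}=1$; $\mathsf d_{ij}=\mathsf c_k(\mathsf d_{ik}\cdot \mathsf d_{kj})$ for $k\ne i,j$; $\mathsf c_i(\mathsf d_{ij}\cdot x)\cdot \mathsf c_i(\mathsf d_{ij}\cdot -x)=0$ for $i\neq j$. Put $\Delta x=\{i:\mathsf c_ix\ne x\}$, $\mathsf q_ix=-\mathsf c_i{-x}$, $\mathsf s^i_jx=\mathsf c_i(\mathsf d_{ij}\cdot x)$ and $x\leftrightarrow y=(-x+y)\cdot(-y+x)$. A topological cylindric algebra ($\mathsf{TCA}_\alpha$) is a $\mathsf{CA}_\alpha$ with additional unary operations $I_i$ $(i<\alpha)$ such that $\mathsf q_i(x\leftrightarrow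 y)\le \mathsf q_i(I_ix\leftrightarrow I_iy)$; $I_ix\le x$; $I_ix\cdot I_iy=I_i(x\cdot y)$; $I_ix\le I_iI_ix$; $I_i1=1$; $\mathsf c_kI_ix=I_ix$ if $k\neq i$, $k\notin\Delta x$; and $\mathsf s^i_jI_ix=I_j\mathsf s^i_jx$ if $j\notin\Delta x$. Its cylindric reduct $\mathfrak{Rd}_{ca}$ forgets the $I_i$; its $\mathsf{Df}$ reduct keeps only the Boolean operations and the $\mathsf c_i$. For $\mathfrak B\in\mathsf{TCA}_\omega$ and $n<\omega$, $\mathfrak{Nr}_n\mathfrak B$ is the algebra with universe $\{b:\Delta b\subseteq n\}$ and the operations of $\mathfrak B$ with indices below $n$; $\mathsf{Nr}_n\mathsf{TCA}_\omega$ is the class of algebras isomorphic to some $\mathfrak{Nr}_n\mathfrak B$, $\mathfrak B\in \mathsf{TCA}_\omega$. A representation of an algebra $\mathfrak A$ of dimension $n$ is an injective homomorphism $f:\mathfrak A\to\wp(V)$, where $V$ is a disjoint union $\bigsqcup_{t}{}^nU_t$ of Cartesian spaces; on $\wp(V)$ the $\mathsf c_i$ and $\mathsf d_{ij}$ are the usual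 ones of set algebras, and (for topological algebras) each $U_t$ is a topological space and $I_i(X)=\{s\in {}^nU_t: s_i\in\mathrm{int}\{a\in U_t: s^i_a\in X\}\}$ in each component, $s^i_a$ being $s$ with $i$-th coordinate changed to $a$. For $\mathsf{Df}$ reducts $V$ is a disjoint union of products $U_{t,0}\times\dots\times U_{t,n-1}$, and $f$ is required to preserve only the Boolean operations and the $\mathsf c_i$. A representation is complete if $f(\prod X)=\bigcap f[X]$ whenever $\prod X$ exists in $\mathfrak A$. An algebra is (completely) representable if it has a (complete) representation. An atomic algebra $\mathfrak A$ is strongly representable if it is completely additive (all $\mathsf c_i$ and, for topological algebras, all duals $-I_i-$ preserve existing suprema) and the complex algebra of its atom structure is representable. For a class $\mathsf K$, $\mathsf{Up}\,\mathsf K$ is the class of algebras isomorphic to ultraproducts of members of $\mathsf K$, and $\mathsf{Ur}\,\mathsf K$ is the class of algebras having an ultrapower isomorphic to a member of $\mathsf K$. **Theorem.** (1) Let $2<n<\omega$. There is an atomic uncountable algebra $\mathfrak A\in\mathsf{Nr}_n\mathsf{TCA}_\omega$ that is not completely representable, and whose $\mathsf{Df}$ reduct is not completely representable either. Uncountability is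 necessary: every atomic algebra in $\mathsf{Nr}_n\mathsf{TCA}_\omega$ that is not completely representable is uncountable. (2) Let $1<n<\omega$. There is a countable $\mathfrak A\in\mathsf{TCA}_n$ that is completely representable and strongly representable, but does not belong to $\mathsf{Up}\,\mathsf{Ur}\,\mathsf{Nr}_n\mathsf{TCA}_\omega$; in particular $\mathfrak A\notin\mathsf{Nr}_n\mathsf{TCA}_\omega$. (3) Let $n<\omega$. If $\mathfrak A\in\mathsf{Nr}_n\mathsf{TCA}_\omega$ is atomic, then its cylindric reduct $\mathfrak{Rd}_{ca}\mathfrak A$ is strongly representable. -/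

import Mathlib

universe u

/-- An algebra of the similarity type of cylindric algebras of dimension `α`:
a Boolean algebra with cylindrifications `c i` and diagonal elements `d i j`. -/
structure CylSig (α : Type) where
  carrier : Type u
  [ba : BooleanAlgebra carrier]
  c : α → carrier → carrier
  d : α → α → carrier

/-- An algebra of the similarity type of topological cylindric algebras of dimension `α`:
in addition to the cylindric operations there are unary operations `I i`. Its cylindric reduct
is `toCylSig`. -/
structure TopCylSig (α : Type) extends CylSig.{u} α where
  I : α → carrier → carrier

instance {α : Type} : CoeSort (CylSig.{u} α) (Type u) := ⟨CylSig.carrier⟩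

instance {α : Type} : CoeSort (TopCylSig.{u} α) (Type u) := ⟨fun A => A.carrier⟩

instance {α : Type} (A : CylSig.{u} α) : BooleanAlgebra A.carrier := A.ba

namespace CylSig

variable {α : Type}

/-- The dimension set of an element. -/
def dimSet (A : CylSig.{u} α) (x : A) : Set α := {i | A.c i x ≠ x}

/-- The dual `q i` of the cylindrification `c i`. -/
def q (A : CylSig.{u} α) (i : α) (x : A) : A := (A.c i xᶜ)ᶜ

/-- The substitution of `j` for `i`. -/
def s (A : CylSig.{u} α) (i j : α) (x : A) : A := A.c i (A.d i j ⊓ x)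

/-- The axioms of cylindric algebras of dimension `α`. -/
structure IsCA (A : CylSig.{u} α) : Prop where
  c_bot : ∀ i, A.c i ⊥ = ⊥
  le_c : ∀ i (x : A), x ≤ A.c i x
  c_inf_c : ∀ i (x y : A), A.c i (x ⊓ A.c i y) = A.c i x ⊓ A.c i y
  c_comm : ∀ i j (x : A), A.c i (A.c j x) = A.c j (A.c i x)
  d_self : ∀ i, A.d i i = ⊤
  d_eq : ∀ i j k, k ≠ i → k ≠ j → A.d i j = A.c k (A.d i k ⊓ A.d k j)
  c_d : ∀ i j (x : A), i ≠ j → A.c i (A.d i j ⊓ x) ⊓ A.c i (A.d i j ⊓ xᶜ) = ⊥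

/-- Homomorphisms of algebras of the cylindric similarity type. -/
structure IsHom (A B : CylSig.{u} α) (f : BoundedLatticeHom A B) : Prop where
  map_c : ∀ i x, f (A.c i x) = B.c i (f x)
  map_d : ∀ i j, f (A.d i j) = B.d i j

/-- The full generalized cylindric set algebra with bases `U t`, `t : ι`. Its unit is the disjoint
union over `t` of the Cartesian spaces of all sequences `α → U t`. -/
abbrev genSet [DecidableEq α] (ι : Type u) (U : ι → Type u) : CylSig.{u} α where
  carrier := Set (Σ t : ι, α → U t)
  c i X := {p | ∃ a : U p.1, ⟨p.1, Function.update p.2 i a⟩ ∈ X}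
  d i j := {p | p.2 i = p.2 j}

/-- `A` is representable: there is an injective homomorphism of `A` into a full generalized
cylindric set algebra. -/
def Representable [DecidableEq α] (A : CylSig.{u} α) : Prop :=
  ∃ (ι : Type u) (U : ι → Type u) (f : BoundedLatticeHom A (genSet (α := α) ι U)),
    Function.Injective f ∧ IsHom A (genSet ι U) f

/-- The complex algebra of the atom structure of `A`. -/
abbrev cmAt (A : CylSig.{u} α) : CylSig.{u} α where
  carrier := Set {a : A // IsAtom a}
  c i X := {a | ∃ b ∈ X, a.1 ≤ A.c i b.1}
  d i j := {a | a.1 ≤ A.d i j}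

/-- The cylindrifications preserve all existing suprema. -/
def CompletelyAdditive (A : CylSig.{u} α) : Prop :=
  ∀ i (X : Set A) (x : A), IsLUB X x → IsLUB (A.c i '' X) (A.c i x)

/-- `A` is strongly representable: it is atomic and completely additive, and the complex algebra
of its atom structure is representable. -/
def StronglyRepresentable [DecidableEq α] (A : CylSig.{u} α) : Prop :=
  IsAtomic A ∧ A.CompletelyAdditive ∧ A.cmAt.Representable

/-- The diagonal-free reduct of `A` (Boolean operations and cylindrifications only) is completely
representable: there is an injective homomorphism into the power set of a disjoint union of
Cartesian products `∏ k, U t k`, which preserves all existing infima. -/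
def DfCompletelyRepresentable [DecidableEq α] (A : CylSig.{u} α) : Prop :=
  ∃ (ι : Type u) (U : ι → α → Type u)
    (f : BoundedLatticeHom A (Set (Σ t : ι, ∀ k : α, U t k))),
    Function.Injective f ∧
    (∀ i x, f (A.c i x) = {p | ∃ a : U p.1 i, ⟨p.1, Function.update p.2 i a⟩ ∈ f x}) ∧
    ∀ (X : Set A) (x : A), IsGLB X x → f x = ⋂ y ∈ X, f y

end CylSig

namespace TopCylSig

variable {α : Type}

/-- The axioms of topological cylindric algebras of dimension `α`. -/
structure IsTCA (A : TopCylSig.{u} α) : Prop extends A.toCylSig.IsCA where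
  I_congr : ∀ i (x y : A),
    A.q i ((xᶜ ⊔ y) ⊓ (yᶜ ⊔ x)) ≤ A.q i (((A.I i x)ᶜ ⊔ A.I i y) ⊓ ((A.I i y)ᶜ ⊔ A.I i x))
  I_le : ∀ i (x : A), A.I i x ≤ x
  I_inf : ∀ i (x y : A), A.I i x ⊓ A.I i y = A.I i (x ⊓ y)
  I_le_I_I : ∀ i (x : A), A.I i x ≤ A.I i (A.I i x)
  I_top : ∀ i, A.I i ⊤ = ⊤
  c_I : ∀ i k (x : A), k ≠ i → k ∉ A.dimSet x → A.c k (A.I i x) = A.I i x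
  s_I : ∀ i j (x : A), j ∉ A.dimSet x → A.s i j (A.I i x) = A.I j (A.s i j x)

/-- Homomorphisms of algebras of the topological cylindric similarity type. -/
structure IsHom (A B : TopCylSig.{u} α) (f : BoundedLatticeHom A B) : Prop
    extends CylSig.IsHom A.toCylSig B.toCylSig f where
  map_I : ∀ i x, f (A.I i x) = B.I i (f x)

/-- The full generalized topological cylindric set algebra whose bases are the topological spaces
`U t`, `t : ι`; the operation `I i` takes interiors along the `i`-th coordinate. -/
abbrev genSet [DecidableEq α] (ι : Type u) (U : ι → Type u) [∀ t, TopologicalSpace (U t)] :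
    TopCylSig.{u} α where
  toCylSig := CylSig.genSet ι U
  I i (X : Set (Σ t : ι, α → U t)) :=
    ({p | p.2 i ∈ interior {a : U p.1 | ⟨p.1, Function.update p.2 i a⟩ ∈ X}} :
      Set (Σ t : ι, α → U t))

/-- `A` is representable: there is an injective homomorphism of `A` into a full generalized
topological cylindric set algebra. -/
def Representable [DecidableEq α] (A : TopCylSig.{u} α) : Prop :=
  ∃ (ι : Type u) (U : ι → Type u) (_ : ∀ t, TopologicalSpace (U t))
    (f : BoundedLatticeHom A (genSet (α := α) ι U)),
    Function.Injective f ∧ IsHom A (genSet ι U) f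

/-- `A` is completely representable: it has a representation that carries every existing infimum
to the intersection. -/
def CompletelyRepresentable [DecidableEq α] (A : TopCylSig.{u} α) : Prop :=
  ∃ (ι : Type u) (U : ι → Type u) (_ : ∀ t, TopologicalSpace (U t))
    (f : BoundedLatticeHom A (genSet (α := α) ι U)),
    Function.Injective f ∧ IsHom A (genSet ι U) f ∧
    ∀ (X : Set A) (x : A), IsGLB X x →
      (f x : Set (Σ t : ι, α → U t)) = ⋂ y ∈ X, (f y : Set (Σ t : ι, α → U t))

/-- The operator dual to `I i`. -/
def dia (A : TopCylSig.{u} α) (i : α) (x : A) : A := (A.I i xᶜ)ᶜ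

/-- The complex algebra of the atom structure of `A`. The atom structure has, besides the relations
for the cylindrifications and diagonals, the relations `a ≤ dia i b`, and the dual of `I i` is the
completely additive operator that this relation defines. -/
abbrev cmAt (A : TopCylSig.{u} α) : TopCylSig.{u} α where
  toCylSig := A.toCylSig.cmAt
  I i (X : Set {a : A // IsAtom a}) :=
    ({a | ∃ b ∈ Xᶜ, a.1 ≤ A.dia i b.1} : Set {a : A // IsAtom a})ᶜ

/-- The cylindrifications and the duals of the `I i` preserve all existing suprema. -/
def CompletelyAdditive (A : TopCylSig.{u} α) : Prop :=
  A.toCylSig.CompletelyAdditive ∧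
    ∀ i (X : Set A) (x : A), IsLUB X x → IsLUB (A.dia i '' X) (A.dia i x)

/-- `A` is strongly representable: it is atomic and completely additive, and the complex algebra
of its atom structure is representable. -/
def StronglyRepresentable [DecidableEq α] (A : TopCylSig.{u} α) : Prop :=
  IsAtomic A ∧ A.CompletelyAdditive ∧ A.cmAt.Representable

/-- The reduct of an `ω`-dimensional algebra to the operations with indices below `n`. -/
abbrev rd (n : ℕ) (B : TopCylSig.{u} ℕ) : TopCylSig.{u} (Fin n) where
  carrier := B.carrier
  ba := B.ba
  c i := B.c i
  d i j := B.d i j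
  I i := B.I i

/-- `A` belongs to the class of neat `n`-reducts of `ω`-dimensional topological cylindric algebras:
for such an algebra `B`, `A` is isomorphic to the subalgebra of `B.rd n` whose universe consists of
the elements with dimension set included in `n = {0, …, n - 1}`. -/
def IsNeatReduct (n : ℕ) (A : TopCylSig.{u} (Fin n)) : Prop :=
  ∃ B : TopCylSig.{u} ℕ, B.IsTCA ∧ ∃ f : BoundedLatticeHom A (B.rd n),
    Function.Injective f ∧ IsHom A (B.rd n) f ∧
      Set.range f = {b : B | B.dimSet b ⊆ Set.Iio n}

/-- Operation symbols of topological cylindric algebras of dimension `α`. -/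
inductive Op (α : Type) : ℕ → Type
  | bot : Op α 0
  | top : Op α 0
  | d : α → α → Op α 0
  | compl : Op α 1
  | c : α → Op α 1
  | I : α → Op α 1
  | sup : Op α 2
  | inf : Op α 2

/-- The first-order language of topological cylindric algebras of dimension `α`. -/
def lang (α : Type) : FirstOrder.Language.{0, 0} := ⟨Op α, fun _ => Empty⟩

/-- The interpretation of an operation symbol in an algebra. -/
def interp (A : TopCylSig.{u} α) : ∀ {k : ℕ}, Op α k → (Fin k → A) → A
  | _, .bot, _ => ⊥
  | _, .top, _ => ⊤
  | _, .d i j, _ => A.d i j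
  | _, .compl, v => (v 0)ᶜ
  | _, .c i, v => A.c i (v 0)
  | _, .I i, v => A.I i (v 0)
  | _, .sup, v => v 0 ⊔ v 1
  | _, .inf, v => v 0 ⊓ v 1

instance instStructure (A : TopCylSig.{u} α) : (lang α).Structure A.carrier where
  funMap F v := A.interp F v
  RelMap R _ := R.elim

/-- `Up K`: the algebras isomorphic to an ultraproduct of members of `K`. -/
def Up (K : TopCylSig.{u} α → Prop) (A : TopCylSig.{u} α) : Prop :=
  ∃ (J : Type u) (G : Ultrafilter J) (C : J → TopCylSig.{u} α), (∀ j, K (C j)) ∧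
    Nonempty ((lang α).Equiv ((G : Filter J).Product fun j => (C j).carrier) A.carrier)

/-- `Ur K`: the ultraroots of members of `K`, that is, the algebras with an ultrapower isomorphic
to a member of `K`. -/
def Ur (K : TopCylSig.{u} α → Prop) (A : TopCylSig.{u} α) : Prop :=
  ∃ (J : Type u) (G : Ultrafilter J) (C : TopCylSig.{u} α), K C ∧
    Nonempty ((lang α).Equiv ((G : Filter J).Product fun _ => A.carrier) C.carrier)

end TopCylSig

/-! ### Arithmetic of cylindrifications and diagonals. -/

namespace CylSig

variable {α : Type} {A : CylSig.{u} α}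

/-! Counterexample for (1). Take more than continuum many labels and a graph with labelled vertices,
some of whose edges are coloured by natural numbers, without monochromatic triangles and realizing
every admissible finite one-point extension. The `n`-ary relations that depend only on equalities,
labels and the first `N` colours, for some `N`, form a field of sets; over the discrete topology all
`I i` are the identity. It is the neat reduct of the analogous `ω`-dimensional field. Missing
colours of a finite configuration can be supplied by large ones, so totally coloured configurations
are dense and their types are atoms (`isAtomic_fieldFin`). Hence the diagonal of two coordinates
together with their colour relations has supremum `⊤`, and a complete representation would colour
all pairs of distinct labels without a monochromatic triangle. By `mk_le_continuum_of_no_triangle`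
there are too many labels for that. The argument uses three coordinates and survives the loss of the
diagonals.

Counterexample for (2). Over a base of `n` pairs, let parity split the sequences that visit the
pairs in their natural order, and split no other arrangement. A spare dimension would allow two
coordinates to be interchanged, carrying the splitting to another arrangement, so this is no neat
reduct. The algebra is finite, so ultraproducts and ultraroots change nothing; its field is closed
under intersections, so both kinds of representation are immediate.

Positive claims. Let `f` map `A` onto the neat reduct of `B`. A model is built by forcing with
elements of `B`: coordinates above `n` are names of points, coordinate `n` is a variable for
describing open sets, and conditions are nonzero finite-dimensional elements independent of the
coordinates up to `n`. Deciding an atom at given names is dense because every element of `B` of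
dimension set below `n` comes from `A` (`exists_atom`); fresh coordinates provide witnesses. A
descending sequence of conditions meeting countably many dense sets yields a space in which every
`n`-sequence satisfies an atom (`exists_isAtomModel`). If `A` is countable, every element can be
treated, and such models form a complete representation. For (3), arbitrary sets of atoms need
witnesses; finitely many are treated at a time, without interiors, and an ultraproduct over the
finite families represents the complex algebra. -/

theorem notMem_dimSet {x : A} {i : α} : i ∉ A.dimSet x ↔ A.c i x = x := not_not

namespace IsCA

variable (h : A.IsCA)
include h

theorem c_top (i : α) : A.c i (⊤ : A) = ⊤ := top_le_iff.1 (h.le_c i ⊤)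

theorem c_c (i : α) (x : A) : A.c i (A.c i x) = A.c i x := by
  have := h.c_inf_c i ⊤ x
  rwa [top_inf_eq, h.c_top, top_inf_eq] at this

/-- Both sides say that `A.c i x ⊓ A.c i y = ⊥`, because a cylindrification is `⊥` only at `⊥`. This
self-conjugacy is the source of the closure of fixed elements under complement and of complete
additivity. -/
theorem c_disjoint {i : α} {x y : A} : Disjoint (A.c i x) y ↔ Disjoint x (A.c i y) := by
  have key : ∀ z : A, A.c i z = ⊥ ↔ z = ⊥ := fun z =>
    ⟨fun hz => le_bot_iff.1 (hz ▸ h.le_c i z), fun hz => hz ▸ h.c_bot i⟩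
  rw [disjoint_iff, disjoint_iff, ← key (x ⊓ _), h.c_inf_c, ← key (_ ⊓ y), inf_comm _ y,
    h.c_inf_c, inf_comm]

theorem c_le_iff {i : α} {x y : A} (hy : A.c i y = y) : A.c i x ≤ y ↔ x ≤ y := by
  refine ⟨(h.le_c i x).trans, fun hxy => ?_⟩
  have h1 : A.c i yᶜ ≤ yᶜ := by
    rw [le_compl_iff_disjoint_right, h.c_disjoint, hy]
    exact disjoint_compl_left
  rw [← disjoint_compl_right_iff, h.c_disjoint]
  exact (disjoint_compl_right_iff.2 hxy).mono_right h1

theorem c_mono {i : α} {x y : A} (hxy : x ≤ y) : A.c i x ≤ A.c i y :=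
  (h.c_le_iff (h.c_c i y)).2 (hxy.trans (h.le_c i y))

theorem fixed_compl {i : α} {x : A} (hx : A.c i x = x) : A.c i xᶜ = xᶜ := by
  refine le_antisymm ?_ (h.le_c i _)
  rw [le_compl_iff_disjoint_right, h.c_disjoint, hx]
  exact disjoint_compl_left

theorem c_inf_right {i : α} {x y : A} (hy : A.c i y = y) : A.c i (x ⊓ y) = A.c i x ⊓ y := by
  conv_lhs => rw [← hy]
  rw [h.c_inf_c, hy]

theorem c_inf_left {i : α} {x y : A} (hx : A.c i x = x) : A.c i (x ⊓ y) = x ⊓ A.c i y := by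
  rw [inf_comm, h.c_inf_right hx, inf_comm]

theorem fixed_inf {i : α} {x y : A} (hx : A.c i x = x) (hy : A.c i y = y) :
    A.c i (x ⊓ y) = x ⊓ y := by
  rw [h.c_inf_right hy, hx]

theorem fixed_c {i j : α} {x : A} (hx : A.c i x = x) : A.c i (A.c j x) = A.c j x := by
  rw [h.c_comm, hx]

theorem c_eq_bot {i : α} {x : A} : A.c i x = ⊥ ↔ x = ⊥ :=
  ⟨fun hz => le_bot_iff.1 (hz ▸ h.le_c i x), fun hz => hz ▸ h.c_bot i⟩

theorem fixed_d {i j k : α} (hi : k ≠ i) (hj : k ≠ j) : A.c k (A.d i j) = A.d i j := by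
  rw [h.d_eq i j k hi hj, h.c_c]

/-- By `d_eq`, `A.c i (A.d i j ⊓ A.d j i) = ⊤`, so `c_d` leaves no room for `A.d i j` outside `A.d j
i`. -/
theorem d_le_symm (i j : α) : A.d i j ≤ A.d j i := by
  rcases eq_or_ne i j with rfl | hij
  · exact le_rfl
  have h1 := h.d_eq j j i hij hij
  have h2 := h.c_d i j (A.d j i) hij
  rw [h.d_self, inf_comm] at h1
  rw [← h1, top_inf_eq, h.c_eq_bot] at h2
  exact disjoint_compl_right_iff.1 (disjoint_iff.2 h2)

theorem d_symm (i j : α) : A.d i j = A.d j i := le_antisymm (h.d_le_symm i j) (h.d_le_symm j i)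

theorem c_d_top {i j : α} (hij : i ≠ j) : A.c i (A.d i j) = ⊤ := by
  have h1 := h.d_eq j j i hij hij
  rw [h.d_self] at h1
  exact top_le_iff.1 (h1.le.trans (h.c_mono inf_le_right))

theorem d_trans (i j k : α) : A.d i j ⊓ A.d j k ≤ A.d i k := by
  rcases eq_or_ne j i with rfl | hi
  · exact inf_le_right
  rcases eq_or_ne j k with rfl | hk
  · exact inf_le_left
  rw [h.d_eq i k j hi hk]
  exact h.le_c _ _

theorem d_inf_c_d_le {i j : α} (hij : i ≠ j) (x : A) : A.d i j ⊓ A.c i (A.d i j ⊓ x) ≤ x := by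
  rw [← disjoint_compl_right_iff, disjoint_iff, ← le_bot_iff, ← h.c_d i j x hij]
  refine le_inf (inf_le_left.trans inf_le_right) (le_trans ?_ (h.le_c _ _))
  exact inf_le_inf_right _ inf_le_left

theorem completelyAdditive : A.CompletelyAdditive := by
  refine fun i X x hx => ⟨?_, fun w hw => ?_⟩
  · rintro _ ⟨y, hy, rfl⟩
    exact h.c_mono (hx.1 hy)
  · rw [← disjoint_compl_right_iff, h.c_disjoint, ← le_compl_iff_disjoint_right]
    refine hx.2 fun y hy => ?_
    rw [le_compl_iff_disjoint_right, ← h.c_disjoint, disjoint_compl_right_iff]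
    exact hw ⟨y, hy, rfl⟩

end IsCA

/-- Successive cylindrification along a list of coordinates. -/
def cList (A : CylSig.{u} α) (l : List α) (x : A) : A := l.foldr A.c x

theorem cList_cons (i : α) (l : List α) (x : A) : A.cList (i :: l) x = A.c i (A.cList l x) := rfl

namespace IsCA

variable (h : A.IsCA)
include h

theorem le_cList (l : List α) (x : A) : x ≤ A.cList l x := by
  induction l with
  | nil => exact le_rfl
  | cons i l ih => exact ih.trans (h.le_c i _)

theorem cList_inf_left {l : List α} {x y : A} (hx : ∀ i ∈ l, A.c i x = x) :
    A.cList l (x ⊓ y) = x ⊓ A.cList l y := by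
  induction l with
  | nil => rfl
  | cons i l ih =>
    rw [cList_cons, ih fun j hj => hx j (by simp [hj]), h.c_inf_left (hx i (by simp)), cList_cons]

theorem cList_fixed_of_fixed {l : List α} {i : α} {x : A} (hx : A.c i x = x) :
    A.c i (A.cList l x) = A.cList l x := by
  induction l with
  | nil => exact hx
  | cons j l ih => exact h.fixed_c ih

theorem cList_fixed_of_mem {l : List α} {i : α} (hi : i ∈ l) (x : A) :
    A.c i (A.cList l x) = A.cList l x := by
  induction l with
  | nil => simp at hi
  | cons j l ih =>
    rcases eq_or_ne i j with rfl | hij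
    · exact h.c_c _ _
    · exact h.fixed_c (ih (by simpa [hij] using hi))

theorem cList_eq_bot {l : List α} {x : A} : A.cList l x = ⊥ ↔ x = ⊥ := by
  induction l with
  | nil => exact Iff.rfl
  | cons i l ih => rw [cList_cons, h.c_eq_bot, ih]

theorem fixed_finset_inf {ι : Type*} (S : Finset ι) (g : ι → A) {i : α}
    (hg : ∀ t ∈ S, A.c i (g t) = g t) : A.c i (S.inf g) = S.inf g := by
  classical
  induction S using Finset.induction_on with
  | empty => exact h.c_top i
  | insert a S ha ih =>
    rw [Finset.inf_insert]
    exact h.fixed_inf (hg a (by simp)) (ih fun t ht => hg t (by simp [ht]))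

end IsCA
end CylSig

/-! ### Arithmetic of the interior operators. -/

namespace TopCylSig.IsTCA

variable {α : Type} {A : TopCylSig.{u} α} (h : A.IsTCA)
include h

/-- Monotonicity of `I i` relative to a parameter `e` not involving `i`: below `e` the elements `x`
and `x ⊓ y` agree, and since `e` is fixed by `c i`, the axiom `I_congr` transfers this agreement to
their interiors. -/
theorem inf_I_le {i : α} {e x y : A} (he : A.c i e = e) (hxy : e ⊓ x ≤ y) :
    e ⊓ A.I i x ≤ A.I i y := by
  have h1 : e ≤ (xᶜ ⊔ (x ⊓ y)) ⊓ ((x ⊓ y)ᶜ ⊔ x) := by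
    refine le_inf ?_ ?_
    · rw [sup_inf_left, compl_sup_eq_top, top_inf_eq, sup_comm, ← himp_eq, le_himp_iff]
      exact hxy
    · rw [compl_inf, sup_assoc, sup_comm, sup_assoc]; simp
  have h2 : e ≤ A.q i ((xᶜ ⊔ (x ⊓ y)) ⊓ ((x ⊓ y)ᶜ ⊔ x)) := by
    unfold CylSig.q
    rw [le_compl_comm, h.toIsCA.c_le_iff (h.toIsCA.fixed_compl he)]
    exact compl_le_compl h1
  have h3 := (h2.trans (h.I_congr i x (x ⊓ y)))
  unfold CylSig.q at h3
  have h4 := h3.trans (compl_le_compl (h.toIsCA.le_c i _))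
  rw [compl_compl] at h4
  have h5 := h4.trans inf_le_left
  rw [sup_comm, ← himp_eq, le_himp_iff, ← h.I_inf] at h5
  exact h5.trans inf_le_right

theorem inf_I_congr {i : α} {e x y : A} (he : A.c i e = e) (hxy : e ⊓ x = e ⊓ y) :
    e ⊓ A.I i x = e ⊓ A.I i y :=
  le_antisymm (le_inf inf_le_left (h.inf_I_le he (hxy.le.trans inf_le_right)))
    (le_inf inf_le_left (h.inf_I_le he (hxy.ge.trans inf_le_right)))

theorem I_finset_inf {ι : Type*} (S : Finset ι) (g : ι → A) (i : α) :
    A.I i (S.inf g) = S.inf fun t => A.I i (g t) := by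
  classical
  induction S using Finset.induction_on with
  | empty => exact h.I_top i
  | insert a S ha ih => rw [Finset.inf_insert, Finset.inf_insert, ← h.I_inf, ih]

theorem fixed_I {i k : α} {x : A} (hk : k ≠ i) (hx : A.c k x = x) : A.c k (A.I i x) = A.I i x :=
  h.c_I i k x hk (CylSig.notMem_dimSet.2 hx)

/-- The interior along `j` of the renaming of `x` from `i` to `j` is the renaming of the
interior. -/
theorem d_inf_I_s {i j : α} (hij : i ≠ j) {x : A} (hx : A.c j x = x) :
    A.d i j ⊓ A.I j (A.s i j x) = A.d i j ⊓ A.I i x := by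
  rw [← h.s_I i j x (CylSig.notMem_dimSet.2 hx)]
  refine le_antisymm (le_inf inf_le_left (h.toIsCA.d_inf_c_d_le hij _)) 
    (le_inf inf_le_left (h.toIsCA.le_c _ _))

end TopCylSig.IsTCA

/-! ### Cylindric fields of sets over a discrete base. -/

/-- A field of sets of `α`-sequences over `M` that contains the diagonals and is closed under
cylindrifications. -/
structure CylField (α : Type) [DecidableEq α] (M : Type u) where
  sets : BooleanSubalgebra (Set (α → M))
  c_mem : ∀ i, ∀ X ∈ sets, {s : α → M | ∃ a, Function.update s i a ∈ X} ∈ sets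
  d_mem : ∀ i j, {s : α → M | s i = s j} ∈ sets

namespace CylField

variable {α : Type} [DecidableEq α] {M : Type u} (L : CylField α M)

/-- The topological cylindric algebra of a cylindric field of sets over a discrete base. -/
@[reducible] def toAlg : TopCylSig.{u} α where
  carrier := L.sets
  c i X := ⟨_, L.c_mem i X.1 X.2⟩
  d i j := ⟨_, L.d_mem i j⟩
  I _ X := X

theorem le_iff {X Y : L.sets} : X ≤ Y ↔ ∀ s ∈ X.1, s ∈ Y.1 := Iff.rfl

theorem ext_iff {X Y : L.sets} : X = Y ↔ ∀ s, s ∈ X.1 ↔ s ∈ Y.1 := by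
  rw [Subtype.ext_iff, Set.ext_iff]

theorem mem_inf {X Y : L.sets} {s : α → M} : s ∈ (X ⊓ Y).1 ↔ s ∈ X.1 ∧ s ∈ Y.1 := Iff.rfl

theorem mem_compl {X : L.sets} {s : α → M} : s ∈ (Xᶜ).1 ↔ s ∉ X.1 := Iff.rfl

theorem isCA : L.toAlg.toCylSig.IsCA where
  c_bot i := L.ext_iff.2 fun s => ⟨fun ⟨_, ha⟩ => ha, fun hs => hs.elim⟩
  le_c i X := L.le_iff.2 fun s hs => ⟨s i, by rwa [Function.update_eq_self]⟩
  c_inf_c i X Y := L.ext_iff.2 fun s => by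
    simp only [mem_inf, Set.mem_ofPred_eq, Function.update_idem]
    exact ⟨fun ⟨a, h1, h2⟩ => ⟨⟨a, h1⟩, h2⟩, fun ⟨⟨a, h1⟩, h2⟩ => ⟨a, h1, h2⟩⟩
  c_comm i j X := L.ext_iff.2 fun s => by
    rcases eq_or_ne i j with rfl | hij
    · rfl
    simp only [Set.mem_ofPred_eq]
    rw [exists_comm]
    simp only [Function.update_comm hij]
  d_self i := L.ext_iff.2 fun s => ⟨fun _ => trivial, fun _ => rfl⟩
  d_eq i j k hi hj := L.ext_iff.2 fun s => by
    simp only [mem_inf, Set.mem_ofPred_eq, Function.update_self, Function.update_of_ne hi.symm,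
      Function.update_of_ne hj.symm]
    exact ⟨fun h => ⟨s i, rfl, h⟩, fun ⟨a, h1, h2⟩ => h1.trans h2⟩
  c_d i j X hij := L.ext_iff.2 fun s => by
    simp only [mem_inf, Set.mem_ofPred_eq, mem_compl, Function.update_self,
      Function.update_of_ne hij.symm]
    exact ⟨fun ⟨⟨a, h1, h2⟩, b, h3, h4⟩ => (h4 (h3.trans h1.symm ▸ h2)).elim, fun hs => hs.elim⟩

theorem isTCA : L.toAlg.IsTCA where
  toIsCA := L.isCA
  I_congr _ _ _ := le_rfl
  I_le _ _ := le_rfl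
  I_inf _ _ _ := rfl
  I_le_I_I _ _ := le_rfl
  I_top _ := rfl
  c_I _ _ _ _ hk := CylSig.notMem_dimSet.1 hk
  s_I _ _ _ _ := rfl

/-- The sets invariant under one of a decreasing sequence of symmetric relations with the one-point
extension property. -/
def ofRel (R : ℕ → (α → M) → (α → M) → Prop) (symm : ∀ N s t, R N s t → R N t s)
    (anti : ∀ N N' s t, N ≤ N' → R N' s t → R N s t)
    (ext : ∀ N s t i a, R N s t → ∃ b, R N (Function.update s i a) (Function.update t i b))
    (diag : ∀ i j, ∃ N, ∀ s t, R N s t → s i = s j → t i = t j) : CylField α M where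
  sets :=
    { carrier := {X | ∃ N, ∀ s t, R N s t → s ∈ X → t ∈ X}
      supClosed' := fun _ ⟨N, hN⟩ _ ⟨N', hN'⟩ => ⟨max N N', fun s t h hs =>
        hs.imp (hN s t (anti _ _ _ _ (le_max_left _ _) h))
          (hN' s t (anti _ _ _ _ (le_max_right _ _) h))⟩
      infClosed' := fun _ ⟨N, hN⟩ _ ⟨N', hN'⟩ => ⟨max N N', fun s t h hs =>
        ⟨hN s t (anti _ _ _ _ (le_max_left _ _) h) hs.1,
          hN' s t (anti _ _ _ _ (le_max_right _ _) h) hs.2⟩⟩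
      compl_mem' := fun ⟨N, hN⟩ => ⟨N, fun s t h hs ht => hs (hN t s (symm _ _ _ h) ht)⟩
      bot_mem' := ⟨0, fun _ _ _ h => h⟩ }
  c_mem := fun i _ ⟨N, hN⟩ => ⟨N, fun s t h ⟨a, ha⟩ =>
    (ext N s t i a h).imp fun _ hb => hN _ _ hb ha⟩
  d_mem := diag

end CylField

/-! ### Arithmetic of substitutions. -/

namespace CylSig.IsCA

variable {α : Type} {A : CylSig.{u} α} (h : A.IsCA)
include h

theorem s_mono {i j : α} {x y : A} (hxy : x ≤ y) : A.s i j x ≤ A.s i j y :=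
  h.c_mono (inf_le_inf_left _ hxy)

/-- Cylindrifying the substituted element by `j` gives back `A.c i x`, because `c j` absorbs the
diagonal and leaves `x` alone. -/
theorem s_ne_bot {i j : α} (hij : i ≠ j) {x : A} (hx : A.c j x = x) (h0 : x ≠ ⊥) :
    A.s i j x ≠ ⊥ := by
  intro hs
  apply h0
  rw [← h.c_eq_bot (i := i), ← top_inf_eq (x), ← h.c_d_top hij.symm, ← h.c_inf_right hx, h.d_symm,
    h.c_comm, h.c_eq_bot]
  exact hs

theorem fixed_s_self (i j : α) (x : A) : A.c i (A.s i j x) = A.s i j x := h.c_c _ _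

theorem fixed_s {i j k : α} (hi : k ≠ i) (hj : k ≠ j) {x : A} (hx : A.c k x = x) :
    A.c k (A.s i j x) = A.s i j x :=
  h.fixed_c (h.fixed_inf (h.fixed_d hi hj) hx)

theorem s_of_fixed {i j : α} (hij : i ≠ j) {x : A} (hx : A.c i x = x) : A.s i j x = x := by
  unfold CylSig.s
  rw [h.c_inf_right hx, h.c_d_top hij, top_inf_eq]

theorem s_disjoint {i j : α} (hij : i ≠ j) {x y : A} (hxy : Disjoint x y) :
    Disjoint (A.s i j x) (A.s i j y) := by
  rw [disjoint_iff, ← le_bot_iff, ← h.c_d i j x hij]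
  exact inf_le_inf_left _ (h.c_mono (inf_le_inf_left _ hxy.symm.le_compl_right))

theorem s_s {i j k : α} (hi : k ≠ i) (hj : k ≠ j) (hij : i ≠ j) {x : A} (hx : A.c k x = x) :
    A.s k j (A.s i k x) = A.s i j x := by
  unfold CylSig.s
  rw [← h.c_inf_left (h.fixed_d hi.symm hij), h.c_comm, ← inf_assoc, h.c_inf_right hx,
    inf_comm (A.d k j), ← h.d_eq i j k hi hj]

end CylSig.IsCA

/-! ### The finite algebra for (2), and why it is not a neat reduct. -/

namespace ParityField

variable (n : ℕ)

/-- The base: `n` pairs of points. -/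
abbrev Base (n : ℕ) : Type u := Fin n × ULift.{u} (ZMod 2)

variable {n}

/-- The sequence meets the pairs in their natural order. -/
def Straight (s : Fin n → Base.{u} n) : Prop := ∀ m, (s m).1 = m

/-- `t` arises from `s` by interchanging the points of some of the pairs, the number of these pairs
being even if `s` is straight. -/
def Rel (s t : Fin n → Base.{u} n) : Prop :=
  ∃ h : Fin n → ULift.{u} (ZMod 2), (∀ m, t m = ((s m).1, (s m).2 + h (s m).1)) ∧
    (Straight s → ∑ m, h m = 0)

theorem Rel.straight {s t : Fin n → Base.{u} n} (h : Rel s t) : Straight s ↔ Straight t := by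
  obtain ⟨h, h1, -⟩ := h
  simp [Straight, h1]

theorem Rel.symm {s t : Fin n → Base.{u} n} (h : Rel s t) : Rel t s := by
  have hst := h.straight
  obtain ⟨h, h1, h2⟩ := h
  refine ⟨-h, fun m => ?_, fun ht => ?_⟩
  · simp [h1]
  · simp [h2 (hst.2 ht)]

/-- If the updated sequence is straight, no coordinate except `i` meets the `i`-th pair, so the
interchange in that pair can be chosen to make the total parity even. Otherwise parity imposes no
condition and the old interchanges serve. -/
theorem Rel.update {s t : Fin n → Base.{u} n} (h : Rel s t) (i : Fin n) (a : Base.{u} n) :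
    ∃ b, Rel (Function.update s i a) (Function.update t i b) := by
  obtain ⟨h, h1, -⟩ := h
  by_cases hs : Straight (Function.update s i a)
  · have ha : a.1 = i := by simpa using hs i
    have hm : ∀ m, m ≠ i → (s m).1 = m := fun m hm => by simpa [hm] using hs m
    refine ⟨(i, a.2 + (h i - ∑ m, h m)), Function.update h i (h i - ∑ m, h m), fun m => ?_,
      fun _ => ?_⟩
    · rcases eq_or_ne m i with rfl | hmi
      · simp [ha]
      · simp [hmi, h1, hm m hmi]
    · rw [Finset.sum_update_of_mem (Finset.mem_univ i)]
      rw [← Finset.add_sum_erase _ h (Finset.mem_univ i), Finset.sdiff_singleton_eq_erase]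
      abel
  · refine ⟨(a.1, a.2 + h a.1), h, fun m => ?_, fun h' => (hs h').elim⟩
    rcases eq_or_ne m i with rfl | hmi
    · simp
    · simp [hmi, h1]

/-- The field of sets invariant under `Rel`. -/
def field (n : ℕ) : CylField.{u} (Fin n) (Base.{u} n) :=
  CylField.ofRel (fun _ => Rel) (fun _ _ _ h => h.symm) (fun _ _ _ _ _ h => h)
    (fun _ _ _ i a h => h.update i a)
    (fun i j => ⟨0, fun s t ⟨h, h1, _⟩ hij => by rw [h1, h1, hij]⟩)

theorem mem_field {X : Set (Fin n → Base.{u} n)} :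
    X ∈ (field n).sets ↔ ∀ s t, Rel s t → s ∈ X → t ∈ X :=
  ⟨fun ⟨_, h⟩ => h, fun h => ⟨0, h⟩⟩

/-- The sequences whose `m`-th entry lies in the `j`-th pair. -/
def pair (j m : Fin n) : (field.{u} n).sets :=
  ⟨{s | (s m).1 = j}, mem_field.2 fun s t ⟨h, h1, _⟩ (hs : (s m).1 = j) =>
    show (t m).1 = j by rw [h1, hs]⟩

/-- The straight sequences of parity `p`. -/
def straight (p : Set (ULift.{u} (ZMod 2))) : (field.{u} n).sets :=
  ⟨{s | Straight s ∧ ∑ m, (s m).2 ∈ p}, mem_field.2 fun s t h ⟨h1, h2⟩ =>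
    ⟨h.straight.1 h1, by
      obtain ⟨g, h3, h4⟩ := h
      have : ∑ m, (t m).2 = ∑ m, (s m).2 := by
        simp only [h3, Finset.sum_add_distrib]
        rw [show ∑ m, g (s m).1 = ∑ m, g m from Finset.sum_congr rfl fun m _ => by rw [h1 m],
          h4 h1, add_zero]
      rwa [this]⟩⟩

theorem straight_ne_bot [NeZero n] {p : Set (ULift.{u} (ZMod 2))} (hp : p.Nonempty) :
    straight.{u} (n := n) p ≠ ⊥ := by
  obtain ⟨a, ha⟩ := hp
  intro h
  have h2 := ((field n).ext_iff.1 h (fun m => (m, if m = 0 then a else 0))).1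
    ⟨fun m => rfl, by simpa using ha⟩
  exact h2

theorem straight_le_pair (p : Set (ULift.{u} (ZMod 2))) (j : Fin n) : straight p ≤ pair j j :=
  (field n).le_iff.2 fun _ hs => hs.1 j

theorem straight_disjoint {p q : Set (ULift.{u} (ZMod 2))} (hpq : Disjoint p q) :
    Disjoint (straight (n := n) p) (straight q) := by
  rw [disjoint_iff]
  refine (field n).ext_iff.2 fun s => ⟨fun hs => ?_, fun hs => hs.elim⟩
  exact (Set.disjoint_left.1 hpq hs.1.2 hs.2.2).elim

theorem fixed_pair {j m i : Fin n} (hi : i ≠ m) :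
    (field.{u} n).toAlg.c i (pair j m) = pair j m :=
  (field n).ext_iff.2 fun s => by
    show (∃ a, (Function.update s i a m).1 = j) ↔ (s m).1 = j
    simp only [Function.update_of_ne hi.symm]
    exact ⟨fun ⟨_, h⟩ => h, fun h => ⟨s m, h⟩⟩

theorem s_pair {j m i : Fin n} (hi : i ≠ m) :
    (field.{u} n).toAlg.s m i (pair j m) = pair j i :=
  (field n).ext_iff.2 fun s => by
    show (∃ a, Function.update s m a m = Function.update s m a i ∧
      (Function.update s m a m).1 = j) ↔ (s i).1 = j
    simp [hi]

/-- A non-identical arrangement of the pairs is not split. -/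
theorem le_or_disjoint {π : Equiv.Perm (Fin n)} (h1 : π ≠ 1)
    (x y : (field.{u} n).sets) (hx : x ≠ ⊥) (hy : y ≠ ⊥)
    (hxπ : ∀ j, x ≤ pair (π j) j) (hyπ : ∀ j, y ≤ pair (π j) j) : ¬ Disjoint x y := by
  have key : ∀ z : (field.{u} n).sets, z ≠ ⊥ → ∃ s, s ∈ z.1 := fun z hz => by
    by_contra! h
    exact hz ((field n).ext_iff.2 fun s => ⟨fun hs => h s hs, fun hs => hs.elim⟩)
  obtain ⟨s, hs⟩ := key x hx
  obtain ⟨t, ht⟩ := key y hy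
  have hs1 : ∀ j, (s j).1 = π j := fun j => (field n).le_iff.1 (hxπ j) s hs
  have ht1 : ∀ j, (t j).1 = π j := fun j => (field n).le_iff.1 (hyπ j) t ht
  have hst : Rel s t := by
    -- In the arrangement `π` the `k`-th pair is met exactly at coordinate `π.symm k`, so the
    -- required interchange is read off there; no parity condition arises because `π ≠ 1`.
    refine ⟨fun k => (t (π.symm k)).2 - (s (π.symm k)).2, fun m => ?_,
      fun h => (h1 (Equiv.ext fun j => (hs1 j).symm.trans (h j))).elim⟩
    ext1
    · simp [hs1, ht1]
    · simp [hs1]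
  intro hd
  exact (field n).le_iff.1 (disjoint_iff.1 hd).le t ⟨mem_field.1 x.2 s t hst hs, ht⟩

/-- In a neat reduct, interchanging coordinates `0` and `1` by way of `n` would take the two parity
classes of straight sequences to disjoint nonzero elements of the transposed arrangement,
contradicting `le_or_disjoint`. -/
theorem not_isNeatReduct (hn : 1 < n) : ¬ (field.{u} n).toAlg.IsNeatReduct n := by
  rintro ⟨B, hB, f, hf, hom, hr⟩
  have h := hB.toIsCA
  have : NeZero n := ⟨by omega⟩
  let o : Fin n := ⟨0, by omega⟩
  let l : Fin n := ⟨1, hn⟩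
  have hdim : ∀ x, ∀ i, n ≤ i → B.c i (f x) = f x := fun x i hi => by
    have hx : f x ∈ Set.range f := ⟨x, rfl⟩
    rw [hr] at hx
    exact CylSig.notMem_dimSet.1 fun h' => absurd (hx h') (by simpa using hi)
  have hs : ∀ (i j : Fin n) x, f ((field n).toAlg.s i j x) = B.s i j (f x) := fun i j x => by
    show f ((field n).toAlg.c i ((field n).toAlg.d i j ⊓ x)) = _
    rw [hom.map_c, map_inf, hom.map_d]
    rfl
  have hfix : ∀ (j m i : Fin n), i ≠ m → B.c i (f (pair j m)) = f (pair j m) :=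
    fun j m i him => by
      rw [← fixed_pair him, hom.map_c]
      exact h.c_c _ _
  have h0n : (0 : ℕ) ≠ n := by omega
  have h1n : (1 : ℕ) ≠ n := by omega
  -- The transposition: `1` is parked at `n`, then `0` is moved to `1`, then `n` to `0`.
  set T : B → B := fun x => B.s n 0 (B.s 0 1 (B.s 1 n x)) with hT
  let π : Equiv.Perm (Fin n) := Equiv.swap o l
  have h01 : o ≠ l := by simp [o, l]
  have hTbot : ∀ x, x ≠ ⊥ → T (f x) ≠ ⊥ := fun x hx => by
    have hx' : f x ≠ ⊥ := fun h' => hx (hf (h'.trans (map_bot f).symm))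
    refine h.s_ne_bot h0n.symm (h.fixed_s_self _ _ _) ?_
    refine h.s_ne_bot zero_ne_one (h.fixed_s_self _ _ _) ?_
    exact h.s_ne_bot h1n (hdim x n le_rfl) hx'
  have hTmono : ∀ x y : B, x ≤ y → T x ≤ T y := fun x y hxy =>
    h.s_mono (h.s_mono (h.s_mono hxy))
  have hTpair : ∀ j, T (f (pair j j)) = f (pair j (π j)) := fun j => by
    have hn := hdim (pair j j) n le_rfl
    rcases eq_or_ne j o with rfl | hj0
    · have e1 : B.s 1 n (f (pair o o)) = f (pair o o) :=
        h.s_of_fixed h1n (hfix o o l h01.symm)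
      have e2 : B.s 0 1 (f (pair o o)) = f (pair o l) := by
        rw [← s_pair h01.symm, hs]
      rw [hT]; dsimp only
      rw [e1, e2, h.s_of_fixed h0n.symm (hdim _ n le_rfl)]
      simp [π]
    rcases eq_or_ne j l with rfl | hj1
    · have e1 : B.s 0 1 (B.s 1 n (f (pair l l))) = B.s 1 n (f (pair l l)) :=
        h.s_of_fixed zero_ne_one (h.fixed_s zero_ne_one h0n (hfix l l o h01))
      rw [hT]; dsimp only
      rw [e1, h.s_s h1n.symm h0n.symm one_ne_zero hn, show π l = o by simp [π], ← s_pair h01, hs]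
    · have e1 : B.s 1 n (f (pair j j)) = f (pair j j) := h.s_of_fixed h1n (hfix j j l hj1.symm)
      have e2 : B.s 0 1 (f (pair j j)) = f (pair j j) :=
        h.s_of_fixed zero_ne_one (hfix j j o hj0.symm)
      rw [hT]; dsimp only
      rw [e1, e2, h.s_of_fixed h0n.symm hn]
      simp [π, Equiv.swap_apply_of_ne_of_ne hj0 hj1]
  -- `T (f x)` depends on no coordinate from `n` on, the outermost substitution having removed `n`;
  -- a neat reduct contains every such element.
  have hTmem : ∀ x, ∃ y, f y = T (f x) := fun x => by
    have : T (f x) ∈ Set.range f := by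
      rw [hr]
      intro i hi
      by_contra hin
      apply hi
      have hin' : n ≤ i := by simpa using hin
      rcases eq_or_ne i n with rfl | hne
      · exact h.fixed_s_self _ _ _
      · have := hdim x i hin'
        refine h.fixed_s hne (by omega) (h.fixed_s (by omega) (by omega) (h.fixed_s (by omega) hne this))
    exact this
  obtain ⟨x, hx⟩ := hTmem (straight {0})
  obtain ⟨y, hy⟩ := hTmem (straight {0}ᶜ)
  have hle : ∀ p z, f z = T (f (straight p)) → ∀ j, z ≤ pair (π j) j := fun p z hz j => by
    have h1 : f z ≤ f (pair (π j) j) := by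
      have h2 := hTmono _ _ (OrderHomClass.mono f (straight_le_pair p (π j)))
      rw [hTpair, ← hz] at h2
      simpa [π] using h2
    rw [← inf_eq_left] at h1 ⊢
    rw [← map_inf] at h1
    exact hf h1
  refine le_or_disjoint (π := π) (fun h' => ?_) x y ?_ ?_ (hle _ x hx)
    (hle _ y hy) ?_
  · exact h01 (by simpa [π] using Equiv.congr_fun h' l)
  · rintro rfl
    exact hTbot _ (straight_ne_bot (Set.singleton_nonempty 0)) (hx.symm.trans (map_bot f))
  · rintro rfl
    exact hTbot _ (straight_ne_bot ⟨1, by simp⟩) (hy.symm.trans (map_bot f))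
  · rw [disjoint_iff]
    apply hf
    rw [map_inf, map_bot, hx, hy, ← disjoint_iff]
    refine h.s_disjoint h0n.symm (h.s_disjoint zero_ne_one (h.s_disjoint h1n ?_))
    rw [disjoint_iff, ← map_bot f, ← disjoint_iff.1 (straight_disjoint disjoint_compl_right), map_inf]

end ParityField

/-! ### Representations of fields closed under arbitrary intersections. -/

namespace CylField

variable {α : Type} [DecidableEq α] {M : Type u} (L : CylField α M)

/-- Existing infima in the field are intersections, so the identity over the discrete base is a
complete representation. -/
theorem completelyRepresentable
    (hL : ∀ 𝒳 : Set (Set (α → M)), (∀ X ∈ 𝒳, X ∈ L.sets) → ⋂₀ 𝒳 ∈ L.sets) :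
    L.toAlg.CompletelyRepresentable := by
  refine ⟨PUnit, fun _ => M, fun _ => ⊥,
    { toFun := fun X => {p | p.2 ∈ X.1}
      map_sup' := fun _ _ => rfl
      map_inf' := fun _ _ => rfl
      map_top' := rfl
      map_bot' := rfl }, fun X Y hXY => ?_, ⟨⟨fun i X => rfl, fun i j => rfl⟩, fun i X => ?_⟩, ?_⟩
  · refine L.ext_iff.2 fun s => ?_
    have := Set.ext_iff.1 hXY ⟨PUnit.unit, s⟩
    exact this
  · ext ⟨_, s⟩
    let _ : TopologicalSpace M := ⊥
    have : DiscreteTopology M := ⟨rfl⟩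
    show s ∈ X.1 ↔ s i ∈ interior {a : M | Function.update s i a ∈ X.1}
    rw [interior_eq_iff_isOpen.2 (isOpen_discrete _)]
    simp
  · intro 𝒳 X hX
    ext ⟨_, s⟩
    simp only [Set.mem_iInter]
    refine ⟨fun hs Y hY => L.le_iff.1 (hX.1 hY) s hs, fun hs => ?_⟩
    have h1 := hL (Subtype.val '' 𝒳) (by rintro _ ⟨Y, -, rfl⟩; exact Y.2)
    have h2 : (⟨_, h1⟩ : L.sets) ∈ lowerBounds 𝒳 := fun Y hY =>
      L.le_iff.2 fun t ht => ht _ ⟨Y, hY, rfl⟩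
    refine L.le_iff.1 (hX.2 h2) s ?_
    · rintro _ ⟨Y, hY, rfl⟩
      exact hs Y hY

/-- The intersection of all members containing `s` is an atom: each member or its complement
contains `s`. -/
theorem exists_isAtom
    (hL : ∀ 𝒳 : Set (Set (α → M)), (∀ X ∈ 𝒳, X ∈ L.sets) → ⋂₀ 𝒳 ∈ L.sets) (s : α → M) :
    ∃ a : L.sets, IsAtom a ∧ s ∈ a.1 := by
  let a : L.sets := ⟨⋂₀ {X | X ∈ L.sets ∧ s ∈ X}, hL _ fun X hX => hX.1⟩
  have hle : ∀ Y : L.sets, s ∈ Y.1 → a ≤ Y := fun Y hY => L.le_iff.2 fun t ht => ht Y.1 ⟨Y.2, hY⟩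
  have hs : s ∈ a.1 := fun X hX => hX.2
  refine ⟨a, ⟨fun h => ?_, fun Y hY => ?_⟩, hs⟩
  · exact (L.ext_iff.1 h s).1 hs
  · by_cases hsY : s ∈ Y.1
    · exact absurd (hle Y hsY) hY.not_ge
    · have h1 : a ≤ Yᶜ := hle Yᶜ hsY
      exact disjoint_self.1 (le_compl_iff_disjoint_right.1 (hY.le.trans h1))

theorem mem_of_isAtom {a b : L.sets} (ha : IsAtom a) {s : α → M} (hs : s ∈ a.1) (hb : s ∈ b.1) :
    a ≤ b := by
  rcases ha.le_iff.1 (inf_le_left : a ⊓ b ≤ a) with h | h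
  · exact ((L.ext_iff.1 h s).1 ⟨hs, hb⟩).elim
  · exact inf_eq_left.1 h

/-- Every sequence lies in exactly one atom, so mapping a set of atoms to its union represents the
complex algebra; interiors are trivial on both sides. -/
theorem stronglyRepresentable
    (hL : ∀ 𝒳 : Set (Set (α → M)), (∀ X ∈ 𝒳, X ∈ L.sets) → ⋂₀ 𝒳 ∈ L.sets) :
    L.toAlg.StronglyRepresentable := by
  have hdia : ∀ i (X : L.sets), L.toAlg.dia i X = X := fun i X => compl_compl X
  refine ⟨⟨fun X => ?_⟩, ⟨L.isCA.completelyAdditive, fun i 𝒳 X hX => ?_⟩, ?_⟩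
  · by_cases h : ∃ s, s ∈ X.1
    · obtain ⟨s, hs⟩ := h
      obtain ⟨a, ha, hsa⟩ := L.exists_isAtom hL s
      exact .inr ⟨a, ha, L.mem_of_isAtom ha hsa hs⟩
    · exact .inl (L.ext_iff.2 fun s => ⟨fun hs => h ⟨s, hs⟩, fun hs => hs.elim⟩)
  · simpa [hdia] using hX
  have huniq : ∀ {a b : {a : L.sets // IsAtom a}} {s : α → M}, s ∈ a.1.1 → s ∈ b.1.1 → a = b :=
    fun {a b s} ha hb =>
      Subtype.ext (le_antisymm (L.mem_of_isAtom a.2 ha hb) (L.mem_of_isAtom b.2 hb ha))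
  refine ⟨PUnit, fun _ => M, fun _ => ⊥,
    { toFun := fun X => {p | ∃ a ∈ X, p.2 ∈ a.1.1}
      map_sup' := fun X Y => ?_
      map_inf' := fun X Y => ?_
      map_top' := ?_
      map_bot' := ?_ }, fun X Y hXY => ?_, ⟨⟨fun i X => ?_, fun i j => ?_⟩, fun i X => ?_⟩⟩
  · ext ⟨_, s⟩
    exact ⟨fun ⟨a, ha, hs⟩ => ha.imp (fun h => ⟨a, h, hs⟩) (fun h => ⟨a, h, hs⟩),
      fun h => h.elim (fun ⟨a, ha, hs⟩ => ⟨a, .inl ha, hs⟩) (fun ⟨a, ha, hs⟩ => ⟨a, .inr ha, hs⟩)⟩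
  · ext ⟨_, s⟩
    exact ⟨fun ⟨a, ha, hs⟩ => ⟨⟨a, ha.1, hs⟩, ⟨a, ha.2, hs⟩⟩,
      fun ⟨⟨a, ha, hs⟩, ⟨b, hb, hs'⟩⟩ => ⟨a, ⟨ha, huniq hs hs' ▸ hb⟩, hs⟩⟩
  · ext ⟨_, s⟩
    obtain ⟨a, ha, hsa⟩ := L.exists_isAtom hL s
    exact ⟨fun _ => trivial, fun _ => ⟨⟨a, ha⟩, trivial, hsa⟩⟩
  · ext ⟨_, s⟩
    exact ⟨fun ⟨a, ha, _⟩ => ha, fun h => h.elim⟩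
  · ext a
    have hne : ∃ s, s ∈ a.1.1 := by
      by_contra! h
      exact a.2.1 (L.ext_iff.2 fun s => ⟨fun hs => h s hs, fun hs => hs.elim⟩)
    obtain ⟨s, hs⟩ := hne
    have h1 : (∃ b ∈ X, s ∈ b.1.1) ↔ ∃ b ∈ Y, s ∈ b.1.1 := Set.ext_iff.1 hXY ⟨PUnit.unit, s⟩
    constructor
    · intro ha
      obtain ⟨b, hb, hsb⟩ := h1.1 ⟨a, ha, hs⟩
      exact huniq hs hsb ▸ hb
    · intro ha
      obtain ⟨b, hb, hsb⟩ := h1.2 ⟨a, ha, hs⟩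
      exact huniq hs hsb ▸ hb
  · ext ⟨_, s⟩
    constructor
    · rintro ⟨a, ⟨b, hb, hab⟩, hs⟩
      obtain ⟨u, hu⟩ := L.le_iff.1 hab s hs
      exact ⟨u, b, hb, hu⟩
    · rintro ⟨u, b, hb, hu⟩
      obtain ⟨a, ha, hsa⟩ := L.exists_isAtom hL s
      exact ⟨⟨a, ha⟩, ⟨b, hb, L.mem_of_isAtom ha hsa ⟨u, hu⟩⟩, hsa⟩
  · ext ⟨_, s⟩
    constructor
    · rintro ⟨a, ha, hs⟩
      exact L.le_iff.1 ha s hs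
    · intro hs
      obtain ⟨a, ha, hsa⟩ := L.exists_isAtom hL s
      exact ⟨⟨a, ha⟩, L.mem_of_isAtom ha hsa hs, hsa⟩
  · have hI : L.toAlg.cmAt.I i X = X := by
      ext a
      show ¬ (∃ b ∈ Xᶜ, a.1 ≤ L.toAlg.dia i b.1) ↔ _
      simp only [hdia]
      constructor
      · intro h
        by_contra ha
        exact h ⟨a, ha, le_rfl⟩
      · rintro ha ⟨b, hb, hab⟩
        have : a = b := Subtype.ext ((b.2.le_iff.1 hab).resolve_left a.2.1)
        exact hb (this ▸ ha)
    rw [hI]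
    ext ⟨_, s⟩
    let _ : TopologicalSpace M := ⊥
    have : DiscreteTopology M := ⟨rfl⟩
    show (∃ a ∈ X, s ∈ a.1.1) ↔ s i ∈ interior {u : M | ∃ a ∈ X, Function.update s i u ∈ a.1.1}
    rw [interior_eq_iff_isOpen.2 (isOpen_discrete _)]
    simp

end CylField

/-! ### Finite algebras under ultraproducts and ultraroots. -/

namespace TopCylSig

variable {α : Type}

theorem IsNeatReduct.of_equiv {n : ℕ} {A C : TopCylSig.{u} (Fin n)} (hC : C.IsNeatReduct n)
    (e : (lang (Fin n)).Equiv A.carrier C.carrier) : A.IsNeatReduct n := by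
  obtain ⟨B, hB, f, hf, hom, hr⟩ := hC
  have hop : ∀ {k} (F : Op (Fin n) k) (v : Fin k → A), e (A.interp F v) = C.interp F (e ∘ v) :=
    fun F v => e.map_fun F v
  let g : BoundedLatticeHom A C :=
    { toFun := e
      map_sup' := fun x y => hop .sup ![x, y]
      map_inf' := fun x y => hop .inf ![x, y]
      map_top' := hop .top ![]
      map_bot' := hop .bot ![] }
  refine ⟨B, hB, f.comp g, hf.comp e.injective, ⟨⟨fun i x => ?_, fun i j => ?_⟩, fun i x => ?_⟩, ?_⟩
  · exact (congrArg f (hop (.c i) ![x])).trans (hom.map_c i _)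
  · exact (congrArg f (hop (.d i j) ![])).trans (hom.map_d i j)
  · exact (congrArg f (hop (.I i) ![x])).trans (hom.map_I i _)
  · rw [← hr]
    exact e.toEquiv.surjective.range_comp f

instance {α : Type} [Finite α] (k : ℕ) : Finite (Op α k) := by
  let code : Op α k → Fin 8 × Option α × Option α := fun F => match F with
    | .bot => (0, none, none)
    | .top => (1, none, none)
    | .d i j => (2, some i, some j)
    | .compl => (3, none, none)
    | .c i => (4, some i, none)
    | .I i => (5, some i, none)
    | .sup => (6, none, none)
    | .inf => (7, none, none)
  refine Finite.of_injective code fun F F' h => ?_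
  cases F <;> cases F' <;> simp_all [code]

open FirstOrder in
/-- A finite ultraproduct is isomorphic to one of its factors. -/
theorem exists_equiv_of_finite {α : Type} [Finite α] {J : Type u} (G : Ultrafilter J)
    (C : J → TopCylSig.{u} α) [Finite ((G : Filter J).Product fun j => (C j).carrier)] :
    ∃ j, Nonempty ((lang α).Equiv (C j).carrier ((G : Filter J).Product fun j => (C j).carrier)) := by
  set P := (G : Filter J).Product fun j => (C j).carrier with hP
  let r : P → ∀ j, (C j).carrier := Quotient.out
  let mk : (∀ j, (C j).carrier) → P := Quotient.mk _
  have hmk : ∀ x y, mk x = mk y ↔ ∀ᶠ j in (G : Filter J), x j = y j := fun x y => Quotient.eq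
  have hr : ∀ p, mk (r p) = p := Quotient.out_eq
  -- As `P` and the set of operations are finite, for almost all `j` the evaluation at `j` of the
  -- chosen representatives is at once injective, surjective and compatible with the operations.
  have h1 : ∀ᶠ j in (G : Filter J), ∀ p q : P, r p j = r q j → p = q := by
    rw [Filter.eventually_all]; intro p
    rw [Filter.eventually_all]; intro q
    by_cases hpq : p = q
    · exact .of_forall fun _ _ => hpq
    · have : ¬ ∀ᶠ j in (G : Filter J), r p j = r q j := fun h =>
        hpq (by rw [← hr p, ← hr q, hmk]; exact h)
      exact (Ultrafilter.eventually_not.2 this).mono fun j hj h => (hj h).elim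
  have h2 : ∀ᶠ j in (G : Filter J), ∀ x : (C j).carrier, ∃ p, r p j = x := by
    by_contra hn
    rw [← Ultrafilter.eventually_not] at hn
    have : ∀ j, ∃ x : (C j).carrier, (¬ ∀ x : (C j).carrier, ∃ p, r p j = x) → ∀ p, r p j ≠ x := by
      -- In almost every factor an element missed by all representatives could be selected; but the
      -- class of this selection has a representative agreeing with it almost everywhere.
      intro j
      by_cases h : ∀ x : (C j).carrier, ∃ p, r p j = x
      · exact ⟨⊥, fun h' => (h' h).elim⟩
      · push Not at h
        exact h.imp fun x hx _ => hx
    choose x hx using this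
    have h3 : ∀ᶠ j in (G : Filter J), r (mk x) j = x j := (hmk _ _).1 (hr _)
    obtain ⟨j, hj, hj'⟩ := (h3.and hn).exists
    exact hx j hj' _ hj
  -- All arities are at most `2`, so only finitely many conditions occur.
  have h3 : ∀ᶠ j in (G : Filter J), ∀ k : Fin 3, ∀ (F : Op α k) (v : Fin k → P),
      r (Language.Structure.funMap (L := lang α) (M := P) F v) j =
        (C j).interp F (fun i => r (v i) j) := by
    rw [Filter.eventually_all]; intro k
    rw [Filter.eventually_all]; intro F
    rw [Filter.eventually_all]; intro v
    have : mk (r (Language.Structure.funMap (L := lang α) (M := P) F v)) =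
        mk (fun j => (C j).interp F (fun i => r (v i) j)) := by
      rw [hr]
      have hv : v = fun i => mk (r (v i)) := funext fun i => (hr _).symm
      conv_lhs => rw [hv]
      exact Language.Ultraproduct.funMap_cast (L := lang α) (u := G) (M := fun j => (C j).carrier) F
        (fun i => r (v i))
    exact (hmk _ _).1 this
  obtain ⟨j, ⟨hj1, hj2⟩, hj3⟩ := ((h1.and h2).and h3).exists
  refine ⟨j, ⟨(Language.Equiv.symm
    { toFun := fun p => r p j
      invFun := fun x => (hj2 x).choose
      left_inv := fun p => hj1 _ _ (hj2 (r p j)).choose_spec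
      right_inv := fun x => (hj2 x).choose_spec
      map_fun' := fun {k} F v => ?_
      map_rel' := fun R => R.elim })⟩⟩
  have hk : k < 3 := by cases F <;> decide
  exact hj3 ⟨k, hk⟩ F v

theorem Up.exists_equiv {α : Type} [Finite α] {K : TopCylSig.{u} α → Prop} {A : TopCylSig.{u} α}
    [Finite A.carrier] (h : Up K A) :
    ∃ C, K C ∧ Nonempty ((lang α).Equiv C.carrier A.carrier) := by
  obtain ⟨J, G, C, hC, ⟨e⟩⟩ := h
  have := Finite.of_equiv _ e.toEquiv.symm
  obtain ⟨j, ⟨e'⟩⟩ := exists_equiv_of_finite G C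
  exact ⟨C j, hC j, ⟨e.comp e'⟩⟩

/-- A function into a finite set is constant almost everywhere, so an ultrapower of a finite algebra
is finite, hence isomorphic to the algebra. -/
theorem Ur.exists_equiv {α : Type} [Finite α] {K : TopCylSig.{u} α → Prop} {A : TopCylSig.{u} α}
    [Finite A.carrier] (h : Ur K A) :
    ∃ C, K C ∧ Nonempty ((lang α).Equiv A.carrier C.carrier) := by
  obtain ⟨J, G, C, hC, ⟨e⟩⟩ := h
  have hfin : Finite ((G : Filter J).Product fun _ => A.carrier) := by
    refine Finite.of_surjective (fun a : A.carrier => (Quotient.mk _ fun _ => a :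
      (G : Filter J).Product fun _ => A.carrier)) fun p => ?_
    induction p using Quotient.inductionOn with
    | _ x =>
    have h1 : ∀ᶠ j in (G : Filter J), ∃ a, x j = a := .of_forall fun j => ⟨_, rfl⟩
    rw [Ultrafilter.eventually_exists_iff] at h1
    obtain ⟨a, ha⟩ := h1
    exact ⟨a, Quotient.sound (ha.mono fun j hj => hj.symm)⟩
  obtain ⟨j, ⟨e'⟩⟩ := exists_equiv_of_finite G fun _ => A
  exact ⟨C, hC, ⟨e.comp e'⟩⟩

theorem not_up_ur_of_finite {n : ℕ} {A : TopCylSig.{u} (Fin n)} [Finite A.carrier]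
    (hA : ¬ A.IsNeatReduct n) : ¬ Up (Ur (IsNeatReduct n)) A := by
  intro h
  obtain ⟨C, hC, ⟨e⟩⟩ := h.exists_equiv
  have := Finite.of_equiv _ e.toEquiv.symm
  obtain ⟨D, hD, ⟨e'⟩⟩ := hC.exists_equiv
  exact hA ((hD.of_equiv e').of_equiv e.symm)

end TopCylSig


theorem exists_not_up_ur (n : ℕ) (hn : 1 < n) :
    ∃ A : TopCylSig.{u} (Fin n), A.IsTCA ∧ Countable A ∧
        A.CompletelyRepresentable ∧ A.StronglyRepresentable ∧
        ¬ TopCylSig.Up (TopCylSig.Ur (TopCylSig.IsNeatReduct n)) A ∧ ¬ A.IsNeatReduct n := by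
  have hL : ∀ 𝒳 : Set (Set (Fin n → ParityField.Base.{u} n)),
      (∀ X ∈ 𝒳, X ∈ (ParityField.field n).sets) → ⋂₀ 𝒳 ∈ (ParityField.field n).sets :=
    fun 𝒳 h𝒳 => ParityField.mem_field.2 fun s t hst hs X hX =>
      ParityField.mem_field.1 (h𝒳 X hX) s t hst (hs X hX)
  have : Finite (ParityField.field.{u} n).toAlg.carrier :=
    inferInstanceAs (Finite (ParityField.field.{u} n).sets)
  refine ⟨(ParityField.field n).toAlg, (ParityField.field n).isTCA, ?_,
    (ParityField.field n).completelyRepresentable hL,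
    (ParityField.field n).stronglyRepresentable hL,
    TopCylSig.not_up_ur_of_finite (ParityField.not_isNeatReduct hn), ParityField.not_isNeatReduct hn⟩
  exact inferInstanceAs (Countable (ParityField.field.{u} n).sets)

/-! ### Countable edge colourings without monochromatic triangles. -/

open Cardinal in
/-- A complete graph whose edges are coloured by natural numbers without a monochromatic triangle
has at most continuum many vertices. -/
theorem mk_le_continuum_of_no_triangle {X : Type u} (c : X → X → ℕ) (symm : ∀ x y, c x y = c y x)
    (tri : ∀ x y z, x ≠ y → y ≠ z → x ≠ z → c x y = c y z → c x y = c x z → False) :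
    #X ≤ 𝔠 := by
  classical
  rcases isEmpty_or_nonempty X with hX | ⟨⟨x0⟩⟩
  · simp
  -- Well-founded trees serve as terms for a set of at most continuum many vertices that is closed
  -- under countable types: a node `some g` picks a vertex joined to its `n`-th child with colour `g
  -- n`, whenever one exists for all `n`.
  let T := WType fun a : Option (ℕ → ℕ) => {_n : ℕ // a.isSome}
  let ev : T → X := WType.elim X fun p => match p with
    | ⟨none, _⟩ => x0
    | ⟨some g, ch⟩ =>
      if h : ∃ x, ∀ n, ch ⟨n, rfl⟩ ≠ x ∧ c (ch ⟨n, rfl⟩) x = g n then h.choose else x0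
  have hT : #T ≤ 𝔠 := by
    refine WType.cardinalMk_le_of_le ?_
    have h1 : ∀ a : Option (ℕ → ℕ), 𝔠 ^ #{_n : ℕ // a.isSome} ≤ 𝔠 := fun a =>
      (Cardinal.power_le_power_left Cardinal.continuum_ne_zero (Cardinal.mk_le_aleph0)).trans
        Cardinal.continuum_power_aleph0.le
    refine (Cardinal.sum_le_sum _ _ h1).trans ?_
    have h2 : #(Option (ℕ → ℕ)) ≤ 𝔠 := by
      rw [Cardinal.mk_option]
      exact Cardinal.add_le_of_le Cardinal.aleph0_le_continuum (by simp)
        (Cardinal.one_lt_aleph0.le.trans Cardinal.aleph0_le_continuum)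
    rw [Cardinal.sum_const']
    exact (mul_le_mul_left h2 _).trans Cardinal.continuum_mul_self.le
  by_contra hlt
  obtain ⟨x, hx⟩ : ∃ x, x ∉ Set.range ev := by
    by_contra! h
    apply hlt
    have h1 := Cardinal.mk_le_of_surjective (f := fun t : ULift.{u} T => ev t.down)
      fun x => (h x).imp' ULift.up fun _ h => h
    refine h1.trans ?_
    rw [Cardinal.mk_uLift]
    simpa using hT
  -- In a good set the map `s ↦ c s x` is injective, since equal values would make `s`, `t`, `x` a
  -- monochromatic triangle. So good sets are countable, and a vertex of the range imitating `x`
  -- over a maximal one enlarges it.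
  let good : Set (Set X) := {S | S ⊆ Set.range ev ∧
    ∀ s ∈ S, ∀ t ∈ S, s ≠ t → c s t = c s x ∨ c s t = c t x}
  obtain ⟨S, hS⟩ : ∃ S, Maximal (· ∈ good) S := by
    refine zorn_subset good fun C hC hchain => ⟨⋃₀ C, ⟨?_, ?_⟩, fun s hs => Set.subset_sUnion_of_mem hs⟩
    · exact Set.sUnion_subset fun s hs => (hC hs).1
    · rintro s ⟨S1, h1, hs⟩ t ⟨S2, h2, ht⟩ hst
      rcases hchain.total h1 h2 with h | h
      · exact (hC h2).2 s (h hs) t ht hst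
      · exact (hC h1).2 s hs t (h ht) hst
  have hxS : ∀ s ∈ S, s ≠ x := fun s hs h => hx (h ▸ hS.prop.1 hs)
  have hcount : S.Countable := by
    refine Set.countable_iff_exists_injOn.2 ⟨fun s => c s x, fun s hs t ht hst => ?_⟩
    by_contra hne
    dsimp only at hst
    rcases hS.prop.2 s hs t ht hne with h | h
    · exact tri s t x hne (hxS t ht) (hxS s hs) (h.trans hst) h
    · exact tri s t x hne (hxS t ht) (hxS s hs) h (h.trans hst.symm)
  obtain ⟨y, hy, hyS⟩ : ∃ y ∈ Set.range ev, ∀ s ∈ S, s ≠ y ∧ c s y = c s x := by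
    rcases S.eq_empty_or_nonempty with h0 | hne
    · exact ⟨ev (WType.mk none fun i => by simpa using i.2), ⟨_, rfl⟩, by simp [h0]⟩
    · obtain ⟨e, he⟩ := hcount.exists_eq_range hne
      have hch : ∀ n, ∃ t, ev t = e n := fun n => hS.prop.1 (he ▸ ⟨n, rfl⟩)
      choose ch hch using hch
      have hex : ∃ x', ∀ n, e n ≠ x' ∧ c (e n) x' = c (e n) x :=
        ⟨x, fun n => ⟨hxS _ (he ▸ ⟨n, rfl⟩), rfl⟩⟩
      refine ⟨ev (WType.mk (some fun n => c (e n) x) fun n => ch n.1), ⟨_, rfl⟩, ?_⟩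
      have hev : ev (WType.mk (some fun n => c (e n) x) fun n => ch n.1) = hex.choose := by
        have : ev (WType.mk (some fun n => c (e n) x) fun n => ch n.1) =
          if h : ∃ x', ∀ n, ev (ch n) ≠ x' ∧ c (ev (ch n)) x' = c (e n) x then h.choose else x0 :=
          rfl
        rw [this]
        simp only [hch]
        rw [dif_pos hex]
      rw [hev, he]
      rintro _ ⟨n, rfl⟩
      exact hex.choose_spec n
  have hins : insert y S ∈ good := by
    refine ⟨Set.insert_subset hy hS.prop.1, ?_⟩
    rintro s (rfl | hs) t (rfl | ht) hst
    · exact (hst rfl).elim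
    · right; rw [symm]; exact (hyS t ht).2
    · left; exact (hyS s hs).2
    · exact hS.prop.2 s hs t ht hst
  have := hS.le_of_ge hins (Set.subset_insert y S) (Set.mem_insert y S)
  exact (hyS y this).1 rfl

/-! ### The universal coloured graph. -/

/-- A vertex-labelled graph with partially coloured edges, without monochromatic triangles, in which
all finite one-point extensions are realized. -/
structure UniversalGraph (I M : Type u) where
  lab : M → I
  Adj : ℕ → M → M → Prop
  symm : ∀ k a b, Adj k a b → Adj k b a
  irrefl : ∀ k a, ¬ Adj k a a
  unique : ∀ k l a b, Adj k a b → Adj l a b → k = l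
  triangle : ∀ k a b c, Adj k a b → Adj k b c → Adj k a c → False
  ext : ∀ (i : I) (F : Finset M) (v : M → Option ℕ),
    (∀ a ∈ F, ∀ b ∈ F, ∀ k, v a = some k → v b = some k → ¬ Adj k a b) →
    ∃ z, z ∉ F ∧ lab z = i ∧ ∀ a ∈ F, ∀ k, Adj k z a ↔ v a = some k

/-- Vertices given by a label and a list of earlier vertices with colours. -/
inductive Vertex (I : Type u) : Type u
  | mk (i : I) (m : ℕ) (x : Fin m → Vertex I) (v : Fin m → Option ℕ) : Vertex I

namespace Vertex

variable {I : Type u}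

/-- The label of a vertex. -/
def lab : Vertex I → I
  | mk i _ _ _ => i

/-- A measure of the depth of a vertex. -/
def rank : Vertex I → ℕ
  | mk _ _ x _ => ∑ j, (x j).rank + 1

/-- The first vertex lists the second one with colour `k`. -/
def Decl (k : ℕ) : Vertex I → Vertex I → Prop
  | mk _ _ x v, b => ∃ j, x j = b ∧ v j = some k

/-- One of the two vertices lists the other one with colour `k`. -/
def Adj (k : ℕ) (a b : Vertex I) : Prop := Decl k a b ∨ Decl k b a

/-- No vertex is listed with two colours, and no monochromatic triangle is created, hereditarily. -/
def Valid : Vertex I → Prop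
  | mk _ _ x v => (∀ j, (x j).Valid) ∧ (∀ j j', x j = x j' → v j = v j') ∧
      ∀ j j' k, v j = some k → v j' = some k → ¬ Adj k (x j) (x j')

theorem Decl.rank_lt {k : ℕ} {a b : Vertex I} (h : Decl k a b) : b.rank < a.rank := by
  cases a with
  | mk i m x v =>
    obtain ⟨j, rfl, -⟩ := h
    rw [rank, Nat.lt_succ_iff]
    exact Finset.single_le_sum (f := fun j => (x j).rank) (fun _ _ => Nat.zero_le _)
      (Finset.mem_univ j)

theorem Adj.symm {k : ℕ} {a b : Vertex I} (h : Adj k a b) : Adj k b a := Or.symm h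

theorem Adj.decl {k : ℕ} {a b : Vertex I} (h : Adj k a b) (hr : b.rank ≤ a.rank) : Decl k a b :=
  h.resolve_right fun h' => absurd h'.rank_lt hr.not_gt

theorem Valid.decl_unique {k l : ℕ} {a b : Vertex I} (ha : a.Valid) (h : Decl k a b)
    (h' : Decl l a b) : k = l := by
  cases a with
  | mk i m x v =>
    obtain ⟨j, rfl, hj⟩ := h
    obtain ⟨j', hjj, hj'⟩ := h'
    rw [Valid] at ha
    rw [ha.2.1 j' j hjj, hj] at hj'
    exact Option.some_injective _ hj'

theorem Valid.not_adj {k : ℕ} {a b c : Vertex I} (ha : a.Valid) (h : Decl k a b)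
    (h' : Decl k a c) : ¬ Adj k b c := by
  cases a with
  | mk i m x v =>
    obtain ⟨j, rfl, hj⟩ := h
    obtain ⟨j', rfl, hj'⟩ := h'
    rw [Valid] at ha
    exact ha.2.2 j j' k hj hj'

/-- Listing lowers the rank, so a vertex of largest rank lists the other two, and its validity
forbids the triangle. -/
theorem no_triangle {k : ℕ} {a b c : Vertex I} (ha : a.Valid) (hb : b.Valid) (hc : c.Valid)
    (hab : Adj k a b) (hbc : Adj k b c) (hac : Adj k a c) : False := by
  rcases le_total b.rank a.rank with h1 | h1
  · rcases le_total c.rank a.rank with h2 | h2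
    · exact ha.not_adj (hab.decl h1) (hac.decl h2) hbc
    · exact hc.not_adj (hac.symm.decl h2) (hbc.symm.decl (h1.trans h2)) hab
  · rcases le_total c.rank b.rank with h2 | h2
    · exact hb.not_adj (hab.symm.decl h1) (hbc.decl h2) hac
    · exact hc.not_adj (hac.symm.decl (h1.trans h2)) (hbc.symm.decl h2) hab

/-- The new vertex lists exactly `F` with the prescribed colours. Its rank exceeds those of `F`, so
it is new and no member of `F` lists it. -/
theorem exists_ext (i : I) (F : Finset {a : Vertex I // a.Valid})
    (v : {a : Vertex I // a.Valid} → Option ℕ)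
    (hv : ∀ a ∈ F, ∀ b ∈ F, ∀ k, v a = some k → v b = some k → ¬ Adj k a.1 b.1) :
    ∃ z : {a : Vertex I // a.Valid}, z ∉ F ∧ z.1.lab = i ∧
      ∀ a ∈ F, ∀ k, Adj k z.1 a.1 ↔ v a = some k := by
  let x : Fin F.card → {a : Vertex I // a.Valid} := fun j => (F.equivFin.symm j).1
  have hx : ∀ j, x j ∈ F := fun j => (F.equivFin.symm j).2
  have hinj : ∀ j j', (x j).1 = (x j').1 → j = j' := fun j j' h =>
    F.equivFin.symm.injective (Subtype.ext (Subtype.ext h))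
  have hsurj : ∀ a ∈ F, ∃ j, x j = a := fun a ha => ⟨F.equivFin ⟨a, ha⟩, by simp [x]⟩
  let z : Vertex I := mk i F.card (fun j => (x j).1) fun j => v (x j)
  have hrank : ∀ a ∈ F, a.1.rank < z.rank := fun a ha => by
    obtain ⟨j, rfl⟩ := hsurj a ha
    show _ < ∑ j, (x j).1.rank + 1
    rw [Nat.lt_succ_iff]
    exact Finset.single_le_sum (f := fun j => (x j).1.rank) (fun _ _ => Nat.zero_le _)
      (Finset.mem_univ j)
  refine ⟨⟨z, ?_⟩, fun hz => (hrank _ hz).false, rfl, fun a ha k => ⟨fun h => ?_, fun h => ?_⟩⟩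
  · rw [Valid]
    exact ⟨fun j => (x j).2, fun j j' h => by rw [hinj _ _ h],
      fun j j' k h h' => hv _ (hx j) _ (hx j') k h h'⟩
  · obtain ⟨j, hj, hk⟩ := h.decl (hrank a ha).le
    rwa [← Subtype.ext hj]
  · obtain ⟨j, rfl⟩ := hsurj a ha
    exact .inl ⟨j, rfl, h⟩

/-- The graph of valid vertices. -/
def graph (I : Type u) : UniversalGraph I {a : Vertex I // a.Valid} where
  lab a := a.1.lab
  Adj k a b := Adj k a.1 b.1
  symm _ _ _ h := h.symm
  irrefl k a h := (h.decl le_rfl).rank_lt.false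
  unique k l a b h h' := by
    rcases le_total b.1.rank a.1.rank with h1 | h1
    · exact a.2.decl_unique (h.decl h1) (h'.decl h1)
    · exact b.2.decl_unique (h.symm.decl h1) (h'.symm.decl h1)
  triangle k a b c := no_triangle a.2 b.2 c.2
  ext := exists_ext

end Vertex

/-! ### Back-and-forth and recolouring. -/

namespace UniversalGraph

variable {I M : Type u} (𝒢 : UniversalGraph I M) {α : Type}

/-- Equality pattern, labels and the first `N` colours agree on the coordinates in `Γ N`. -/
def Rel (Γ : ℕ → Finset α) (N : ℕ) (s t : α → M) : Prop :=
  ∀ a ∈ Γ N, ∀ b ∈ Γ N, (s a = s b ↔ t a = t b) ∧ 𝒢.lab (s a) = 𝒢.lab (t a) ∧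
    ∀ k < N, 𝒢.Adj k (s a) (s b) ↔ 𝒢.Adj k (t a) (t b)

variable {𝒢} {Γ : ℕ → Finset α}

theorem Rel.symm {N : ℕ} {s t : α → M} (h : 𝒢.Rel Γ N s t) : 𝒢.Rel Γ N t s := fun a ha b hb =>
  let ⟨h1, h2, h3⟩ := h a ha b hb
  ⟨h1.symm, h2.symm, fun k hk => (h3 k hk).symm⟩

theorem Rel.trans {N : ℕ} {s t r : α → M} (h : 𝒢.Rel Γ N s t) (h' : 𝒢.Rel Γ N t r) :
    𝒢.Rel Γ N s r := fun a ha b hb =>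
  let ⟨h1, h2, h3⟩ := h a ha b hb
  let ⟨h1', h2', h3'⟩ := h' a ha b hb
  ⟨h1.trans h1', h2.trans h2', fun k hk => (h3 k hk).trans (h3' k hk)⟩

theorem Rel.anti (hΓ : Monotone Γ) {N N' : ℕ} (hN : N ≤ N') {s t : α → M}
    (h : 𝒢.Rel Γ N' s t) : 𝒢.Rel Γ N s t := fun a ha b hb =>
  let ⟨h1, h2, h3⟩ := h a (hΓ hN ha) b (hΓ hN hb)
  ⟨h1, h2, fun k hk => h3 k (hk.trans_le hN)⟩

theorem adj_comm {k : ℕ} {a b : M} : 𝒢.Adj k a b ↔ 𝒢.Adj k b a := ⟨𝒢.symm k a b, 𝒢.symm k b a⟩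

/-- If `c` already occurs among the relevant other entries of `s`, the matching entry of `t` is
taken. Otherwise a new vertex copies the label of `c` and its colours below `N`; a forbidden
triangle over `t` would already be one over `s`. -/
theorem Rel.update [DecidableEq α] {N : ℕ} {s t : α → M} (h : 𝒢.Rel Γ N s t) (i : α) (c : M) :
    ∃ z, 𝒢.Rel Γ N (Function.update s i c) (Function.update t i z) := by
  classical
  have key : ∀ z, (∀ a ∈ Γ N, a ≠ i → (c = s a ↔ z = t a)) → 𝒢.lab c = 𝒢.lab z →
      (∀ a ∈ Γ N, a ≠ i → ∀ k < N, (𝒢.Adj k c (s a) ↔ 𝒢.Adj k z (t a))) →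
      𝒢.Rel Γ N (Function.update s i c) (Function.update t i z) := by
    intro z h1 h2 h3 a ha b hb
    rcases eq_or_ne a i with hai | hai <;> rcases eq_or_ne b i with hbi | hbi
    · simp [hai, hbi, h2, 𝒢.irrefl]
    · subst hai
      simp only [Function.update_self, Function.update_of_ne hbi]
      exact ⟨h1 b hb hbi, h2, h3 b hb hbi⟩
    · subst hbi
      simp only [Function.update_self, Function.update_of_ne hai]
      refine ⟨by rw [eq_comm, h1 a ha hai, eq_comm], (h a ha a ha).2.1, fun k hk => ?_⟩
      rw [adj_comm, h3 a ha hai k hk, adj_comm]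
    · simp only [Function.update_of_ne hbi, Function.update_of_ne hai]
      exact h a ha b hb
  by_cases hc : ∃ g ∈ Γ N, g ≠ i ∧ c = s g
  · obtain ⟨g, hg, -, rfl⟩ := hc
    exact ⟨t g, key _ (fun a ha _ => (h g hg a ha).1) (h g hg g hg).2.1
      fun a ha _ => (h g hg a ha).2.2⟩
  -- Colours from `N` on are dropped: `Rel` says nothing about them for `t`, so copying them might
  -- create triangles.
  let P : M → ℕ → Prop := fun w k => k < N ∧ ∃ g ∈ Γ N, t g = w ∧ 𝒢.Adj k c (s g)
  let v : M → Option ℕ := fun w => if h : ∃ k, P w k then some h.choose else none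
  have hP : ∀ g ∈ Γ N, ∀ k, P (t g) k ↔ k < N ∧ 𝒢.Adj k c (s g) := fun g hg k =>
    and_congr_right fun hk => ⟨fun ⟨g', hg', h1, h2⟩ => ((h g' hg' g hg).1.2 h1) ▸ h2,
      fun h' => ⟨g, hg, rfl, h'⟩⟩
  have hv : ∀ g ∈ Γ N, ∀ k, v (t g) = some k ↔ k < N ∧ 𝒢.Adj k c (s g) := by
    intro g hg k
    rw [← hP g hg]
    by_cases h' : ∃ k, P (t g) k
    · have h1 : v (t g) = some h'.choose := dif_pos h'
      have h2 := h'.choose_spec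
      rw [h1, Option.some_inj]
      refine ⟨fun h3 => h3 ▸ h2, fun h3 => ?_⟩
      exact 𝒢.unique _ _ _ _ ((hP g hg _).1 h2).2 ((hP g hg _).1 h3).2
    · have h1 : v (t g) = none := dif_neg h'
      rw [h1]
      exact ⟨fun h => by simp at h, fun h => (h' ⟨k, h⟩).elim⟩
  obtain ⟨z, hz1, hz2, hz3⟩ := 𝒢.ext (𝒢.lab c) (((Γ N).erase i).image t) v (by
    simp only [Finset.mem_image, Finset.mem_erase]
    rintro _ ⟨a, ⟨-, ha⟩, rfl⟩ _ ⟨b, ⟨-, hb⟩, rfl⟩ k h1 h2 h3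
    rw [hv a ha] at h1
    rw [hv b hb] at h2
    exact 𝒢.triangle k c (s a) (s b) h1.2 (((h a ha b hb).2.2 k h1.1).2 h3) h2.2)
  refine ⟨z, key z (fun a ha hai => ⟨fun h' => (hc ⟨a, ha, hai, h'⟩).elim, fun h' => ?_⟩) hz2.symm
    fun a ha hai k hk => ?_⟩
  · exact (hz1 (h' ▸ Finset.mem_image_of_mem t (Finset.mem_erase.2 ⟨hai, ha⟩))).elim
  · rw [hz3 _ (Finset.mem_image_of_mem t (Finset.mem_erase.2 ⟨hai, ha⟩)), hv a ha]
    simp [hk]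

/-- Every finite vertex-labelled complete graph whose edges are coloured without monochromatic
triangles embeds. -/
theorem exists_realization (C : M → M → ℕ) (hC : ∀ a b, C a b = C b a) (F : Finset M)
    (hF : ∀ a ∈ F, ∀ b ∈ F, ∀ c ∈ F, a ≠ b → b ≠ c → a ≠ c → C a b = C b c → C a b = C a c →
      False) :
    ∃ φ : M → M, Set.InjOn φ F ∧ (∀ a ∈ F, 𝒢.lab (φ a) = 𝒢.lab a) ∧
      ∀ a ∈ F, ∀ b ∈ F, a ≠ b → 𝒢.Adj (C a b) (φ a) (φ b) := by
  classical
  induction F using Finset.induction_on with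
  | empty => exact ⟨id, by simp⟩
  | insert a F ha ih =>
    obtain ⟨φ, h1, h2, h3⟩ := ih fun x hx y hy z hz =>
      hF x (Finset.mem_insert_of_mem hx) y (Finset.mem_insert_of_mem hy) z
        (Finset.mem_insert_of_mem hz)
    have hne : ∀ x ∈ F, x ≠ a := fun x hx h => ha (h ▸ hx)
    have : Nonempty M := ⟨a⟩
    have hinv : ∀ x ∈ F, Function.invFunOn φ F (φ x) = x := fun x hx =>
      h1.leftInvOn_invFunOn hx
    obtain ⟨z, hz1, hz2, hz3⟩ := 𝒢.ext (𝒢.lab a) (F.image φ)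
      (fun w => some (C a (Function.invFunOn φ F w))) (by
        simp only [Finset.mem_image, Option.some_inj]
        rintro _ ⟨x, hx, rfl⟩ _ ⟨y, hy, rfl⟩ k h4 h5 h6
        rw [hinv x hx] at h4
        rw [hinv y hy] at h5
        rcases eq_or_ne x y with rfl | hxy
        · exact 𝒢.irrefl _ _ h6
        have h7 := 𝒢.unique _ _ _ _ h6 (h3 x hx y hy hxy)
        exact hF a (Finset.mem_insert_self _ _) x (Finset.mem_insert_of_mem hx) y
          (Finset.mem_insert_of_mem hy) (hne x hx).symm hxy (hne y hy).symm (h4.trans h7)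
          (h4.trans h5.symm))
    have hz4 : ∀ x ∈ F, z ≠ φ x := fun x hx h => hz1 (h ▸ Finset.mem_image_of_mem φ hx)
    have hz5 : ∀ x ∈ F, 𝒢.Adj (C a x) z (φ x) := fun x hx =>
      (hz3 _ (Finset.mem_image_of_mem φ hx) _).2 (by rw [hinv x hx])
    have hφ : ∀ x ∈ F, Function.update φ a z x = φ x := fun x hx =>
      Function.update_of_ne (hne x hx) _ _
    refine ⟨Function.update φ a z, ?_, ?_, ?_⟩
    · intro x hx y hy hxy
      rcases Finset.mem_insert.1 hx with hxa | hx <;> rcases Finset.mem_insert.1 hy with hya | hy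
      · rw [hxa, hya]
      · rw [hxa, Function.update_self, hφ y hy] at hxy
        exact (hz4 y hy hxy).elim
      · rw [hya, Function.update_self, hφ x hx] at hxy
        exact (hz4 x hx hxy.symm).elim
      · rw [hφ x hx, hφ y hy] at hxy
        exact h1 hx hy hxy
    · intro x hx
      rcases Finset.mem_insert.1 hx with rfl | hx
      · rw [Function.update_self, hz2]
      · rw [hφ x hx, h2 x hx]
    · intro x hx y hy hxy
      rcases Finset.mem_insert.1 hx with hxa | hx <;> rcases Finset.mem_insert.1 hy with hya | hy
      · exact (hxy (hxa.trans hya.symm)).elim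
      · rw [hxa, Function.update_self, hφ y hy]
        exact hz5 y hy
      · rw [hya, Function.update_self, hφ x hx, hC]
        exact 𝒢.symm _ _ _ (hz5 x hx)
      · rw [hφ x hx, hφ y hy]
        exact h3 x hx y hy hxy

/-- The uncoloured edges of a finite sequence can be coloured without changing the first colours. -/
theorem exists_rel_coloured [Finite α] (N : ℕ) (s : α → M) :
    ∃ t, 𝒢.Rel Γ N s t ∧ ∀ a b, t a ≠ t b → ∃ k, 𝒢.Adj k (t a) (t b) := by
  classical
  obtain ⟨e, he⟩ := Set.countable_iff_exists_injOn.1 (Set.finite_range s).countable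
  -- Colours below `N` are kept. The others become `N + e x + e y`, which differs from all kept
  -- colours, and three equal sums would contradict the injectivity of `e`.
  let C : M → M → ℕ := fun x y =>
    if h : ∃ k < N, 𝒢.Adj k x y then h.choose else N + e x + e y
  have hC1 : ∀ x y k, k < N → 𝒢.Adj k x y → C x y = k := fun x y k hk h => by
    have h' : ∃ k < N, 𝒢.Adj k x y := ⟨k, hk, h⟩
    rw [show C x y = h'.choose from dif_pos h']
    exact 𝒢.unique _ _ _ _ h'.choose_spec.2 h
  have hC2 : ∀ x y, (C x y < N ∧ 𝒢.Adj (C x y) x y) ∨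
      C x y = N + e x + e y ∧ ¬ ∃ k < N, 𝒢.Adj k x y := fun x y => by
    by_cases h : ∃ k < N, 𝒢.Adj k x y
    · rw [show C x y = h.choose from dif_pos h]
      exact .inl h.choose_spec
    · exact .inr ⟨dif_neg h, h⟩
  have hC : ∀ x y, C x y = C y x := fun x y => by
    rcases hC2 x y with ⟨h1, h2⟩ | ⟨h1, h2⟩
    · exact (hC1 y x _ h1 (𝒢.symm _ _ _ h2)).symm
    · rcases hC2 y x with ⟨h3, h4⟩ | ⟨h3, h4⟩
      · exact (h2 ⟨_, h3, 𝒢.symm _ _ _ h4⟩).elim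
      · omega
  obtain ⟨φ, h1, h2, h3⟩ := 𝒢.exists_realization C hC (Set.finite_range s).toFinset (by
    simp only [Set.Finite.mem_toFinset]
    intro a ha b hb c hc hab hbc hac e1 e2
    rcases hC2 a b with ⟨h1, h2⟩ | ⟨h1, -⟩ <;> rcases hC2 b c with ⟨h3, h4⟩ | ⟨h3, -⟩ <;>
      rcases hC2 a c with ⟨h5, h6⟩ | ⟨h5, -⟩ <;> try omega
    · exact 𝒢.triangle _ _ _ _ h2 (e1 ▸ h4) (e2 ▸ h6)
    · exact hab (he ha hb (by omega)))
  simp only [Set.Finite.mem_toFinset, Set.Finite.coe_toFinset, Set.forall_mem_range] at h1 h2 h3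
  have hinj : ∀ a b, φ (s a) = φ (s b) ↔ s a = s b := fun a b =>
    h1.eq_iff ⟨a, rfl⟩ ⟨b, rfl⟩
  refine ⟨φ ∘ s, fun a _ b _ => ⟨(hinj a b).symm, (h2 a).symm, fun k hk => ?_⟩, fun a b hab =>
    ⟨_, h3 a b fun h => hab (congrArg φ h)⟩⟩
  rcases eq_or_ne (s a) (s b) with hab | hab
  · simp [hab, 𝒢.irrefl]
  · refine ⟨fun h => ?_, fun h => ?_⟩
    · have := h3 a b hab
      rwa [hC1 _ _ k hk h] at this
    · have h4 := 𝒢.unique _ _ _ _ h (h3 a b hab)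
      rcases hC2 (s a) (s b) with ⟨h5, h6⟩ | ⟨h5, h6⟩
      · rwa [h4]
      · omega

end UniversalGraph

/-! ### The finite- and infinite-dimensional fields of the graph. -/

namespace UniversalGraph

variable {I M : Type u} (𝒢 : UniversalGraph I M)

/-- The field of sets invariant under one of the relations `Rel Γ N`. -/
def field {α : Type} [DecidableEq α] (Γ : ℕ → Finset α) (hΓ : Monotone Γ) (hex : ∀ a, ∃ N, a ∈ Γ N) :
    CylField α M :=
  CylField.ofRel (𝒢.Rel Γ) (fun _ _ _ h => h.symm) (fun _ _ _ _ hN h => h.anti hΓ hN)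
    (fun _ _ _ i a h => h.update i a) fun i j => by
      obtain ⟨N, hN⟩ := hex i
      obtain ⟨N', hN'⟩ := hex j
      exact ⟨max N N', fun s t h hs => (h i (hΓ (le_max_left _ _) hN) j
        (hΓ (le_max_right _ _) hN')).1.1 hs⟩

variable (n : ℕ)

/-- The `n`-dimensional field of sets. -/
def fieldFin : CylField (Fin n) M :=
  𝒢.field (fun _ => Finset.univ) monotone_const fun _ => ⟨0, Finset.mem_univ _⟩

/-- The `ω`-dimensional field of sets. -/
def fieldNat : CylField ℕ M :=
  𝒢.field Finset.range Finset.range_mono fun a => ⟨a + 1, Finset.self_mem_range_succ a⟩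

variable {𝒢 n}

theorem mem_fieldFin {X : Set (Fin n → M)} : X ∈ (𝒢.fieldFin n).sets ↔
    ∃ N, ∀ s t, 𝒢.Rel (fun _ => Finset.univ) N s t → s ∈ X → t ∈ X := Iff.rfl

theorem mem_fieldNat {X : Set (ℕ → M)} : X ∈ 𝒢.fieldNat.sets ↔
    ∃ N, ∀ s t, 𝒢.Rel Finset.range N s t → s ∈ X → t ∈ X := Iff.rfl

theorem exists_coloured_mem {X : (𝒢.fieldFin n).sets} (hX : X ≠ ⊥) :
    ∃ t ∈ X.1, ∀ a b, t a ≠ t b → ∃ k, 𝒢.Adj k (t a) (t b) := by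
  obtain ⟨s, hs⟩ : ∃ s, s ∈ X.1 := by
    by_contra! h
    exact hX ((𝒢.fieldFin n).ext_iff.2 fun s => ⟨fun hs => h s hs, fun hs => hs.elim⟩)
  obtain ⟨N, hN⟩ := mem_fieldFin.1 X.2
  obtain ⟨t, h1, h2⟩ := 𝒢.exists_rel_coloured (Γ := fun _ => Finset.univ) N s
  exact ⟨t, hN s t h1 hs, h2⟩

/-- A nonempty member contains a totally coloured sequence `t`. If `N` exceeds all its colours, the
`N`-class of `t` is an atom: no edge can receive a second colour, so its members agree with `t` at
every level. -/
theorem isAtomic_fieldFin : IsAtomic (𝒢.fieldFin n).sets := by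
  refine ⟨fun X => or_iff_not_imp_left.2 fun hX => ?_⟩
  obtain ⟨t, htX, ht⟩ := exists_coloured_mem hX
  obtain ⟨N0, hN0⟩ := mem_fieldFin.1 X.2
  have hcol : ∃ N, ∀ a b, t a ≠ t b → ∃ k < N, 𝒢.Adj k (t a) (t b) := by
    choose! k hk using ht
    refine ⟨∑ a, ∑ b, k a b + 1, fun a b hab => ⟨k a b, ?_, hk a b hab⟩⟩
    rw [Nat.lt_succ_iff]
    exact (Finset.single_le_sum (f := fun b => k a b) (fun _ _ => Nat.zero_le _)
      (Finset.mem_univ b)).trans (Finset.single_le_sum (f := fun a => ∑ b, k a b)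
        (fun _ _ => Nat.zero_le _) (Finset.mem_univ a))
  obtain ⟨N, hN⟩ := hcol
  let A : (𝒢.fieldFin n).sets := ⟨{r | 𝒢.Rel (fun _ => Finset.univ) N t r},
    mem_fieldFin.2 ⟨N, fun r r' h (hr : 𝒢.Rel _ N t r) => hr.trans h⟩⟩
  have htA : t ∈ A.1 := fun a _ b _ => ⟨Iff.rfl, rfl, fun _ _ => Iff.rfl⟩
  have hall : ∀ r ∈ A.1, ∀ N', 𝒢.Rel (fun _ => Finset.univ) N' t r := by
    intro r hr N' a ha b hb
    obtain ⟨h1, h2, h3⟩ := hr a ha b hb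
    refine ⟨h1, h2, fun k _ => ?_⟩
    by_cases hab : t a = t b
    · rw [hab, h1.1 hab]
      exact iff_of_false (𝒢.irrefl _ _) (𝒢.irrefl _ _)
    · obtain ⟨l, hl, hadj⟩ := hN a b hab
      constructor <;> intro h
      · obtain rfl := 𝒢.unique _ _ _ _ h hadj
        exact (h3 k hl).1 h
      · obtain rfl := 𝒢.unique _ _ _ _ h ((h3 l hl).1 hadj)
        exact hadj
  have hle : ∀ Y : (𝒢.fieldFin n).sets, ∀ r ∈ A.1, r ∈ Y.1 → A ≤ Y := by
    intro Y r hr hrY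
    obtain ⟨N', hN'⟩ := mem_fieldFin.1 Y.2
    exact (𝒢.fieldFin n).le_iff.2 fun r' hr' =>
      hN' r r' ((hall r hr N').symm.trans (hall r' hr' N')) hrY
  refine ⟨A, ⟨fun h => ((𝒢.fieldFin n).ext_iff.1 h t).1 htA, fun Y hY => ?_⟩, hle X t htA htX⟩
  refine (𝒢.fieldFin n).ext_iff.2 fun r => ⟨fun hr => ?_, fun hr => hr.elim⟩
  exact (hY.not_ge (hle Y r ((𝒢.fieldFin n).le_iff.1 hY.le r hr) hr)).elim

/-- Membership in `X` depends on finitely many coordinates only, so finitely many one-coordinate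
changes lead from `s` to a sequence indistinguishable from `t`. -/
theorem mem_of_agree {X : 𝒢.fieldNat.sets} (hX : ∀ i, n ≤ i → 𝒢.fieldNat.toAlg.c i X = X)
    {s t : ℕ → M} (hst : ∀ m < n, s m = t m) (hs : s ∈ X.1) : t ∈ X.1 := by
  obtain ⟨N, hN⟩ := mem_fieldNat.1 X.2
  have key : ∀ j, n ≤ j → (fun m => if m < j then t m else s m) ∈ X.1 := by
    intro j hj
    induction j, hj using Nat.le_induction with
    | base =>
      convert hs using 1
      ext m
      split_ifs with h
      · exact (hst m h).symm
      · rfl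
    | succ j hj ih =>
      rw [← hX j hj]
      refine ⟨s j, ?_⟩
      convert ih using 1
      ext m
      rcases lt_trichotomy m j with h | rfl | h
      · simp [h.ne, h, h.le]
      · simp
      · simp [h.ne', h.not_gt, h.not_ge]
  refine hN _ t (fun a ha b hb => ?_) (key (max n N) (le_max_left _ _))
  have ha' : a < max n N := (Finset.mem_range.1 ha).trans_le (le_max_right _ _)
  have hb' : b < max n N := (Finset.mem_range.1 hb).trans_le (le_max_right _ _)
  simp [ha', hb']

theorem isNeatReduct_fieldFin [NeZero n] : (𝒢.fieldFin n).toAlg.IsNeatReduct n := by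
  have hext : ∀ t : Fin n → M, ∃ s : ℕ → M, (fun m : Fin n => s m) = t := fun t =>
    ⟨fun m => if h : m < n then t ⟨m, h⟩ else t 0, by ext m; simp⟩
  have hupd : ∀ (s : ℕ → M) (i : Fin n) u,
      (fun m : Fin n => Function.update s i u m) = Function.update (fun m : Fin n => s m) i u :=
    fun s i u => Function.update_comp_eq_of_injective s Fin.val_injective i u
  let F : BoundedLatticeHom (𝒢.fieldFin n).toAlg (𝒢.fieldNat.toAlg.rd n) :=
    { toFun := fun X => ⟨{s | (fun m : Fin n => s m) ∈ X.1}, by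
        obtain ⟨N, hN⟩ := mem_fieldFin.1 X.2
        refine mem_fieldNat.2 ⟨max n N, fun s t h hs => hN _ _ (fun a _ b _ => ?_) hs⟩
        have ha : ∀ a : Fin n, a.1 ∈ Finset.range (max n N) := fun a =>
          Finset.mem_range.2 (a.2.trans_le (le_max_left _ _))
        obtain ⟨h1, h2, h3⟩ := h a (ha a) b (ha b)
        exact ⟨h1, h2, fun k hk => h3 k (hk.trans_le (le_max_right _ _))⟩⟩
      map_sup' := fun _ _ => rfl
      map_inf' := fun _ _ => rfl
      map_top' := rfl
      map_bot' := rfl }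
  refine ⟨𝒢.fieldNat.toAlg, 𝒢.fieldNat.isTCA, F, fun X Y hXY => ?_,
    ⟨⟨fun i X => ?_, fun i j => rfl⟩, fun i X => rfl⟩, ?_⟩
  · refine (𝒢.fieldFin n).ext_iff.2 fun t => ?_
    obtain ⟨s, rfl⟩ := hext t
    exact 𝒢.fieldNat.ext_iff.1 hXY s
  · refine 𝒢.fieldNat.ext_iff.2 fun s => ?_
    show (∃ u, Function.update (fun m : Fin n => s m) i u ∈ X.1) ↔
      ∃ u, (fun m : Fin n => Function.update s i u m) ∈ X.1
    simp only [hupd]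
  · ext X
    constructor
    · rintro ⟨Y, rfl⟩ i hi
      by_contra hin
      apply hi
      refine 𝒢.fieldNat.ext_iff.2 fun s => ?_
      show (∃ u, (fun m : Fin n => Function.update s i u m) ∈ Y.1) ↔ (fun m : Fin n => s m) ∈ Y.1
      have : ∀ u, (fun m : Fin n => Function.update s i u m) = fun m : Fin n => s m := fun u => by
        ext m
        exact Function.update_of_ne (fun h : (m : ℕ) = i => hin (Set.mem_Iio.2 (h ▸ m.2))) _ _
      simp only [this]
      exact ⟨fun ⟨_, h⟩ => h, fun h => ⟨s 0, h⟩⟩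
    · intro hX
      have hX' : ∀ i, n ≤ i → 𝒢.fieldNat.toAlg.c i X = X := fun i hi =>
        CylSig.notMem_dimSet.1 fun h => absurd (hX h) (by simpa using hi)
      -- Irrelevant coordinates repeat coordinate `0`, so that the type of `t ∘ π` is determined by
      -- that of `t`.
      let π : ℕ → Fin n := fun m => if h : m < n then ⟨m, h⟩ else 0
      have hπ : ∀ s : ℕ → M, ∀ m < n, s (π m) = s m := fun s m hm => by simp [π, hm]
      refine ⟨⟨{t | t ∘ π ∈ X.1}, ?_⟩, ?_⟩
      · obtain ⟨N, hN⟩ := mem_fieldNat.1 X.2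
        exact mem_fieldFin.2 ⟨N, fun s t h hs => hN _ _
          (fun a _ b _ => h (π a) (Finset.mem_univ _) (π b) (Finset.mem_univ _)) hs⟩
      · refine 𝒢.fieldNat.ext_iff.2 fun s => ?_
        show (fun m => s (π m)) ∈ X.1 ↔ s ∈ X.1
        exact ⟨fun h => mem_of_agree hX' (hπ s) h,
          fun h => mem_of_agree hX' (fun m hm => (hπ s m hm).symm) h⟩

/-! ### Failure of complete representability. -/

variable (𝒢)

/-- The sequences whose `m`-th entry has label `i`. -/
def labSet (i : I) (m : Fin n) : (𝒢.fieldFin n).sets :=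
  ⟨{s | 𝒢.lab (s m) = i}, mem_fieldFin.2 ⟨0, fun _ t h hs =>
    ((h m (Finset.mem_univ _) m (Finset.mem_univ _)).2.1.symm.trans hs : 𝒢.lab (t m) = i)⟩⟩

/-- The sequences whose `a`-th and `b`-th entries are joined with colour `k`. -/
def adjSet (k : ℕ) (a b : Fin n) : (𝒢.fieldFin n).sets :=
  ⟨{s | 𝒢.Adj k (s a) (s b)}, mem_fieldFin.2 ⟨k + 1, fun _ _ h hs =>
    ((h a (Finset.mem_univ _) b (Finset.mem_univ _)).2.2 k (Nat.lt_succ_self k)).1 hs⟩⟩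

theorem exists_lab (i : I) : ∃ z, 𝒢.lab z = i :=
  (𝒢.ext i ∅ (fun _ => none) (by simp)).imp fun _ h => h.2.1

-- Each label yields a represented sequence whose coordinates `o`, `l`, `q` stand for three copies
-- of one point with that label. Completeness assigns a colour to each pair of distinct labels, and
-- the three copies suffice to exclude monochromatic triangles.
open Cardinal in
theorem not_dfCompletelyRepresentable (hn : 2 < n) (hI : 𝔠 < #I) :
    ¬ (𝒢.fieldFin n).toAlg.toCylSig.DfCompletelyRepresentable := by
  rintro ⟨ι, U, f, hf, hc, hglb⟩
  let o : Fin n := ⟨0, by omega⟩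
  let l : Fin n := ⟨1, by omega⟩
  let q : Fin n := ⟨2, hn⟩
  have hol : o ≠ l := by simp [o, l]
  have hoq : o ≠ q := by simp [o, q]
  have hlq : l ≠ q := by simp [l, q]
  have hI' : Nonempty I := by
    rw [← Cardinal.mk_ne_zero_iff]
    exact (bot_le.trans_lt hI).ne'
  have hM : ∃ z : M, True := ⟨(𝒢.exists_lab hI'.some).choose, trivial⟩
  obtain ⟨z0, -⟩ := hM
  obtain ⟨⟨t, s0⟩⟩ : Nonempty (Σ t : ι, ∀ k, U t k) := by
    by_contra hemp
    rw [not_nonempty_iff] at hemp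
    have h1 : (⊤ : (𝒢.fieldFin n).sets) = ⊥ := hf (Set.ext fun p => hemp.elim p)
    exact (((𝒢.fieldFin n).ext_iff.1 h1 fun _ => z0).1 trivial).elim
  let mem : (𝒢.fieldFin n).sets → (∀ k, U t k) → Prop := fun X w => (⟨t, w⟩ : Σ t : ι, ∀ k, U t k) ∈ f X
  have mem_inf : ∀ {X Y w}, mem X w → mem Y w → mem (X ⊓ Y) w := fun {X Y w} h h' => by
    show _ ∈ f (X ⊓ Y)
    rw [map_inf]
    exact ⟨h, h'⟩
  have mem_mono : ∀ {X Y w}, mem X w → (∀ s ∈ X.1, s ∈ Y.1) → mem Y w := fun {X Y w} h' h =>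
    OrderHomClass.mono f ((𝒢.fieldFin n).le_iff.2 h) h'
  have mem_bot : ∀ {X w}, mem X w → ¬ ∀ s, s ∉ X.1 := fun {X w} h' h => by
    have h1 : X = ⊥ := (𝒢.fieldFin n).ext_iff.2 fun s => ⟨fun hs => h s hs, fun hs => hs.elim⟩
    have h2 : _ ∈ f X := h'
    rw [h1, map_bot] at h2
    exact h2
  have mem_c : ∀ {i X w}, mem ((𝒢.fieldFin n).toAlg.c i X) w ↔ ∃ u, mem X (Function.update w i u) :=
    fun {i X w} => by
      show _ ∈ f ((𝒢.fieldFin n).toAlg.c i X) ↔ _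
      rw [hc]
      rfl
  have mem_agree : ∀ {X : (𝒢.fieldFin n).sets} (T : Finset (Fin n)), (∀ i ∉ T, (𝒢.fieldFin n).toAlg.c i X = X) →
      ∀ {w w'}, (∀ i ∈ T, w i = w' i) → mem X w → mem X w' := by
    intro X T hT
    -- Coordinates outside `T` are changed one at a time, each change being absorbed by a
    -- cylindrification.
    have key : ∀ S : Finset (Fin n), Disjoint S T → ∀ w w', (∀ i ∉ S, w i = w' i) →
        mem X w → mem X w' := by
      intro S
      induction S using Finset.induction_on with
      | empty =>
        intro _ w w' h hw
        rwa [← funext fun i => h i (Finset.notMem_empty i)]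
      | insert a S ha ih =>
        intro hd w w' h hw
        rw [Finset.disjoint_insert_left] at hd
        rw [← hT a hd.1, mem_c]
        refine ⟨w a, ih hd.2 w _ (fun i hi => ?_) hw⟩
        rcases eq_or_ne i a with rfl | hia
        · simp
        · rw [Function.update_of_ne hia]
          exact h i (by simp [hia, hi])
    intro w w' h hw
    exact key Tᶜ disjoint_compl_left w w' (fun i hi => h i (by simpa using hi)) hw
  have fix_lab : ∀ i m, ∀ j ∉ ({m} : Finset (Fin n)), (𝒢.fieldFin n).toAlg.c j (𝒢.labSet i m) = 𝒢.labSet i m := by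
    intro i m j hj
    refine (𝒢.fieldFin n).ext_iff.2 fun s => ?_
    show (∃ u, 𝒢.lab (Function.update s j u m) = i) ↔ 𝒢.lab (s m) = i
    simp only [Function.update_of_ne fun h : m = j => hj (by simp [h])]
    exact ⟨fun ⟨_, h⟩ => h, fun h => ⟨s m, h⟩⟩
  have fix_adj : ∀ k a b, ∀ j ∉ ({a, b} : Finset (Fin n)),
      (𝒢.fieldFin n).toAlg.c j (𝒢.adjSet k a b) = 𝒢.adjSet k a b := by
    intro k a b j hj
    refine (𝒢.fieldFin n).ext_iff.2 fun s => ?_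
    show (∃ u, 𝒢.Adj k (Function.update s j u a) (Function.update s j u b)) ↔ 𝒢.Adj k (s a) (s b)
    simp only [Function.update_of_ne fun h : a = j => hj (by simp [h]),
      Function.update_of_ne fun h : b = j => hj (by simp [h])]
    exact ⟨fun ⟨_, h⟩ => h, fun h => ⟨s a, h⟩⟩
  have fix_d : ∀ a b, ∀ j ∉ ({a, b} : Finset (Fin n)),
      (𝒢.fieldFin n).toAlg.c j ((𝒢.fieldFin n).toAlg.d a b) = (𝒢.fieldFin n).toAlg.d a b := by
    intro a b j hj
    exact (𝒢.fieldFin n).isCA.fixed_d (fun h => hj (by simp [h])) fun h => hj (by simp [h])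
  have hz : ∀ i, ∃ w, mem (𝒢.labSet i o) w ∧ mem ((𝒢.fieldFin n).toAlg.d o l) w ∧ mem ((𝒢.fieldFin n).toAlg.d o q) w := by
    intro i
    obtain ⟨z, hz⟩ := 𝒢.exists_lab i
    have htop : (𝒢.fieldFin n).toAlg.c o ((𝒢.fieldFin n).toAlg.c l ((𝒢.fieldFin n).toAlg.c q
        (𝒢.labSet i o ⊓ (𝒢.fieldFin n).toAlg.d o l ⊓ (𝒢.fieldFin n).toAlg.d o q))) = ⊤ := by
      refine (𝒢.fieldFin n).ext_iff.2 fun s => ⟨fun _ => trivial, fun _ => ?_⟩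
      let W : Fin n → M := Function.update (Function.update (Function.update s o z) l z) q z
      have h1 : W o = z := by simp [W, hol, hoq]
      have h2 : W l = z := by simp [W, hlq]
      have h3 : W q = z := by simp [W]
      exact ⟨z, z, z, ⟨(congrArg 𝒢.lab h1).trans hz, h1.trans h2.symm⟩, h1.trans h3.symm⟩
    have h1 : mem ⊤ s0 := by
      show _ ∈ f (⊤ : (𝒢.fieldFin n).sets)
      rw [map_top]
      trivial
    rw [← htop, mem_c] at h1
    obtain ⟨u, h1⟩ := h1
    rw [mem_c] at h1
    obtain ⟨u', h1⟩ := h1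
    rw [mem_c] at h1
    obtain ⟨u'', h1⟩ := h1
    exact ⟨_, mem_mono h1 fun s hs => hs.1.1, mem_mono h1 fun s hs => hs.1.2,
      mem_mono h1 fun s hs => hs.2⟩
  choose z hz1 hz2 hz3 using hz
  have hz4 : ∀ i, mem ((𝒢.fieldFin n).toAlg.d l q) (z i) := fun i =>
    mem_mono (mem_inf (hz2 i) (hz3 i)) fun s hs =>
      (show s o = s l from hs.1).symm.trans (show s o = s q from hs.2)
  have hz5 : ∀ i, mem (𝒢.labSet i l) (z i) := fun i =>
    mem_mono (mem_inf (hz1 i) (hz2 i)) fun s hs => by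
      have h1 : 𝒢.lab (s o) = i := hs.1
      have h2 : s o = s l := hs.2
      show 𝒢.lab (s l) = i
      rw [← h2, h1]
  -- The factors of the product may be different sets, so copies of points are combined only at
  -- their own coordinates; the abstract diagonals recorded in `hz2`, `hz3`, `hz4` move statements
  -- between coordinates.
  let mix : I → I → I → ∀ k, U t k := fun i j r m => if m = l then z j m else if m = q then z r m
    else z i m
  have mix_o : ∀ i j r, mix i j r o = z i o := fun i j r => by simp [mix, hol, hoq]
  have mix_l : ∀ i j r, mix i j r l = z j l := fun i j r => by simp [mix]
  have mix_q : ∀ i j r, mix i j r q = z r q := fun i j r => by simp [mix, hlq.symm]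
  -- The only use of completeness: totally coloured sequences are dense, so the complements of the
  -- diagonal and of the colour relations have infimum `⊥`.
  have hcover : ∀ w, mem ((𝒢.fieldFin n).toAlg.d o l) w ∨ ∃ k, mem (𝒢.adjSet k o l) w := by
    intro w
    by_contra! hcon
    have h1 : IsGLB (insert ((𝒢.fieldFin n).toAlg.d o l)ᶜ (Set.range fun k => (𝒢.adjSet k o l)ᶜ)) (⊥ : (𝒢.fieldFin n).sets) := by
      refine ⟨fun _ _ => bot_le, fun Y hY => ?_⟩
      by_contra hne
      obtain ⟨r, hr, hr'⟩ := exists_coloured_mem (X := Y) fun h => hne (h ▸ le_rfl)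
      have h2 : r o ≠ r l := (𝒢.fieldFin n).le_iff.1 (hY (Set.mem_insert _ _)) r hr
      obtain ⟨k, hk⟩ := hr' o l h2
      exact (𝒢.fieldFin n).le_iff.1 (hY (Set.mem_insert_of_mem _ ⟨k, rfl⟩)) r hr hk
    have h2 := hglb _ _ h1
    have h3 : ∀ X : (𝒢.fieldFin n).sets, ¬ mem X w → (⟨t, w⟩ : Σ t : ι, ∀ k, U t k) ∈ f Xᶜ := fun X hX => by
      rw [map_compl']
      exact hX
    have h4 : (⟨t, w⟩ : Σ t : ι, ∀ k, U t k) ∈ f (⊥ : (𝒢.fieldFin n).sets) := by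
      rw [h2]
      simp only [Set.mem_iInter]
      rintro _ (rfl | ⟨k, rfl⟩)
      · exact h3 _ hcon.1
      · exact h3 _ (hcon.2 k)
    rw [map_bot] at h4
    exact h4
  have hcol : ∀ i j, ∃ k, i ≠ j → mem (𝒢.adjSet k o l) (mix i j j) := by
    intro i j
    by_cases hij : i = j
    · exact ⟨0, fun h => (h hij).elim⟩
    rcases hcover (mix i j j) with h | ⟨k, hk⟩
    · have h1 : mem (𝒢.labSet i o) (mix i j j) :=
        mem_agree _ (fix_lab i o) (by simp [mix_o]) (hz1 i)
      have h2 : mem (𝒢.labSet j l) (mix i j j) :=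
        mem_agree _ (fix_lab j l) (by simp [mix_l]) (hz5 j)
      refine (mem_bot (mem_inf h (mem_inf h1 h2)) fun s hs => ?_).elim
      have e1 : s o = s l := hs.1
      have e2 : 𝒢.lab (s o) = i := hs.2.1
      have e3 : 𝒢.lab (s l) = j := hs.2.2
      exact hij (by rw [← e2, ← e3, e1])
    · exact ⟨k, fun _ => hk⟩
  choose c hcol using hcol
  have h01 : ∀ i j w, i ≠ j → w o = z i o → w l = z j l → mem (𝒢.adjSet (c i j) o l) w :=
    fun i j w hij h1 h2 => mem_agree _ (fix_adj _ o l) (by simp [mix_o, mix_l, h1, h2]) (hcol i j hij)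
  have h02 : ∀ i j w, i ≠ j → w o = z i o → w q = z j q → mem (𝒢.adjSet (c i j) o q) w := by
    intro i j w hij h1 h2
    refine mem_agree (w := mix i j j) _ (fix_adj _ o q) (by simp [mix_o, mix_q, h1, h2]) ?_
    have h3 : mem ((𝒢.fieldFin n).toAlg.d l q) (mix i j j) :=
      mem_agree _ (fix_d l q) (by simp [mix_l, mix_q]) (hz4 j)
    refine mem_mono (mem_inf (hcol i j hij) h3) fun s hs => ?_
    have e1 : 𝒢.Adj (c i j) (s o) (s l) := hs.1
    have e2 : s l = s q := hs.2
    show 𝒢.Adj (c i j) (s o) (s q)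
    rwa [← e2]
  have h12 : ∀ i j w, i ≠ j → w l = z i l → w q = z j q → mem (𝒢.adjSet (c i j) l q) w := by
    intro i j w hij h1 h2
    refine mem_agree (w := mix i i j) _ (fix_adj _ l q) (by simp [mix_l, mix_q, h1, h2]) ?_
    have h3 : mem ((𝒢.fieldFin n).toAlg.d o l) (mix i i j) :=
      mem_agree _ (fix_d o l) (by simp [mix_l, mix_o]) (hz2 i)
    refine mem_mono (mem_inf (h02 i j _ hij (mix_o _ _ _) (mix_q _ _ _)) h3) fun s hs => ?_
    have e1 : 𝒢.Adj (c i j) (s o) (s q) := hs.1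
    have e2 : s o = s l := hs.2
    show 𝒢.Adj (c i j) (s l) (s q)
    rwa [← e2]
  have hsymm : ∀ i j, i ≠ j → c i j = c j i := by
    intro i j hij
    have h3 : mem ((𝒢.fieldFin n).toAlg.d o q) (mix j i j) :=
      mem_agree _ (fix_d o q) (by simp [mix_q, mix_o]) (hz3 j)
    have h4 := mem_inf (mem_inf (h12 i j (mix j i j) hij (mix_l _ _ _) (mix_q _ _ _)) h3)
      (h01 j i _ hij.symm (mix_o _ _ _) (mix_l _ _ _))
    by_contra hne
    refine mem_bot h4 fun s hs => hne ?_
    have e1 : 𝒢.Adj (c i j) (s l) (s q) := hs.1.1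
    have e2 : s o = s q := hs.1.2
    have e3 : 𝒢.Adj (c j i) (s o) (s l) := hs.2
    rw [← e2] at e1
    exact 𝒢.unique _ _ _ _ (𝒢.symm _ _ _ e1) e3
  classical
  refine hI.not_ge (mk_le_continuum_of_no_triangle (fun i j => if i = j then 0 else c i j)
    (fun i j => ?_) fun i j r hij hjr hir h1 h2 => ?_)
  · by_cases hij : i = j
    · simp [hij]
    · simp [hij, Ne.symm hij, hsymm i j hij]
  · simp only [hij, hjr, hir, if_false] at h1 h2
    have h4 := mem_inf (mem_inf (h01 i j (mix i j r) hij (mix_o _ _ _) (mix_l _ _ _))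
      (h12 j r (mix i j r) hjr (mix_l _ _ _) (mix_q _ _ _)))
      (h02 i r (mix i j r) hir (mix_o _ _ _) (mix_q _ _ _))
    rw [← h1, ← h2] at h4
    exact mem_bot h4 fun s hs => 𝒢.triangle _ _ _ _ hs.1.1 hs.1.2 hs.2

end UniversalGraph

theorem TopCylSig.CompletelyRepresentable.df {α : Type} [DecidableEq α] {A : TopCylSig.{u} α}
    (h : A.CompletelyRepresentable) : A.toCylSig.DfCompletelyRepresentable := by
  obtain ⟨ι, U, _, f, hf, hom, hglb⟩ := h
  exact ⟨ι, fun t _ => U t, f, hf, fun i x => hom.map_c i x, hglb⟩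

theorem exists_not_completelyRepresentable (n : ℕ) (hn : 2 < n) :
    ∃ A : TopCylSig.{u} (Fin n), A.IsNeatReduct n ∧ IsAtomic A ∧ Uncountable A ∧
      ¬ A.CompletelyRepresentable ∧ ¬ A.toCylSig.DfCompletelyRepresentable := by
  -- There are `2 ^ 𝔠` labels, beyond the bound of `mk_le_continuum_of_no_triangle`.
  let I := ULift.{u} (Set (Set ℕ))
  let 𝒢 := Vertex.graph I
  have hI : Cardinal.continuum < Cardinal.mk I := by
    simpa [I] using Cardinal.cantor Cardinal.continuum
  have : NeZero n := ⟨by omega⟩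
  have hdf := 𝒢.not_dfCompletelyRepresentable hn hI
  refine ⟨(𝒢.fieldFin n).toAlg, UniversalGraph.isNeatReduct_fieldFin,
    UniversalGraph.isAtomic_fieldFin, ?_, fun h => hdf h.df, hdf⟩
  have hI' : Uncountable I := by
    rw [← Cardinal.aleph0_lt_mk_iff]
    exact Cardinal.aleph0_lt_continuum.trans hI
  refine Function.Injective.uncountable (f := fun i : I => 𝒢.labSet i (0 : Fin n)) fun i j hij => ?_
  obtain ⟨z, hz⟩ := 𝒢.exists_lab i
  have h1 : 𝒢.lab z = j := ((𝒢.fieldFin n).ext_iff.1 hij fun _ => z).1 hz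
  exact hz.symm.trans h1

/-! ### Conditions in an `ω`-dimensional algebra. -/

namespace CylSig

variable {B : CylSig.{u} ℕ} {n : ℕ}

/-- The element `⋀ i ∈ S, d i (κ i)`. -/
def diagInf (B : CylSig.{u} ℕ) {n : ℕ} (S : Finset (Fin n)) (κ : Fin n → ℕ) : B :=
  S.inf fun i => B.d i (κ i)

/-- Cylindrification along the first `n` coordinates. -/
def cFirst (B : CylSig.{u} ℕ) (n : ℕ) (x : B) : B := B.cList ((List.finRange n).map Fin.val) x

/-- Almost all cylindrifications fix `x`. -/
def FinDim (B : CylSig.{u} ℕ) (x : B) : Prop := ∃ N, ∀ k, N ≤ k → B.c k x = x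

/-- A nonzero finite-dimensional element that does not depend on the coordinates up to `n`. -/
structure IsCond (B : CylSig.{u} ℕ) (n : ℕ) (p : B) : Prop where
  ne_bot : p ≠ ⊥
  fixed : ∀ k, k ≤ n → B.c k p = p
  finDim : B.FinDim p

namespace IsCA

variable (h : B.IsCA)
include h

theorem finDim_inf {x y : B} (hx : B.FinDim x) (hy : B.FinDim y) : B.FinDim (x ⊓ y) := by
  obtain ⟨N, hN⟩ := hx
  obtain ⟨N', hN'⟩ := hy
  exact ⟨max N N', fun k hk => h.fixed_inf (hN k ((le_max_left _ _).trans hk))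
    (hN' k ((le_max_right _ _).trans hk))⟩

theorem finDim_compl {x : B} (hx : B.FinDim x) : B.FinDim xᶜ :=
  hx.imp fun _ hN k hk => h.fixed_compl (hN k hk)

theorem finDim_d (i j : ℕ) : B.FinDim (B.d i j) :=
  ⟨i + j + 1, fun k hk => h.fixed_d (by omega) (by omega)⟩

theorem finDim_cList (l : List ℕ) {x : B} (hx : B.FinDim x) : B.FinDim (B.cList l x) :=
  hx.imp fun _ hN k hk => h.cList_fixed_of_fixed (hN k hk)

theorem finDim_finset_inf {ι : Type*} (S : Finset ι) (g : ι → B) (hg : ∀ t, B.FinDim (g t)) :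
    B.FinDim (S.inf g) := by
  classical
  induction S using Finset.induction_on with
  | empty => exact ⟨0, fun k _ => h.c_top k⟩
  | insert a S ha ih =>
    rw [Finset.inf_insert]
    exact h.finDim_inf (hg a) ih

theorem diagInf_fixed {S : Finset (Fin n)} {κ : Fin n → ℕ} {k : ℕ} (h1 : ∀ i ∈ S, k ≠ i)
    (h2 : ∀ i ∈ S, k ≠ κ i) : B.c k (B.diagInf S κ) = B.diagInf S κ :=
  h.fixed_finset_inf _ _ fun i hi => h.fixed_d (h1 i hi) (h2 i hi)

theorem finDim_diagInf (S : Finset (Fin n)) (κ : Fin n → ℕ) : B.FinDim (B.diagInf S κ) :=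
  h.finDim_finset_inf _ _ fun _ => h.finDim_d _ _

omit h in
theorem diagInf_univ_update (κ : Fin n → ℕ) (i : Fin n) (j : ℕ) :
    B.diagInf Finset.univ (Function.update κ i j) =
      B.d i j ⊓ B.diagInf (Finset.univ.erase i) κ := by
  rw [← Finset.insert_erase (Finset.mem_univ i), diagInf, Finset.inf_insert, Function.update_self,
    Finset.erase_insert_eq_erase, Finset.erase_idem]
  congr 1
  exact Finset.inf_congr rfl fun k hk => by
    rw [Function.update_of_ne (Finset.ne_of_mem_erase hk)]

omit h in
theorem diagInf_univ (κ : Fin n → ℕ) (i : Fin n) :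
    B.diagInf Finset.univ κ = B.d i (κ i) ⊓ B.diagInf (Finset.univ.erase i) κ := by
  rw [← diagInf_univ_update, Function.update_eq_self]

/-- Neither `p` nor `x` involves a coordinate below `n`, so cylindrifying by these one after another
removes the diagonals. -/
theorem le_of_inf_diagInf_le {κ : Fin n → ℕ} (hκ : ∀ i, n ≤ κ i) (S : Finset (Fin n)) {p x : B}
    (hp : ∀ k, k < n → B.c k p = p) (hx : ∀ k, k < n → B.c k x = x)
    (hpx : p ⊓ B.diagInf S κ ≤ x) : p ≤ x := by
  induction S using Finset.induction_on with
  | empty => simpa [diagInf] using hpx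
  | insert a S ha ih =>
    apply ih
    rw [diagInf, Finset.inf_insert, inf_left_comm, ← h.c_le_iff (hx a a.2), h.c_inf_right,
      h.c_d_top ((a.2.trans_le (hκ a)).ne), top_inf_eq] at hpx
    · exact hpx
    · refine h.fixed_inf (hp a a.2) (h.diagInf_fixed (fun i hi hai => ha ?_) fun i _ => ?_)
      · rwa [Fin.ext hai]
      · exact (a.2.trans_le (hκ i)).ne

/-- Substituting `κ` into `y` and then imposing the equalities `κ` returns `y`: `d_inf_c_d_le` for
one coordinate after another. -/
theorem diagInf_inf_cFirst_le {κ : Fin n → ℕ} (hκ : ∀ i, n ≤ κ i) (y : B) :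
    B.diagInf Finset.univ κ ⊓ B.cFirst n (B.diagInf Finset.univ κ ⊓ y) ≤ y := by
  have key : ∀ l : List (Fin n), l.Nodup → B.diagInf l.toFinset κ ⊓
      B.cList (l.map Fin.val) (B.diagInf l.toFinset κ ⊓ y) ≤ y := by
    intro l
    induction l with
    | nil => intro _; exact inf_le_right.trans inf_le_right
    | cons i l ih =>
      intro hl
      rw [List.nodup_cons] at hl
      have e1 : B.diagInf (i :: l).toFinset κ = B.d i (κ i) ⊓ B.diagInf l.toFinset κ := by
        rw [List.toFinset_cons, diagInf, Finset.inf_insert, diagInf]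
      have e2 : B.cList (l.map Fin.val) (B.d i (κ i) ⊓ (B.diagInf l.toFinset κ ⊓ y)) =
          B.d i (κ i) ⊓ B.cList (l.map Fin.val) (B.diagInf l.toFinset κ ⊓ y) := by
        refine h.cList_inf_left fun m hm => ?_
        obtain ⟨m, hm, rfl⟩ := List.mem_map.1 hm
        refine h.fixed_d (fun hmi => hl.1 ?_) (m.2.trans_le (hκ i)).ne
        rwa [← Fin.ext hmi]
      rw [e1, List.map_cons, cList_cons, inf_assoc _ _ y, e2]
      refine le_trans ?_ (ih hl.2)
      refine le_inf (inf_le_left.trans inf_le_right) (le_trans ?_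
        (h.d_inf_c_d_le (i.2.trans_le (hκ i)).ne _))
      exact inf_le_inf_right _ inf_le_left
  have := key _ (List.nodup_finRange n)
  rwa [List.toFinset_finRange] at this

theorem cFirst_fixed {k : ℕ} (hk : k < n) (x : B) : B.c k (B.cFirst n x) = B.cFirst n x :=
  h.cList_fixed_of_mem (l := (List.finRange n).map Fin.val)
    (List.mem_map.2 ⟨⟨k, hk⟩, List.mem_finRange _, rfl⟩) x

omit h in
theorem lt_of_mem_map_finRange {k : ℕ} (hk : k ∈ (List.finRange n).map Fin.val) : k < n := by
  obtain ⟨m, -, rfl⟩ := List.mem_map.1 hk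
  exact m.2

/-- A condition can be strengthened so as to force a compatible element. -/
theorem exists_cond_le {p y : B} (hp : B.IsCond n p) {κ : Fin n → ℕ} (hκ : ∀ i, n < κ i)
    (hy : B.c n y = y) (hfin : B.FinDim y) (hne : p ⊓ B.diagInf Finset.univ κ ⊓ y ≠ ⊥) :
    ∃ p', B.IsCond n p' ∧ p' ≤ p ∧ p' ⊓ B.diagInf Finset.univ κ ≤ y := by
  have e : B.cFirst n (p ⊓ B.diagInf Finset.univ κ ⊓ y) =
      p ⊓ B.cFirst n (B.diagInf Finset.univ κ ⊓ y) := by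
    rw [inf_assoc]
    exact h.cList_inf_left fun k hk => hp.fixed k (lt_of_mem_map_finRange hk).le
  -- The new condition expresses that `p` holds and `y` holds at the points named by `κ`.
  refine ⟨B.cFirst n (p ⊓ B.diagInf Finset.univ κ ⊓ y), ⟨?_, fun k hk => ?_, ?_⟩, ?_, ?_⟩
  · exact fun h0 => hne (h.cList_eq_bot.1 h0)
  · rcases hk.lt_or_eq with hk | rfl
    · exact h.cFirst_fixed hk _
    · exact h.cList_fixed_of_fixed (h.fixed_inf (h.fixed_inf (hp.fixed _ le_rfl)
        (h.diagInf_fixed (fun i _ => i.2.ne') fun i _ => (hκ i).ne)) hy)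
  · exact h.finDim_cList _ (h.finDim_inf (h.finDim_inf hp.finDim (h.finDim_diagInf _ _)) hfin)
  · rw [e]; exact inf_le_left
  · rw [e, inf_assoc, inf_comm (B.cFirst n _)]
    exact inf_le_right.trans (h.diagInf_inf_cFirst_le (fun i => (hκ i).le) y)

/-- A fresh coordinate provides a witness. -/
theorem exists_cond_update_le {p y : B} (hp : B.IsCond n p) {κ : Fin n → ℕ} (hκ : ∀ i, n < κ i)
    (hy : B.c n y = y) (hfin : B.FinDim y) (i : Fin n)
    (hne : p ⊓ B.diagInf (Finset.univ.erase i) κ ⊓ y ≠ ⊥) :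
    ∃ j p', B.IsCond n p' ∧ p' ≤ p ∧
      p' ⊓ B.diagInf Finset.univ (Function.update κ i (n + 1 + j)) ≤ y := by
  obtain ⟨N, hN⟩ := h.finDim_inf (h.finDim_inf hp.finDim
    (h.finDim_diagInf (Finset.univ.erase i) κ)) hfin
  have hfix := hN (n + 1 + N) (by omega)
  -- Everything is independent of coordinate `n + 1 + N`, so equating it with `i` is consistent.
  refine ⟨N, h.exists_cond_le hp (fun m => ?_) hy hfin fun h0 => hne ?_⟩
  · rcases eq_or_ne m i with rfl | hm
    · rw [Function.update_self]; omega
    · rw [Function.update_of_ne hm]; exact hκ m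
  · rw [diagInf_univ_update, inf_left_comm, inf_assoc, ← h.c_eq_bot (i := n + 1 + N), 
      h.c_inf_right hfix, h.d_symm, h.c_d_top, top_inf_eq] at h0
    · exact h0
    · have := i.2; omega

end IsCA
end CylSig

/-! ### Neat embeddings and the basic density lemmas. -/

namespace TopCylSig

/-- `f` is an isomorphism of `A` onto the neat `n`-reduct of `B`. -/
structure IsNeatEmbedding {n : ℕ} {A : TopCylSig.{u} (Fin n)} {B : TopCylSig.{u} ℕ} (f : A → B) :
    Prop where
  isTCA : B.IsTCA
  le_iff : ∀ x y, f x ≤ f y ↔ x ≤ y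
  map_bot : f ⊥ = ⊥
  map_inf : ∀ x y, f (x ⊓ y) = f x ⊓ f y
  map_compl : ∀ x, f xᶜ = (f x)ᶜ
  map_c : ∀ i x, f (A.c i x) = B.c i (f x)
  map_d : ∀ i j, f (A.d i j) = B.d i j
  map_I : ∀ i x, f (A.I i x) = B.I i (f x)
  fixed : ∀ x k, n ≤ k → B.c k (f x) = f x
  exists_eq : ∀ b, (∀ k, n ≤ k → B.c k b = b) → ∃ x, f x = b

theorem IsNeatReduct.exists_isNeatEmbedding {n : ℕ} {A : TopCylSig.{u} (Fin n)}
    (h : A.IsNeatReduct n) : ∃ (B : TopCylSig.{u} ℕ) (f : A → B), IsNeatEmbedding f := by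
  obtain ⟨B, hB, f, hf, hom, hr⟩ := h
  refine ⟨B, f, hB, fun x y => ?_, map_bot f, fun x y => map_inf f x y,
    fun x => map_compl' f x, hom.map_c, hom.map_d, hom.map_I, fun x k hk => ?_, fun b hb => ?_⟩
  · refine ⟨fun h => ?_, fun h => OrderHomClass.mono f h⟩
    rw [← inf_eq_left] at h ⊢
    exact hf ((map_inf f x y).trans h)
  · have hx : f x ∈ Set.range f := ⟨x, rfl⟩
    rw [hr] at hx
    exact CylSig.notMem_dimSet.1 fun h' => absurd (hx h') (by simpa using hk)
  · have : b ∈ Set.range f := by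
      rw [hr]
      intro i hi
      by_contra hin
      exact hi (hb i (by simpa using hin))
    exact this

/-- The coordinates that serve as names of the points of a generic model. -/
def names (n : ℕ) (τ : Fin n → ℕ) (i : Fin n) : ℕ := n + 1 + τ i

theorem lt_names {n : ℕ} (τ : Fin n → ℕ) (i : Fin n) : n < names n τ i := by
  unfold names; omega

theorem names_update {n : ℕ} (τ : Fin n → ℕ) (i : Fin n) (j : ℕ) :
    names n (Function.update τ i j) = Function.update (names n τ) i (n + 1 + j) := by
  ext m
  rcases eq_or_ne m i with rfl | hm
  · simp [names]
  · simp [names, hm]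

/-- The element saying that the first `n` coordinates are the points named by `τ`. -/
def nameEl (B : CylSig.{u} ℕ) {n : ℕ} (τ : Fin n → ℕ) : B := B.diagInf Finset.univ (names n τ)

/-- The part of `nameEl B τ` that does not concern the coordinate `i`. -/
def nameErase (B : CylSig.{u} ℕ) {n : ℕ} (τ : Fin n → ℕ) (i : Fin n) : B :=
  B.diagInf (Finset.univ.erase i) (names n τ)

section

variable {B : CylSig.{u} ℕ} {n : ℕ}

theorem nameEl_eq (τ : Fin n → ℕ) (i : Fin n) :
    nameEl B τ = B.d i (n + 1 + τ i) ⊓ nameErase B τ i := CylSig.IsCA.diagInf_univ _ i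

theorem nameEl_update (τ : Fin n → ℕ) (i : Fin n) (j : ℕ) :
    nameEl B (Function.update τ i j) = B.d i (n + 1 + j) ⊓ nameErase B τ i := by
  rw [nameEl, names_update, CylSig.IsCA.diagInf_univ_update]
  rfl

theorem nameErase_update (τ : Fin n → ℕ) (i : Fin n) (j : ℕ) :
    nameErase B (Function.update τ i j) i = nameErase B τ i := by
  unfold nameErase CylSig.diagInf
  refine Finset.inf_congr rfl fun m hm => ?_
  rw [names_update, Function.update_of_ne (Finset.ne_of_mem_erase hm)]

theorem nameEl_fixed (h : B.IsCA) (τ : Fin n → ℕ) : B.c n (nameEl B τ) = nameEl B τ :=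
  h.diagInf_fixed (fun i _ => i.2.ne') fun i _ => (lt_names τ i).ne

theorem nameErase_fixed (h : B.IsCA) (τ : Fin n → ℕ) (i : Fin n) :
    B.c n (nameErase B τ i) = nameErase B τ i :=
  h.diagInf_fixed (fun i _ => i.2.ne') fun i _ => (lt_names τ i).ne

theorem nameErase_fixed_self (h : B.IsCA) (τ : Fin n → ℕ) (i : Fin n) :
    B.c i (nameErase B τ i) = nameErase B τ i :=
  h.diagInf_fixed (fun _ hm hmi => Finset.ne_of_mem_erase hm (Fin.ext hmi.symm))
    fun m _ => (i.2.trans (lt_names τ m)).ne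

theorem le_of_inf_nameEl_le (h : B.IsCA) {τ : Fin n → ℕ} {p x : B}
    (hp : ∀ k, k < n → B.c k p = p) (hx : ∀ k, k < n → B.c k x = x)
    (hpx : p ⊓ nameEl B τ ≤ x) : p ≤ x :=
  h.le_of_inf_diagInf_le (fun i => (lt_names τ i).le) _ hp hx hpx

theorem inf_nameEl_ne_bot (h : B.IsCA) {τ : Fin n → ℕ} {p : B} (hp : B.IsCond n p) :
    p ⊓ nameEl B τ ≠ ⊥ := fun h0 =>
  hp.ne_bot (le_bot_iff.1 (le_of_inf_nameEl_le h (fun k hk => hp.fixed k hk.le)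
    (fun k _ => h.c_bot k) h0.le))

end

namespace IsNeatEmbedding

variable {n : ℕ} {A : TopCylSig.{u} (Fin n)} {B : TopCylSig.{u} ℕ} {f : A → B}
  (h : IsNeatEmbedding f)
include h

theorem isCA : B.IsCA := h.isTCA.toIsCA

theorem finDim (x : A) : B.FinDim (f x) := ⟨n, h.fixed x⟩

theorem injective : Function.Injective f := fun x y hxy =>
  le_antisymm ((h.le_iff x y).1 hxy.le) ((h.le_iff y x).1 hxy.ge)

theorem reduct_isCA : A.toCylSig.IsCA where
  c_bot i := h.injective (by rw [h.map_c, h.map_bot, h.isCA.c_bot])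
  le_c i x := by rw [← h.le_iff, h.map_c]; exact h.isCA.le_c _ _
  c_inf_c i x y := h.injective (by
    rw [h.map_c, h.map_inf, h.map_inf, h.map_c, h.map_c, h.isCA.c_inf_c])
  c_comm i j x := h.injective (by rw [h.map_c, h.map_c, h.map_c, h.map_c, h.isCA.c_comm])
  d_self i := by
    rw [← compl_eq_bot]
    apply h.injective
    rw [h.map_compl, h.map_d, h.isCA.d_self, compl_top, h.map_bot]
  d_eq i j k hi hj := h.injective (by
    rw [h.map_c, h.map_inf, h.map_d, h.map_d, h.map_d]
    exact h.isCA.d_eq _ _ _ (fun e => hi (Fin.ext e)) fun e => hj (Fin.ext e))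
  c_d i j x hij := h.injective (by
    rw [h.map_inf, h.map_c, h.map_c, h.map_inf, h.map_inf, h.map_d, h.map_compl, h.map_bot]
    exact h.isCA.c_d _ _ _ fun e => hij (Fin.ext e))

theorem I_le (i : Fin n) (x : A) : A.I i x ≤ x := by
  rw [← h.le_iff, h.map_I]
  exact h.isTCA.I_le _ _

theorem ne_bot {x : A} (hx : x ≠ ⊥) : f x ≠ ⊥ := fun h0 =>
  hx (h.injective (h0.trans h.map_bot.symm))

/-- Cylindrifying `p ⊓ nameEl B.toCylSig τ` by the finitely many relevant coordinates from `n` on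
gives a nonzero element of the neat reduct, hence of `A`. An atom below it is compatible with `p` at
`τ`, since its image passes through these cylindrifications. -/
theorem exists_atom [IsAtomic A] (τ : Fin n → ℕ) {p : B} (hp : B.IsCond n p) :
    ∃ p', B.IsCond n p' ∧ p' ≤ p ∧ ∃ a, IsAtom a ∧ p' ⊓ nameEl B.toCylSig τ ≤ f a := by
  suffices hs : ∃ a, IsAtom a ∧ p ⊓ nameEl B.toCylSig τ ⊓ f a ≠ ⊥ by
    obtain ⟨a, ha, hne⟩ := hs
    obtain ⟨p', h1, h2, h3⟩ := h.isCA.exists_cond_le hp (lt_names τ) (h.fixed a n le_rfl)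
      (h.finDim a) hne
    exact ⟨p', h1, h2, a, ha, h3⟩
  by_contra! hcon
  obtain ⟨N, hN⟩ := h.isCA.finDim_inf hp.finDim (h.isCA.finDim_diagInf Finset.univ (names n τ))
  have hmem : ∀ k, k ∈ (List.range N).filter (n ≤ ·) ↔ k < N ∧ n ≤ k := by simp
  obtain ⟨x, hx⟩ := h.exists_eq
    (B.cList ((List.range N).filter (n ≤ ·)) (p ⊓ nameEl B.toCylSig τ)) fun k hk => by
      rcases lt_or_ge k N with hkN | hkN
      · exact h.isCA.cList_fixed_of_mem ((hmem k).2 ⟨hkN, hk⟩) _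
      · exact h.isCA.cList_fixed_of_fixed (hN k hkN)
  have hx0 : x ≠ ⊥ := by
    rintro rfl
    rw [h.map_bot] at hx
    exact inf_nameEl_ne_bot h.isCA hp (h.isCA.cList_eq_bot.1 hx.symm)
  obtain ⟨a, ha, hax⟩ := (eq_bot_or_exists_atom_le x).resolve_left hx0
  apply h.ne_bot ha.1
  rw [← inf_eq_left.2 ((h.le_iff _ _).2 hax), hx, ← h.isCA.cList_inf_left, h.isCA.cList_eq_bot,
    inf_comm]
  · exact hcon a ha
  · exact fun k hk => h.fixed a k ((hmem k).1 hk).2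

/-- Once an atom `a` is decided at `τ`, either it lies below no `A.c i b` with `b ∈ X`, or such a
`b` can be realized by a fresh name. -/
theorem exists_witness [IsAtomic A] (τ : Fin n → ℕ) (i : Fin n) (X : Set A) {p : B}
    (hp : B.IsCond n p) : ∃ p', B.IsCond n p' ∧ p' ≤ p ∧
      ((∃ a, IsAtom a ∧ p' ⊓ nameEl B.toCylSig τ ≤ f a ∧ ∀ b ∈ X, ¬ a ≤ A.c i b) ∨
        ∃ b ∈ X, ∃ j, p' ⊓ nameEl B.toCylSig (Function.update τ i j) ≤ f b) := by
  obtain ⟨p1, h1, h2, a, ha, h3⟩ := h.exists_atom τ hp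
  by_cases hX : ∃ b ∈ X, a ≤ A.c i b
  · obtain ⟨b, hb, hab⟩ := hX
    obtain ⟨j, p2, h4, h5, h6⟩ := h.isCA.exists_cond_update_le h1 (lt_names τ)
      (h.fixed b n le_rfl) (h.finDim b) i fun h0 => by
        rw [← h.isCA.c_eq_bot (i := (i : ℕ)), h.isCA.c_inf_left, ← h.map_c] at h0
        · refine inf_nameEl_ne_bot h.isCA (τ := τ) h1 (le_bot_iff.1 (le_trans ?_ h0.le))
          refine le_inf (inf_le_inf_left _ ?_) (h3.trans ((h.le_iff _ _).2 hab))
          rw [nameEl_eq τ i]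
          exact inf_le_right
        · exact h.isCA.fixed_inf (h1.fixed i i.2.le) (nameErase_fixed_self h.isCA τ i)
    refine ⟨p2, h4, h5.trans h2, .inr ⟨b, hb, j, ?_⟩⟩
    rw [nameEl, names_update]
    exact h6
  · push Not at hX
    exact ⟨p1, h1, h2, .inl ⟨a, ha, h3, hX⟩⟩

end IsNeatEmbedding

/-! ### Elements describing basic open sets. -/

/-- The element of which the interior along the coordinate `n` defines the open set belonging to
`I i x` and the points named by `τ`. -/
def openEl {n : ℕ} {A : TopCylSig.{u} (Fin n)} {B : TopCylSig.{u} ℕ} (f : A → B)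
    (t : (Fin n → ℕ) × Fin n × A) : B :=
  B.cFirst n (B.diagInf Finset.univ (Function.update (names n t.1) t.2.1 n) ⊓ f t.2.2)

namespace IsNeatEmbedding

variable {n : ℕ} {A : TopCylSig.{u} (Fin n)} {B : TopCylSig.{u} ℕ} {f : A → B}
  (h : IsNeatEmbedding f)
include h

theorem openEl_fixed (t : (Fin n → ℕ) × Fin n × A) {k : ℕ} (hk : k < n) :
    B.c k (openEl f t) = openEl f t := h.isCA.cFirst_fixed hk _

theorem finDim_openEl (t : (Fin n → ℕ) × Fin n × A) : B.FinDim (openEl f t) :=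
  h.isCA.finDim_cList _ (h.isCA.finDim_inf (h.isCA.finDim_diagInf _ _) (h.finDim _))

theorem finDim_c {x : B} (k : ℕ) (hx : B.FinDim x) : B.FinDim (B.c k x) :=
  hx.imp fun _ hN m hm => h.isCA.fixed_c (hN m hm)

theorem finDim_s {x : B} (i j : ℕ) (hx : B.FinDim x) : B.FinDim (B.s i j x) :=
  h.finDim_c _ (h.isCA.finDim_inf (h.isCA.finDim_d _ _) hx)

theorem finDim_I {x : B} (k : ℕ) (hx : B.FinDim x) : B.FinDim (B.I k x) := by
  obtain ⟨N, hN⟩ := hx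
  exact ⟨max N (k + 1), fun m hm => h.isTCA.fixed_I
    (by have := (le_max_right _ _).trans hm; omega) (hN m ((le_max_left _ _).trans hm))⟩

/-- Renaming the coordinate `n` to `i` and back. -/
theorem s_s_cancel {i : ℕ} (hi : i < n) {y : B} (hy : B.c i y = y) : B.s i n (B.s n i y) = y := by
  have hi' := hi.ne
  have e : B.d i n ⊓ B.c n (B.d n i ⊓ y) = B.d i n ⊓ y := by
    rw [h.isCA.d_symm i n]
    exact le_antisymm (le_inf inf_le_left (h.isCA.d_inf_c_d_le hi'.symm y))
      (le_inf inf_le_left (h.isCA.le_c _ _))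
  rw [CylSig.s, CylSig.s, e, h.isCA.c_inf_right hy, h.isCA.c_d_top hi', top_inf_eq]

theorem s_fixed_last {i : ℕ} (y : B) : B.c n (B.s n i y) = B.s n i y := h.isCA.c_c _ _

theorem d_inf_I_openEl {i : ℕ} (hi : i < n) {y : B} (hy : B.c i y = y) :
    B.d i n ⊓ B.I n y = B.d i n ⊓ B.I i (B.s n i y) := by
  have := h.isTCA.d_inf_I_s hi.ne (h.s_fixed_last (i := i) y)
  rwa [h.s_s_cancel hi hy] at this

/-- Given the names of the coordinates other than `i`, `openEl` with `n` renamed to `i` is just `f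
x`. As `nameErase` does not involve `i`, the agreement passes to interiors by `inf_I_congr`. -/
theorem nameErase_inf_I_openEl (τ : Fin n → ℕ) (i : Fin n) (x : A) :
    nameErase B.toCylSig τ i ⊓ B.I i (B.s n i (openEl f (τ, i, x))) =
      nameErase B.toCylSig τ i ⊓ f (A.I i x) := by
  rw [h.map_I]
  refine h.isTCA.inf_I_congr (nameErase_fixed_self h.isCA τ i) ?_
  have hκ : ∀ m, n ≤ Function.update (names n τ) i n m := fun m => by
    rcases eq_or_ne m i with rfl | hm
    · simp
    · rw [Function.update_of_ne hm]; exact (lt_names τ m).le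
  have e1 := CylSig.IsCA.diagInf_univ_update (B := B.toCylSig) (names n τ) i n
  have e2 : B.diagInf Finset.univ (Function.update (names n τ) i n) ⊓ openEl f (τ, i, x) =
      B.diagInf Finset.univ (Function.update (names n τ) i n) ⊓ f x :=
    le_antisymm (le_inf inf_le_left (h.isCA.diagInf_inf_cFirst_le hκ _))
      (le_inf inf_le_left (h.isCA.le_cList _ _))
  rw [e1, inf_assoc, inf_assoc] at e2
  rw [CylSig.s, ← h.isCA.c_inf_left (nameErase_fixed h.isCA τ i), inf_left_comm,
    h.isCA.d_symm]
  change B.c n (B.d i n ⊓ (B.diagInf _ _ ⊓ _)) = _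
  rw [e2, h.isCA.c_inf_right, h.isCA.d_symm, h.isCA.c_d_top i.2.ne', top_inf_eq]
  · rfl
  · exact h.isCA.fixed_inf (nameErase_fixed h.isCA τ i) (h.fixed x n le_rfl)

/-- A condition decides whether a basic open set is contained in a given set. -/
theorem exists_decide_open (T : Finset ((Fin n → ℕ) × Fin n × A)) (τ : Fin n → ℕ) (i : Fin n)
    (x : A) {p : B} (hp : B.IsCond n p) : ∃ p', B.IsCond n p' ∧ p' ≤ p ∧
      (p' ⊓ nameErase B.toCylSig τ i ⊓ B.I i (B.s n i (T.inf (openEl f))) ≤ f x ∨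
        ∃ j, p' ⊓ nameEl B.toCylSig (Function.update τ i j) ≤
          B.I i (B.s n i (T.inf (openEl f))) ⊓ (f x)ᶜ) := by
  by_cases hle : p ⊓ nameErase B.toCylSig τ i ⊓ B.I i (B.s n i (T.inf (openEl f))) ≤ f x
  · exact ⟨p, hp, le_rfl, .inl hle⟩
  -- If the inclusion is not yet forced, its failure is a consistent statement, and a fresh name is
  -- given to a counterexample.
  · obtain ⟨j, p2, h4, h5, h6⟩ := h.isCA.exists_cond_update_le
      (y := B.I i (B.s n i (T.inf (openEl f))) ⊓ (f x)ᶜ) hp (lt_names τ)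
      (h.isCA.fixed_inf (h.isTCA.fixed_I i.2.ne' (h.s_fixed_last _))
        (h.isCA.fixed_compl (h.fixed x n le_rfl)))
      (h.isCA.finDim_inf (h.finDim_I _ (h.finDim_s _ _ (h.isCA.finDim_finset_inf _ _
        h.finDim_openEl))) (h.isCA.finDim_compl (h.finDim x))) i fun h0 => hle (by
          rw [← disjoint_compl_right_iff, disjoint_iff, inf_assoc]
          exact h0)
    refine ⟨p2, h4, h5, .inr ⟨j, ?_⟩⟩
    rw [nameEl, names_update]
    exact h6

end IsNeatEmbedding
end TopCylSig

/-! ### Generic sequences of conditions. -/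

/-- A descending sequence meeting countably many dense sets. -/
theorem exists_antitone_seq {P ι : Type*} [Preorder P] [Countable ι] [Nonempty ι] (C : P → Prop)
    (D : ι → P → Prop) (hD : ∀ t p, C p → ∃ p', C p' ∧ p' ≤ p ∧ D t p') (p0 : P) (h0 : C p0) :
    ∃ p : ℕ → P, Antitone p ∧ p 0 = p0 ∧ (∀ k, C (p k)) ∧ ∀ t, ∃ k, D t (p k) := by
  obtain ⟨e, he⟩ := exists_surjective_nat ι
  choose g hg using fun (k : ℕ) (p : {p // C p}) => hD (e k) p.1 p.2
  let p : ℕ → {p // C p} := fun k => Nat.rec ⟨p0, h0⟩ (fun k p => ⟨g k p, (hg k p).1⟩) k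
  refine ⟨fun k => (p k).1, antitone_nat_of_succ_le fun k => (hg k (p k)).2.1, rfl,
    fun k => (p k).2, fun t => ?_⟩
  obtain ⟨k, rfl⟩ := he t
  exact ⟨k + 1, (hg k (p k)).2.2⟩

namespace TopCylSig

/-- A descending sequence of conditions that meets the dense sets given by a family of sets of
elements and by a set of elements whose interiors are to be described. -/
structure IsGeneric {n : ℕ} {A : TopCylSig.{u} (Fin n)} {B : TopCylSig.{u} ℕ} (f : A → B)
    (𝒳 : Set (Set A)) (𝒴 : Set A) (p : ℕ → B) : Prop where
  anti : Antitone p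
  cond : ∀ k, B.IsCond n (p k)
  atom : ∀ τ : Fin n → ℕ, ∃ k a, IsAtom a ∧ p k ⊓ nameEl B.toCylSig τ ≤ f a
  witness : ∀ (τ : Fin n → ℕ) i, ∀ X ∈ 𝒳, ∃ k,
    (∃ a, IsAtom a ∧ p k ⊓ nameEl B.toCylSig τ ≤ f a ∧ ∀ b ∈ X, ¬ a ≤ A.c i b) ∨
      ∃ b ∈ X, ∃ j, p k ⊓ nameEl B.toCylSig (Function.update τ i j) ≤ f b
  decide_open : ∀ T : Finset ((Fin n → ℕ) × Fin n × A), (∀ t ∈ T, t.2.2 ∈ 𝒴) →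
    ∀ (τ : Fin n → ℕ) (i : Fin n), ∀ x ∈ 𝒴, ∃ k,
      p k ⊓ nameErase B.toCylSig τ i ⊓ B.I i (B.s n i (T.inf (openEl f))) ≤ f x ∨
        ∃ j, p k ⊓ nameEl B.toCylSig (Function.update τ i j) ≤
          B.I i (B.s n i (T.inf (openEl f))) ⊓ (f x)ᶜ

namespace IsNeatEmbedding

variable {n : ℕ} {A : TopCylSig.{u} (Fin n)} {B : TopCylSig.{u} ℕ} {f : A → B}

theorem exists_isGeneric (h : IsNeatEmbedding f) [IsAtomic A] {𝒳 : Set (Set A)} {𝒴 : Set A}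
    (h𝒳 : 𝒳.Countable) (h𝒴 : 𝒴.Countable) {p0 : B} (hp0 : B.IsCond n p0) :
    ∃ p, IsGeneric f 𝒳 𝒴 p ∧ p 0 = p0 := by
  have := h𝒳.to_subtype
  have := h𝒴.to_subtype
  let 𝒯 := {T : Finset ((Fin n → ℕ) × Fin n × A) | ∀ t ∈ T, t.2.2 ∈ 𝒴}
  have h𝒯 : 𝒯.Countable := by
    classical
    refine (Set.countable_range fun T : Finset ((Fin n → ℕ) × Fin n × 𝒴) =>
      T.image fun t : (Fin n → ℕ) × Fin n × 𝒴 =>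
        ((t.1, t.2.1, t.2.2.1) : (Fin n → ℕ) × Fin n × A)).mono fun T hT => ?_
    refine ⟨T.attach.image fun t : T => (t.1.1, t.1.2.1, ⟨t.1.2.2, hT t.1 t.2⟩), ?_⟩
    ext t
    suffices (∃ a b c, (a, b, c) ∈ T ∧ c ∈ 𝒴 ∧ (a, b, c) = t) ↔ t ∈ T by simpa
    exact ⟨fun ⟨_, _, _, h, _, e⟩ => e ▸ h, fun h => ⟨_, _, _, h, hT t h, rfl⟩⟩
  have := h𝒯.to_subtype
  let D : (Fin n → ℕ) ⊕ ((Fin n → ℕ) × Fin n × 𝒳) ⊕ (𝒯 × (Fin n → ℕ) × Fin n × 𝒴) → B → Prop :=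
    Sum.elim (fun τ p => ∃ a, IsAtom a ∧ p ⊓ nameEl B.toCylSig τ ≤ f a)
      (Sum.elim
        (fun t p =>
          (∃ a, IsAtom a ∧ p ⊓ nameEl B.toCylSig t.1 ≤ f a ∧ ∀ b ∈ t.2.2.1, ¬ a ≤ A.c t.2.1 b) ∨
            ∃ b ∈ t.2.2.1, ∃ j, p ⊓ nameEl B.toCylSig (Function.update t.1 t.2.1 j) ≤ f b)
        (fun t p => p ⊓ nameErase B.toCylSig t.2.1 t.2.2.1 ⊓
            B.I t.2.2.1 (B.s n t.2.2.1 (t.1.1.inf (openEl f))) ≤ f t.2.2.2.1 ∨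
          ∃ j, p ⊓ nameEl B.toCylSig (Function.update t.2.1 t.2.2.1 j) ≤
            B.I t.2.2.1 (B.s n t.2.2.1 (t.1.1.inf (openEl f))) ⊓ (f t.2.2.2.1)ᶜ))
  obtain ⟨p, h1, h2, h3, h4⟩ := exists_antitone_seq (B.IsCond n) D (by
    rintro (τ | ⟨τ, i, X⟩ | ⟨T, τ, i, x⟩) p hp
    · exact h.exists_atom τ hp
    · exact h.exists_witness τ i X.1 hp
    · exact h.exists_decide_open T.1 τ i x.1 hp) p0 hp0
  exact ⟨p, ⟨h1, h3, fun τ => h4 (.inl τ), fun τ i X hX => h4 (.inr (.inl (τ, i, ⟨X, hX⟩))),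
    fun T hT τ i x hx => h4 (.inr (.inr (⟨T, hT⟩, τ, i, ⟨x, hx⟩)))⟩, h2⟩

end IsNeatEmbedding

/-! ### Truth in the generic model. -/

/-- The formula `x` holds of the points named by `τ`. -/
def Force {n : ℕ} {B : TopCylSig.{u} ℕ} (p : ℕ → B) (τ : Fin n → ℕ) (x : B) : Prop :=
  ∃ k, p k ⊓ nameEl B.toCylSig τ ≤ x

/-- The names `j` and `j'` denote the same point. -/
def SamePoint (n : ℕ) {B : TopCylSig.{u} ℕ} (p : ℕ → B) (j j' : ℕ) : Prop :=
  ∃ k, p k ≤ B.d (n + 1 + j) (n + 1 + j')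

/-- The point with name `j` belongs to the open set defined by `y`. -/
def InOpen (n : ℕ) {B : TopCylSig.{u} ℕ} (p : ℕ → B) (y : B) (j : ℕ) : Prop :=
  ∃ k, p k ⊓ B.d n (n + 1 + j) ≤ B.I n y

namespace IsGeneric

variable {n : ℕ} {A : TopCylSig.{u} (Fin n)} {B : TopCylSig.{u} ℕ} {f : A → B}
  {𝒳 : Set (Set A)} {𝒴 : Set A} {p : ℕ → B} (g : IsGeneric f 𝒳 𝒴 p) (h : IsNeatEmbedding f)

include g in
theorem force_inf {τ : Fin n → ℕ} {x y : B} (hx : Force p τ x) (hy : Force p τ y) :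
    Force p τ (x ⊓ y) := by
  obtain ⟨k, hk⟩ := hx
  obtain ⟨l, hl⟩ := hy
  exact ⟨max k l, le_inf ((inf_le_inf_right _ (g.anti (le_max_left _ _))).trans hk)
    ((inf_le_inf_right _ (g.anti (le_max_right _ _))).trans hl)⟩

theorem _root_.TopCylSig.Force.mono {τ : Fin n → ℕ} {x y : B} (hx : Force p τ x) (hxy : x ≤ y) :
    Force p τ y := hx.imp fun _ hk => hk.trans hxy

include g h

theorem not_force_bot (τ : Fin n → ℕ) : ¬ Force p τ ⊥ := fun ⟨k, hk⟩ =>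
  inf_nameEl_ne_bot h.isCA (g.cond k) (le_bot_iff.1 hk)

theorem le_iff_force {τ : Fin n → ℕ} {a x : A} (ha : IsAtom a) (hτ : Force p τ (f a)) :
    a ≤ x ↔ Force p τ (f x) := by
  refine ⟨fun hax => hτ.mono ((h.le_iff _ _).2 hax), fun hx => ?_⟩
  rcases ha.le_iff.1 (inf_le_left : a ⊓ x ≤ a) with h0 | h0
  · have := g.force_inf hτ hx
    rw [← h.map_inf, h0, h.map_bot] at this
    exact (g.not_force_bot h τ this).elim
  · exact inf_eq_left.1 h0

theorem force_d {τ : Fin n → ℕ} {i j : Fin n} :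
    Force p τ (B.d i j) ↔ SamePoint n p (τ i) (τ j) := by
  have hd : ∀ m : Fin n, nameEl B.toCylSig τ ≤ B.d m (n + 1 + τ m) := fun m => by
    rw [nameEl_eq τ m]; exact inf_le_left
  refine exists_congr fun k => ⟨fun hk => ?_, fun hk => ?_⟩
  · refine le_of_inf_nameEl_le h.isCA (τ := τ) (fun m hm => (g.cond k).fixed m hm.le)
      (fun m hm => h.isCA.fixed_d (by omega) (by omega)) ?_
    have h1 : p k ⊓ nameEl B.toCylSig τ ≤ B.d (n + 1 + τ i) i := by
      rw [h.isCA.d_symm]; exact inf_le_right.trans (hd i)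
    exact (le_inf ((le_inf h1 hk).trans (h.isCA.d_trans _ _ _)) (inf_le_right.trans (hd j))).trans
      (h.isCA.d_trans _ _ _)
  · have h1 : p k ⊓ nameEl B.toCylSig τ ≤ B.d (n + 1 + τ j) j := by
      rw [h.isCA.d_symm]; exact inf_le_right.trans (hd j)
    exact (le_inf ((le_inf (inf_le_right.trans (hd i)) (inf_le_left.trans hk)).trans
      (h.isCA.d_trans _ _ _)) h1).trans (h.isCA.d_trans _ _ _)

theorem samePoint_equivalence : Equivalence (SamePoint n p) where
  refl j := ⟨0, by rw [h.isCA.d_self]; exact le_top⟩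
  symm := fun ⟨k, hk⟩ => ⟨k, by rwa [h.isCA.d_symm]⟩
  trans := fun ⟨k, hk⟩ ⟨l, hl⟩ => ⟨max k l, (le_inf ((g.anti (le_max_left _ _)).trans hk)
    ((g.anti (le_max_right _ _)).trans hl)).trans (h.isCA.d_trans _ _ _)⟩

theorem force_congr {τ τ' : Fin n → ℕ} {x : B} (hτ : ∀ m, SamePoint n p (τ m) (τ' m))
    (hx : Force p τ x) : Force p τ' x := by
  obtain ⟨k, hk⟩ := hx
  choose l hl using hτ
  refine ⟨max k (Finset.univ.sup l), le_trans (le_inf (inf_le_left.trans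
    (g.anti (le_max_left _ _))) ?_) hk⟩
  unfold nameEl CylSig.diagInf
  refine Finset.le_inf fun m _ => ?_
  have h1 : p (max k (Finset.univ.sup l)) ≤ B.d (n + 1 + τ' m) (n + 1 + τ m) := by
    rw [h.isCA.d_symm]
    exact (g.anti ((Finset.le_sup (Finset.mem_univ m)).trans (le_max_right _ _))).trans (hl m)
  refine le_trans (le_inf (inf_le_right.trans ?_) (inf_le_left.trans h1)) (h.isCA.d_trans _ _ _)
  exact Finset.inf_le (Finset.mem_univ m)

theorem force_update_congr {τ : Fin n → ℕ} {i : Fin n} {j j' : ℕ} {x : B}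
    (hj : SamePoint n p j j') (hx : Force p (Function.update τ i j) x) :
    Force p (Function.update τ i j') x := by
  refine g.force_congr h (fun m => ?_) hx
  rcases eq_or_ne m i with rfl | hm
  · simpa using hj
  · simpa [hm] using (g.samePoint_equivalence h).refl _

theorem inOpen_congr {j j' : ℕ} {y : B} (hj : SamePoint n p j j') (hy : InOpen n p y j) :
    InOpen n p y j' := by
  obtain ⟨k, hk⟩ := hy
  obtain ⟨l, hl⟩ := hj
  refine ⟨max k l, le_trans (le_inf (inf_le_left.trans (g.anti (le_max_left _ _))) ?_) hk⟩
  refine le_trans (le_inf inf_le_right (inf_le_left.trans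
    ((g.anti (le_max_right _ _)).trans hl))) ?_
  rw [h.isCA.d_symm (n + 1 + j)]
  exact h.isCA.d_trans _ _ _

theorem inOpen_finset_inf {T : Finset ((Fin n → ℕ) × Fin n × A)} {j : ℕ} :
    InOpen n p (T.inf (openEl f)) j ↔ ∀ t ∈ T, InOpen n p (openEl f t) j := by
  classical
  unfold InOpen
  simp only [h.isTCA.I_finset_inf, Finset.le_inf_iff]
  refine ⟨fun ⟨k, hk⟩ t ht => ⟨k, hk t ht⟩, fun hT => ?_⟩
  choose! k hk using hT
  exact ⟨T.sup k, fun t ht => (inf_le_inf_right _ (g.anti (Finset.le_sup ht))).trans (hk t ht)⟩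

theorem force_c {τ : Fin n → ℕ} {i : Fin n} {j : ℕ} {x : A}
    (hx : Force p (Function.update τ i j) (f x)) : Force p τ (f (A.c i x)) := by
  obtain ⟨k, hk⟩ := hx
  refine ⟨k, ?_⟩
  rw [nameEl_update, inf_left_comm] at hk
  have h1 := h.isCA.c_mono (i := (i : ℕ)) hk
  rw [h.isCA.c_inf_right (h.isCA.fixed_inf ((g.cond k).fixed i i.2.le)
    (nameErase_fixed_self h.isCA τ i)), h.isCA.c_d_top (by have := i.2; omega), top_inf_eq,
    ← h.map_c] at h1
  refine le_trans (inf_le_inf_left _ ?_) h1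
  rw [nameEl_eq τ i]
  exact inf_le_right

/-- An inequality need only be checked below a diagonal element with the auxiliary coordinate. -/
theorem le_of_inf_d_le {k : ℕ} {τ : Fin n → ℕ} {j : ℕ} {x : A}
    (hx : p k ⊓ nameEl B.toCylSig τ ⊓ B.d n (n + 1 + j) ≤ f x) :
    p k ⊓ nameEl B.toCylSig τ ≤ f x := by
  rwa [inf_comm, ← h.isCA.c_le_iff (h.fixed x n le_rfl), h.isCA.c_inf_right
    (h.isCA.fixed_inf ((g.cond k).fixed n le_rfl) (nameEl_fixed h.isCA τ)),
    h.isCA.c_d_top (by omega), top_inf_eq] at hx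

omit g in
theorem nameEl_inf_d_le (τ : Fin n → ℕ) (i : Fin n) :
    nameEl B.toCylSig τ ⊓ B.d n (n + 1 + τ i) ≤ B.d i n ⊓ nameErase B.toCylSig τ i := by
  rw [nameEl_eq τ i]
  refine le_inf (le_trans (inf_le_inf_right _ inf_le_left) ?_) (inf_le_left.trans inf_le_right)
  rw [h.isCA.d_symm n]
  exact h.isCA.d_trans _ _ _

/-- The basic open set attached to `(τ, i, x)` contains the point `τ i` as soon as `A.I i x` holds
at `τ`: the interior along `i` is renamed to one along `n`. -/
theorem inOpen_of_force_I {τ : Fin n → ℕ} {i : Fin n} {x : A}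
    (hx : Force p τ (f (A.I i x))) : InOpen n p (openEl f (τ, i, x)) (τ i) := by
  obtain ⟨k, hk⟩ := hx
  refine ⟨k, le_of_inf_nameEl_le h.isCA (τ := τ) (fun m hm => ?_) (fun m hm => ?_) ?_⟩
  · exact h.isCA.fixed_inf ((g.cond k).fixed m hm.le) (h.isCA.fixed_d hm.ne (by omega))
  · exact h.isTCA.fixed_I hm.ne (h.openEl_fixed _ hm)
  · have e1 := h.d_inf_I_openEl i.2 (h.openEl_fixed (τ, i, x) i.2)
    have e2 := h.nameErase_inf_I_openEl τ i x
    have h1 : p k ⊓ B.d n (n + 1 + τ i) ⊓ nameEl B.toCylSig τ ≤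
        B.d i n ⊓ nameErase B.toCylSig τ i := by
      rw [inf_assoc, inf_comm (B.d n _)]
      exact inf_le_right.trans (nameEl_inf_d_le h τ i)
    have h2 : p k ⊓ B.d n (n + 1 + τ i) ⊓ nameEl B.toCylSig τ ≤ f (A.I i x) :=
      (inf_le_inf_right _ inf_le_left).trans hk
    have h3 := le_inf (h1.trans inf_le_right) h2
    rw [← e2] at h3
    have h4 := le_inf (h1.trans inf_le_left) (h3.trans inf_le_right)
    rw [← e1] at h4
    exact h4.trans inf_le_right

/-- The basic open set is contained in the set defined by `x`, because interiors shrink. -/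
theorem force_of_inOpen {τ : Fin n → ℕ} {i : Fin n} {x : A} {j : ℕ}
    (hj : InOpen n p (openEl f (τ, i, x)) j) : Force p (Function.update τ i j) (f x) := by
  obtain ⟨k, hk⟩ := hj
  refine ⟨k, g.le_of_inf_d_le h (j := j) ?_⟩
  have e1 := h.d_inf_I_openEl i.2 (h.openEl_fixed (τ, i, x) i.2)
  have e2 := h.nameErase_inf_I_openEl τ i x
  have h1 : p k ⊓ nameEl B.toCylSig (Function.update τ i j) ⊓ B.d n (n + 1 + j) ≤
      B.d i n ⊓ nameErase B.toCylSig τ i := by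
    have h0 := nameEl_inf_d_le h (Function.update τ i j) i
    rw [Function.update_self, nameErase_update] at h0
    rw [inf_assoc]
    exact inf_le_right.trans h0
  have h2 := le_inf (h1.trans inf_le_left) (le_trans (inf_le_inf_right _ inf_le_left) hk)
  rw [e1] at h2
  have h3 := le_inf (h1.trans inf_le_right) (h2.trans inf_le_right)
  rw [e2] at h3
  exact h3.trans (inf_le_right.trans ((h.le_iff _ _).2 (h.I_le i x)))

/-- By genericity an inclusion true of all named points is forced by some condition, the alternative
being a named counterexample. Applying `I i` to the forced inclusion, with `I_le_I_I`, places the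
point in the interior of `x`. -/
theorem force_I_of_inOpen {T : Finset ((Fin n → ℕ) × Fin n × A)} (hT : ∀ t ∈ T, t.2.2 ∈ 𝒴)
    {τ : Fin n → ℕ} {i : Fin n} {x : A} (hx : x ∈ 𝒴)
    (hτ : InOpen n p (T.inf (openEl f)) (τ i))
    (hsub : ∀ j, InOpen n p (T.inf (openEl f)) j → Force p (Function.update τ i j) (f x)) :
    Force p τ (f (A.I i x)) := by
  have e1 := h.d_inf_I_openEl i.2
    (h.isCA.fixed_finset_inf T (openEl f) fun t _ => h.openEl_fixed t i.2)
  obtain ⟨k, hk | ⟨j, hk⟩⟩ := g.decide_open T hT τ i x hx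
  · obtain ⟨l, hl⟩ := hτ
    refine ⟨max k l, g.le_of_inf_d_le h (j := τ i) ?_⟩
    have h1 : p (max k l) ⊓ nameEl B.toCylSig τ ⊓ B.d n (n + 1 + τ i) ≤
        B.d i n ⊓ nameErase B.toCylSig τ i := by
      rw [inf_assoc]
      exact inf_le_right.trans (nameEl_inf_d_le h τ i)
    have h2 := le_inf (h1.trans inf_le_left) (le_trans (inf_le_inf_right _
      (inf_le_left.trans (g.anti (le_max_right _ _)))) hl)
    rw [e1] at h2
    have h3 := h.isTCA.inf_I_le (h.isCA.fixed_inf ((g.cond k).fixed i i.2.le)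
      (nameErase_fixed_self h.isCA τ i)) hk
    rw [← h.map_I] at h3
    refine le_trans (le_inf (le_inf (inf_le_left.trans (inf_le_left.trans
      (g.anti (le_max_left _ _)))) (h1.trans inf_le_right)) ((h2.trans inf_le_right).trans
        (h.isTCA.I_le_I_I _ _))) h3
  · have hopen : InOpen n p (T.inf (openEl f)) j := by
      refine ⟨k, le_of_inf_nameEl_le h.isCA (τ := Function.update τ i j) (fun m hm => ?_)
        (fun m hm => ?_) ?_⟩
      · exact h.isCA.fixed_inf ((g.cond k).fixed m hm.le) (h.isCA.fixed_d hm.ne (by omega))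
      · exact h.isTCA.fixed_I hm.ne (h.isCA.fixed_finset_inf _ _ fun t _ => h.openEl_fixed t hm)
      · have h1 : p k ⊓ B.d n (n + 1 + j) ⊓ nameEl B.toCylSig (Function.update τ i j) ≤
            B.d i n := by
          have h0 := nameEl_inf_d_le h (Function.update τ i j) i
          rw [Function.update_self] at h0
          rw [inf_assoc, inf_comm (B.d n _)]
          exact inf_le_right.trans (h0.trans inf_le_left)
        have h2 := le_inf h1 ((inf_le_inf_right _ inf_le_left).trans (hk.trans inf_le_left))
        rw [← e1] at h2
        exact h2.trans inf_le_right
    have h1 := g.force_inf (hsub j hopen) ⟨k, hk.trans inf_le_right⟩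
    rw [inf_compl_eq_bot] at h1
    exact (g.not_force_bot h _ h1).elim

end IsGeneric
end TopCylSig

-- Atom models from generic sequences.

universe v
namespace TopCylSig

variable {n : ℕ} {A : TopCylSig.{u} (Fin n)}

/-- An assignment of atoms to the sequences of points of a topological space, as it arises from a
representation. Witnesses for cylindrifications are required for the sets in `𝒳`, the description
of interiors for the elements of `𝒴`. -/
structure IsAtomModel (A : TopCylSig.{u} (Fin n)) (𝒳 : Set (Set A)) (𝒴 : Set A) {U : Type v}
    [TopologicalSpace U] (N : (Fin n → U) → A) : Prop where
  isAtom : ∀ s, IsAtom (N s)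
  le_d : ∀ s i j, N s ≤ A.d i j ↔ s i = s j
  le_c : ∀ s i u, N s ≤ A.c i (N (Function.update s i u))
  witness : ∀ X ∈ 𝒳, ∀ s i, (∃ b ∈ X, N s ≤ A.c i b) →
    ∃ u, ∃ b ∈ X, N (Function.update s i u) ≤ b
  interior : ∀ x ∈ 𝒴, ∀ s i, N s ≤ A.I i x ↔
    s i ∈ interior {u | N (Function.update s i u) ≤ x}

/-- Provides the initial condition: the first `n` names are distinct and unconstrained, so they may
be required to satisfy `a`. -/
theorem IsNeatEmbedding.exists_cond {B : TopCylSig.{u} ℕ} {f : A → B} (h : IsNeatEmbedding f)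
    {a : A} (ha : a ≠ ⊥) : ∃ p, B.IsCond n p ∧ p ⊓ nameEl B.toCylSig (fun i : Fin n => (i : ℕ)) ≤ f a := by
  have key : ∀ S : Finset (Fin n), B.diagInf S (names n fun i : Fin n => (i : ℕ)) ⊓ f a ≠ ⊥ := by
    intro S
    induction S using Finset.induction_on with
    | empty => simpa [CylSig.diagInf] using h.ne_bot ha
    | insert m S hm ih =>
      intro h0
      apply ih
      rw [CylSig.diagInf, Finset.inf_insert, inf_assoc, h.isCA.d_symm,
        ← h.isCA.c_eq_bot (i := names n (fun i : Fin n => (i : ℕ)) m), h.isCA.c_inf_right,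
        h.isCA.c_d_top, top_inf_eq] at h0
      · exact h0
      · exact (m.2.trans (lt_names _ m)).ne'
      · refine h.isCA.fixed_inf (h.isCA.diagInf_fixed (fun i _ => ?_) fun i hi => ?_)
          (h.fixed a _ (lt_names _ m).le)
        · exact (i.2.trans (lt_names _ m)).ne'
        · intro e
          refine hm ?_
          rwa [Fin.ext (Nat.add_left_cancel e : (m : ℕ) = i)]
  have htop : B.IsCond n ⊤ :=
    ⟨fun h0 => h.ne_bot ha (le_bot_iff.1 (le_top.trans h0.le)), fun k _ => h.isCA.c_top k,
      ⟨0, fun k _ => h.isCA.c_top k⟩⟩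
  obtain ⟨p, h1, -, h2⟩ := h.isCA.exists_cond_le htop (lt_names fun i : Fin n => (i : ℕ))
    (h.fixed a n le_rfl) (h.finDim a) (by rw [top_inf_eq]; exact key _)
  exact ⟨p, h1, h2⟩

/-- Points are names modulo forced equality, and a sequence of points is assigned the atom forced at
representatives of them. -/
theorem IsNeatEmbedding.exists_isAtomModel {B : TopCylSig.{u} ℕ} {f : A → B}
    (h : IsNeatEmbedding f) [IsAtomic A] {𝒳 : Set (Set A)} {𝒴 : Set A}
    (h𝒳 : 𝒳.Countable) (h𝒴 : 𝒴.Countable) {a : A} (ha : IsAtom a) :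
    ∃ (U : Type) (_ : TopologicalSpace U) (N : (Fin n → U) → A),
      IsAtomModel A 𝒳 𝒴 N ∧ ∃ s, N s = a := by
  classical
  obtain ⟨p0, hp0, hpa⟩ := h.exists_cond ha.1
  obtain ⟨p, g, rfl⟩ := h.exists_isGeneric h𝒳 h𝒴 hp0
  let _ : Setoid ℕ := ⟨SamePoint n p, g.samePoint_equivalence h⟩
  let U := Quotient (inferInstance : Setoid ℕ)
  let nm : (Fin n → U) → Fin n → ℕ := fun s i => (s i).out
  have hnm : ∀ s i (u : U), nm (Function.update s i u) = Function.update (nm s) i u.out :=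
    fun s i u => by
      ext m
      rcases eq_or_ne m i with rfl | hm
      · simp [nm]
      · simp [nm, hm]
  have hat : ∀ s, ∃ b, IsAtom b ∧ Force p (nm s) (f b) := fun s => by
    obtain ⟨k, b, hb, hk⟩ := g.atom (nm s)
    exact ⟨b, hb, k, hk⟩
  choose N hN1 hN2 using hat
  have hle : ∀ s x, N s ≤ x ↔ Force p (nm s) (f x) := fun s x =>
    g.le_iff_force h (hN1 s) (hN2 s)
  have hout : ∀ j : ℕ, SamePoint n p j (Quotient.out (⟦j⟧ : U)) := fun j =>
    (g.samePoint_equivalence h).symm (Quotient.mk_out j)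
  have hleu : ∀ s i j x, Force p (Function.update (nm s) i j) (f x) →
      N (Function.update s i (⟦j⟧ : U)) ≤ x := fun s i j x hj => by
    rw [hle, hnm]
    exact g.force_update_congr h (hout j) hj
  let O : (Fin n → ℕ) × Fin n × A → Set U := fun t => {u | InOpen n p (openEl f t) u.out}
  -- Only elements of `𝒴` contribute open sets, so finite intersections of these sets are covered by
  -- `decide_open`.
  let top : TopologicalSpace U := .generateFrom (O '' {t | t.2.2 ∈ 𝒴})
  refine ⟨U, top, N, ⟨hN1, fun s i j => ?_, fun s i u => ?_, fun X hX s i ⟨b, hb, hsb⟩ => ?_,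
    fun x hx s i => ?_⟩, ?_⟩
  · rw [hle, h.map_d, g.force_d h]
    refine ⟨fun hs => ?_, fun hs => ?_⟩
    · rw [← Quotient.out_eq (s i), ← Quotient.out_eq (s j)]
      exact Quotient.sound hs
    · show SamePoint n p (Quotient.out (s i)) (Quotient.out (s j))
      rw [hs]
      exact (g.samePoint_equivalence h).refl _
  · rw [hle]
    refine g.force_c h (j := u.out) ?_
    rw [← hnm]
    exact hN2 _
  · obtain ⟨k, ⟨c, hc, hk, hcX⟩ | ⟨c, hc, j, hk⟩⟩ := g.witness (nm s) i X hX
    · have h1 : N s ≤ c := (hle s c).2 ⟨k, hk⟩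
      have h2 : N s = c := (hc.le_iff.1 h1).resolve_left (hN1 s).1
      exact (hcX b hb (h2 ▸ hsb)).elim
    · exact ⟨⟦j⟧, c, hc, hleu s i j c ⟨k, hk⟩⟩
  · constructor
    · intro hs
      have h1 := g.inOpen_of_force_I h ((hle _ _).1 hs)
      refine mem_interior.2 ⟨O (nm s, i, x), fun u hu => ?_,
        TopologicalSpace.isOpen_generateFrom_of_mem ⟨_, hx, rfl⟩, h1⟩
      have h2 := g.force_of_inOpen h hu
      rw [← hnm] at h2
      exact (hle _ _).2 h2
    · intro hs
      obtain ⟨_, ⟨F, ⟨hF, hFO⟩, rfl⟩, h1, h2⟩ :=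
        (TopologicalSpace.isTopologicalBasis_of_subbasis (t := top) rfl).mem_nhds_iff.1
          (mem_interior_iff_mem_nhds.1 hs)
      lift F to Finset (Set U) using hF
      obtain ⟨T, hT, rfl⟩ := Finset.subset_set_image_iff.1 hFO
      have hmem : ∀ u : U, u ∈ ⋂₀ (T.image O : Set (Set U)) ↔
          InOpen n p (T.inf (openEl f)) u.out := fun u => by
        rw [g.inOpen_finset_inf h]
        simp [O]
      rw [hle]
      refine g.force_I_of_inOpen h (T := T) (fun t ht => hT ht) hx ((hmem _).1 h1) fun j hj => ?_
      have h3 : N (Function.update s i (⟦j⟧ : U)) ≤ x :=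
        h2 ((hmem _).2 (g.inOpen_congr h (hout j) hj))
      rw [hle, hnm] at h3
      exact g.force_update_congr h ((g.samePoint_equivalence h).symm (hout j)) h3
  · refine ⟨fun i => (⟦(i : ℕ)⟧ : U), ?_⟩
    have h1 : Force p (fun i : Fin n => (i : ℕ)) (f a) := ⟨0, hpa⟩
    suffices h2 : Force p (nm fun i => (⟦(i : ℕ)⟧ : U)) (f a) from
      (ha.le_iff.1 ((hle _ _).2 h2)).resolve_left (hN1 _).1
    exact g.force_congr h (fun m => hout m) h1

end TopCylSig

/-! ### Complete representations of countable neat reducts. -/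

namespace TopCylSig

variable {n : ℕ} {A : TopCylSig.{u} (Fin n)}

theorem IsAtomModel.ulift {𝒳 : Set (Set A)} {𝒴 : Set A} {U : Type} [TopologicalSpace U]
    {N : (Fin n → U) → A} (h : IsAtomModel A 𝒳 𝒴 N) :
    IsAtomModel A 𝒳 𝒴 fun s : Fin n → ULift.{v} U => N fun i => (s i).down := by
  have hupd : ∀ (s : Fin n → ULift.{v} U) (i : Fin n) (u : ULift.{v} U),
      (fun j => (Function.update s i u j).down) =
        Function.update (fun j => (s j).down) i u.down := fun s i u => by
    ext j
    rcases eq_or_ne j i with rfl | hj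
    · simp
    · simp [hj]
  refine ⟨fun s => h.isAtom _, fun s i j => (h.le_d _ i j).trans ULift.down_inj, fun s i u => ?_,
    fun X hX s i hs => ?_, fun x hx s i => ?_⟩
  · rw [hupd]
    exact h.le_c _ i _
  · obtain ⟨u, b, hb, hu⟩ := h.witness X hX _ i hs
    exact ⟨⟨u⟩, b, hb, by rwa [hupd]⟩
  · rw [h.interior x hx]
    simp only [hupd]
    exact Set.ext_iff.1 (Homeomorph.ulift.preimage_interior
      {u | N (Function.update (fun j => (s j).down) i u) ≤ x}) (s i)

/-- Subsets of an atom model that belong to the elements of the algebra. -/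
theorem completelyRepresentable_of_isAtomModel [IsAtomic A] (hA : A.toCylSig.IsCA)
    (h : ∀ a : A, IsAtom a → ∃ (U : Type u) (_ : TopologicalSpace U) (N : (Fin n → U) → A),
      IsAtomModel A (Set.range singleton) Set.univ N ∧ ∃ s, N s = a) :
    A.CompletelyRepresentable := by
  have h' : ∀ a : {a : A // IsAtom a}, ∃ (U : Type u) (_ : TopologicalSpace U)
      (N : (Fin n → U) → A), IsAtomModel A (Set.range singleton) Set.univ N ∧ ∃ s, N s = a :=
    fun a => h a.1 a.2
  choose U top N hN hs using h'
  let f : BoundedLatticeHom A (Set (Σ a : {a : A // IsAtom a}, Fin n → U a)) :=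
    { toFun := fun x => {p | N p.1 p.2 ≤ x}
      map_sup' := fun x y => Set.ext fun p => by
        have h1 := ((hN p.1).isAtom p.2).not_disjoint_iff_le (b := x ⊔ y)
        rw [disjoint_sup_right, not_and_or, IsAtom.not_disjoint_iff_le ((hN p.1).isAtom p.2),
          IsAtom.not_disjoint_iff_le ((hN p.1).isAtom p.2)] at h1
        exact h1.symm
      map_inf' := fun x y => Set.ext fun p => le_inf_iff
      map_top' := Set.ext fun p => iff_of_true le_top trivial
      map_bot' := Set.ext fun p =>
        iff_of_false (fun h0 => ((hN p.1).isAtom p.2).1 (le_bot_iff.1 h0)) id }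
  have hf : ∀ x p, p ∈ f x ↔ N p.1 p.2 ≤ x := fun _ _ => Iff.rfl
  refine ⟨_, U, top, f, fun x y hxy => ?_, ⟨⟨fun i x => Set.ext fun p => ⟨fun hp => ?_, ?_⟩,
    fun i j => Set.ext fun p => (hN p.1).le_d p.2 i j⟩,
    fun i x => Set.ext fun p => (hN p.1).interior x trivial p.2 i⟩, fun X x hx => ?_⟩
  · refine BooleanAlgebra.eq_iff_atom_le_iff.2 fun a ha => ?_
    obtain ⟨s, hsa⟩ := hs ⟨a, ha⟩
    have := Set.ext_iff.1 hxy ⟨⟨a, ha⟩, s⟩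
    rwa [hf, hf, hsa] at this
  · obtain ⟨u, b, rfl, hu⟩ := (hN p.1).witness {x} ⟨x, rfl⟩ p.2 i ⟨x, rfl, hp⟩
    exact ⟨u, hu⟩
  · rintro ⟨u, hu⟩
    exact ((hN p.1).le_c p.2 i u).trans (hA.c_mono hu)
  · ext p
    simp only [Set.mem_iInter]
    exact le_isGLB_iff hx

/-- For countable `A`, one generic sequence handles all singletons as witness sets and all
interiors; the models obtained for the various atoms together give a complete representation. -/
theorem IsNeatReduct.uncountable (h : A.IsNeatReduct n) (hat : IsAtomic A)
    (hc : ¬ A.CompletelyRepresentable) : Uncountable A := by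
  by_contra hu
  have := not_uncountable_iff.1 hu
  obtain ⟨B, f, hf⟩ := h.exists_isNeatEmbedding
  refine hc (completelyRepresentable_of_isAtomModel hf.reduct_isCA fun a ha => ?_)
  obtain ⟨U, _, N, hN, s, hs⟩ := hf.exists_isAtomModel (Set.countable_range singleton)
    Set.countable_univ ha
  exact ⟨ULift.{u} U, inferInstance, _, hN.ulift, fun i => ⟨s i⟩, hs⟩

end TopCylSig

/-! ### Strong representability by ultraproducts of atom models. -/

namespace TopCylSig

open Filter

variable {n : ℕ} {A : TopCylSig.{u} (Fin n)}

/-- An ultraproduct of atom models represents the complex algebra of the atom structure, provided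
that each set of atoms has witnesses in one of the models. -/
theorem cmAt_representable_of_isAtomModel
    (h : ∀ (𝒳 : Finset (Set {a : A // IsAtom a})) (a : {a : A // IsAtom a}),
      ∃ (U : Type u) (_ : TopologicalSpace U) (N : (Fin n → U) → A),
        IsAtomModel A ((fun X => Subtype.val '' X) '' (𝒳 : Set (Set {a : A // IsAtom a}))) ∅ N ∧
          ∃ s, N s = a) :
    A.toCylSig.cmAt.Representable := by
  classical
  choose U top N hN s₀ hs₀ using h
  -- For each set `X` of atoms, almost all of the finite families contain `X`, so almost all models
  -- have witnesses for it.
  let F : Ultrafilter (Finset (Set {a : A // IsAtom a})) := Ultrafilter.of atTop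
  have hF : ∀ X : Set {a : A // IsAtom a}, ∀ᶠ 𝒳 in (F : Filter (Finset _)), X ∈ 𝒳 := fun X =>
    ((eventually_ge_atTop {X}).filter_mono (Ultrafilter.of_le atTop)).mono fun _ h𝒳 =>
      Finset.singleton_subset_iff.1 h𝒳
  let W : {a : A // IsAtom a} → Type u := fun a => (F : Filter _).Product fun 𝒳 => U 𝒳 a
  let M : ∀ p : (Σ a, Fin n → W a), Finset (Set {a : A // IsAtom a}) → {a : A // IsAtom a} :=
    fun p 𝒳 => ⟨N 𝒳 p.1 fun i => (p.2 i).out 𝒳, (hN 𝒳 p.1).isAtom _⟩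
  have hout : ∀ (a : {a : A // IsAtom a}) (u : ∀ 𝒳, U 𝒳 a),
      ∀ᶠ 𝒳 in F, (Quotient.out (Quotient.mk _ u : W a) : ∀ 𝒳, U 𝒳 a) 𝒳 = u 𝒳 := fun a u =>
    Quotient.mk_out (s := productSetoid (F : Filter _) fun 𝒳 => U 𝒳 a) u
  have hupd : ∀ (p : Σ a, Fin n → W a) (i : Fin n) (u : W p.1) 𝒳,
      (M ⟨p.1, Function.update p.2 i u⟩ 𝒳 : A) =
        N 𝒳 p.1 (Function.update (fun m => (p.2 m).out 𝒳) i (u.out 𝒳)) := fun p i u 𝒳 => by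
    refine congrArg (N 𝒳 p.1) (funext fun m => ?_)
    rcases eq_or_ne m i with rfl | hm
    · simp
    · simp [hm]
  let f : BoundedLatticeHom (Set {a : A // IsAtom a}) (Set (Σ a, Fin n → W a)) :=
    { toFun := fun X => {p | ∀ᶠ 𝒳 in F, M p 𝒳 ∈ X}
      map_sup' := fun X Y => Set.ext fun p => Ultrafilter.eventually_or
      map_inf' := fun X Y => Set.ext fun p => eventually_and
      map_top' := Set.ext fun p => iff_of_true (Eventually.of_forall fun _ => trivial) trivial
      map_bot' := Set.ext fun p => iff_of_false (fun h0 => h0.exists.choose_spec) id }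
  have hf : ∀ X p, p ∈ f X ↔ ∀ᶠ 𝒳 in F, M p 𝒳 ∈ X := fun _ _ => Iff.rfl
  refine ⟨_, W, f, fun X Y hXY => Set.ext fun a => ?_, ⟨fun i X => Set.ext fun p =>
    ⟨fun hp => ?_, ?_⟩, fun i j => Set.ext fun p => ?_⟩⟩
  · have hM : ∀ᶠ 𝒳 in F, M ⟨a, fun m => Quotient.mk _ fun 𝒳 => s₀ 𝒳 a m⟩ 𝒳 = a := by
      filter_upwards [eventually_all.2 fun m => hout a fun 𝒳 => s₀ 𝒳 a m] with 𝒳 h𝒳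
      refine Subtype.ext (Eq.trans (congrArg (N 𝒳 a) (funext h𝒳)) (hs₀ 𝒳 a))
    have key : ∀ X, ⟨a, fun m => Quotient.mk _ fun 𝒳 => s₀ 𝒳 a m⟩ ∈ f X ↔ a ∈ X := fun X => by
      rw [hf, eventually_congr (hM.mono fun 𝒳 h𝒳 => by rw [h𝒳])]
      exact eventually_const
    rw [← key, ← key, hXY]
  · have hw : ∀ 𝒳, ∃ u : U 𝒳 p.1, X ∈ 𝒳 → (∃ b ∈ X, (M p 𝒳 : A) ≤ A.c i b) →
        ∃ b ∈ X, N 𝒳 p.1 (Function.update (fun m => (p.2 m).out 𝒳) i u) = b := fun 𝒳 => by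
      by_cases hX : X ∈ 𝒳 ∧ ∃ b ∈ X, (M p 𝒳 : A) ≤ A.c i b
      · obtain ⟨hX, b, hb, hpb⟩ := hX
        obtain ⟨u, _, ⟨c, hc, rfl⟩, hu⟩ := (hN 𝒳 p.1).witness _ ⟨X, hX, rfl⟩ _ i
          ⟨b, ⟨b, hb, rfl⟩, hpb⟩
        exact ⟨u, fun _ _ => ⟨c, hc, (c.2.le_iff.1 hu).resolve_left ((hN 𝒳 p.1).isAtom _).1⟩⟩
      · exact ⟨(p.2 i).out 𝒳, fun h1 h2 => (hX ⟨h1, h2⟩).elim⟩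
    choose u hu using hw
    refine ⟨Quotient.mk _ u, ?_⟩
    rw [hf]
    filter_upwards [(hf _ _).1 hp, hF X, hout p.1 u] with 𝒳 h1 h2 h3
    obtain ⟨b, hb, hub⟩ := hu 𝒳 h2 h1
    rw [← h3] at hub
    exact (Subtype.ext ((hupd _ _ _ _).trans hub) : M _ 𝒳 = b) ▸ hb
  · rintro ⟨u, hu⟩
    rw [hf] at hu ⊢
    refine hu.mono fun 𝒳 h𝒳 => ⟨_, h𝒳, ?_⟩
    rw [hupd]
    exact (hN 𝒳 p.1).le_c _ i _
  · rw [hf]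
    refine (eventually_congr (Eventually.of_forall fun 𝒳 => (hN 𝒳 p.1).le_d _ i j)).trans ?_
    exact Quotient.out_equiv_out (s := productSetoid (F : Filter _) fun 𝒳 => U 𝒳 p.1)

/-- Finitely many sets of atoms are countably many requirements whatever the size of `A`; no
interiors are described, as only the cylindric reduct is concerned. -/
theorem IsNeatReduct.stronglyRepresentable (h : A.IsNeatReduct n) (hat : IsAtomic A) :
    A.toCylSig.StronglyRepresentable := by
  obtain ⟨B, f, hf⟩ := h.exists_isNeatEmbedding
  refine ⟨hat, hf.reduct_isCA.completelyAdditive, cmAt_representable_of_isAtomModel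
    fun 𝒳 a => ?_⟩
  obtain ⟨U, _, N, hN, s, hs⟩ := hf.exists_isAtomModel
    (𝒳.countable_toSet.image fun X => Subtype.val '' X) Set.countable_empty a.2
  exact ⟨ULift.{u} U, inferInstance, _, hN.ulift, fun i => ⟨s i⟩, hs⟩

end TopCylSig

theorem mainTheorem6 :
    (∀ n : ℕ, 2 < n →
      (∃ A : TopCylSig.{u} (Fin n), A.IsNeatReduct n ∧ IsAtomic A ∧ Uncountable A ∧
        ¬ A.CompletelyRepresentable ∧ ¬ A.toCylSig.DfCompletelyRepresentable) ∧
      (∀ A : TopCylSig.{u} (Fin n), A.IsNeatReduct n → IsAtomic A →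
        ¬ A.CompletelyRepresentable → Uncountable A)) ∧
    (∀ n : ℕ, 1 < n →
      ∃ A : TopCylSig.{u} (Fin n), A.IsTCA ∧ Countable A ∧
        A.CompletelyRepresentable ∧ A.StronglyRepresentable ∧
        ¬ TopCylSig.Up (TopCylSig.Ur (TopCylSig.IsNeatReduct n)) A ∧ ¬ A.IsNeatReduct n) ∧
    (∀ (n : ℕ) (A : TopCylSig.{u} (Fin n)), A.IsNeatReduct n → IsAtomic A →
      A.toCylSig.StronglyRepresentable) :=
  ⟨fun n hn => ⟨exists_not_completelyRepresentable n hn,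
      fun _ h hat => h.uncountable hat⟩,
    fun n hn => exists_not_up_ur n hn, fun _ _ h hat => h.stronglyRepresentable hat⟩
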